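/- **Theorem 2.** Consider finite oriented graphs with $J$ vertices, $K>0$ infinite leads $e_1,\dots,e_K$ (each attached to one vertex) and $M$ finite edges $e_{K+1},\dots,e_{K+M}$ (each joining two distinct vertices). Give each finite edge $e_m$ a length $\ell_m>0$ and set $\ell_k=\infty$ for the leads. On $L^2=\bigoplus_{m=1}^{K+M}L^2([0,\ell_m])$ let $P$ be the operator $(Pu)_m=-\partial_x^2u_m$ whose domain $\mathcal D(P)$ consists of all $u$ such that $u_m\in H^2([0,\ell_m])$ for every $m$, all edges meeting at a vertex take a common value there, and the outward normal derivatives of the edges meeting at a vertex sum to zero, for every vertex. Let $\operatorname{Res}(P)$ be the set of poles of the meromorphic continuation of $\lambda\mapsto(P-\lambda^2)^{-1}$ from $\operatorname{Im}\lambda>0$ to $\mathbb C$, as a family of operators $L^2_{\rm comp}\to L^2_{\rm loc}$. Write $D(\lambda_0,r)=\{\lambda\in\mathbb C:|\lambda-\lambda_0|<r\}$ and $\mathcal H_R=\bigoplus_{m=1}^{K}L^2([0,R])\oplus\bigoplus_{m=K+1}^{K+M}L^2([0,\ell_m])$, regarded as a subspace of $L^2$ (extension by zero on the leads). Let the numbers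 $J$, $K>0$, $M$ of vertices, leads and finite edges be fixed. For any compact sets $\mathcal L\subset(0,\infty)$ and $I\subset(0,\infty)$, any $R>0$ and any real $\gamma<1$ there exists $\epsilon_0>0$ such that the following holds for every such graph with $J$ vertices, $K$ leads, $M$ finite edges and all lengths $\ell_m\in\mathcal L$: if there are $u\in\mathcal H_R\cap\mathcal D(P)$ and $\lambda_0\in I$ with $$\|u\|_{L^2}=1,\qquad \|(P-\lambda_0^2)u\|_{L^2}=\epsilon,\qquad 0<\epsilon<\epsilon_0,$$ then $\operatorname{Res}(P)\cap D(\lambda_0,\epsilon^\gamma)\neq\emptyset$. -/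

import Mathlib

open MeasureTheory Set

noncomputable section

/-- The combinatorial data of an oriented graph with vertices `Fin J`, infinite leads `Fin K` and
finite edges `Fin M`. A lead starts at one vertex; a finite edge joins two distinct vertices
(multiple edges are allowed). -/
structure LeadGraph (J K M : ℕ) where
  /-- the vertex at the end `x = 0` of a lead -/
  leadVertex : Fin K → Fin J
  /-- the vertex at the end `x = 0` of a finite edge -/
  source : Fin M → Fin J
  /-- the vertex at the end `x = ℓ m` of a finite edge -/
  target : Fin M → Fin J
  no_loop : ∀ m, source m ≠ target m

namespace QGraph

/-- The interval that parametrizes an edge: `[0, ∞)` for a lead, `[0, ℓ m]` for a finite edge. -/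
def edgeSet {K M : ℕ} (ℓ : Fin M → ℝ) : Fin K ⊕ Fin M → Set ℝ
  | Sum.inl _ => Ici 0
  | Sum.inr m => Icc 0 (ℓ m)

/-- Lebesgue measure on an edge. -/
abbrev edgeMeasure {K M : ℕ} (ℓ : Fin M → ℝ) (e : Fin K ⊕ Fin M) : Measure ℝ :=
  volume.restrict (edgeSet ℓ e)

/-- The Hilbert space of the graph: the Hilbert sum of the `L²` spaces of the edges. -/
abbrev L2 (K : ℕ) {M : ℕ} (ℓ : Fin M → ℝ) : Type :=
  PiLp 2 (fun e : Fin K ⊕ Fin M => Lp ℂ 2 (edgeMeasure ℓ e))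

/-- `u`, `u'`, `u''` are a function on the interval `S` (which starts at `0`), its derivative and
its second derivative, as for a function of class `H²`: `u` and `u'` are absolutely continuous
on `S` (and given by their values at every point of `S`), and `u`, `u'`, `u''` are in `L²`. -/
structure IsH2 (S : Set ℝ) (u u' u'' : ℝ → ℂ) : Prop where
  memLp : MemLp u 2 (volume.restrict S)
  memLp' : MemLp u' 2 (volume.restrict S)
  memLp'' : MemLp u'' 2 (volume.restrict S)
  eq_integral : ∀ x ∈ S, u x = u 0 + ∫ t in (0 : ℝ)..x, u' t
  eq_integral' : ∀ x ∈ S, u' x = u' 0 + ∫ t in (0 : ℝ)..x, u'' t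

/-- Continuity at the vertices: all edges that end at a vertex `v` take the same value `c v`
there. -/
def ContinuousAtVertices {J K M : ℕ} (G : LeadGraph J K M) (ℓ : Fin M → ℝ)
    (U : Fin K ⊕ Fin M → ℝ → ℂ) : Prop :=
  ∃ c : Fin J → ℂ, (∀ k, U (Sum.inl k) 0 = c (G.leadVertex k)) ∧
    (∀ m, U (Sum.inr m) 0 = c (G.source m)) ∧ (∀ m, U (Sum.inr m) (ℓ m) = c (G.target m))

/-- The Kirchhoff condition: at every vertex the outward normal derivatives (`-u'` at the end
`x = 0` of an edge, `u'` at the end `x = ℓ m`) add up to zero. -/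
def Kirchhoff {J K M : ℕ} (G : LeadGraph J K M) (ℓ : Fin M → ℝ)
    (U' : Fin K ⊕ Fin M → ℝ → ℂ) : Prop :=
  ∀ v : Fin J, (∑ k with G.leadVertex k = v, -U' (Sum.inl k) 0)
    + (∑ m with G.source m = v, -U' (Sum.inr m) 0)
    + (∑ m with G.target m = v, U' (Sum.inr m) (ℓ m)) = 0

/-- `u` is in the domain of the quantum graph Hamiltonian and `f = -u''`. -/
def HamiltonianRel {J K M : ℕ} (G : LeadGraph J K M) (ℓ : Fin M → ℝ) (u f : L2 K ℓ) : Prop :=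
  ∃ U U' U'' : Fin K ⊕ Fin M → ℝ → ℂ,
    (∀ e, IsH2 (edgeSet ℓ e) (U e) (U' e) (U'' e)) ∧
    (∀ e, u e =ᵐ[edgeMeasure ℓ e] U e) ∧
    (∀ e, f e =ᵐ[edgeMeasure ℓ e] fun x => -U'' e x) ∧
    ContinuousAtVertices G ℓ U ∧ Kirchhoff G ℓ U'

section helpers

theorem edgeSet_sub {K M : ℕ} (ℓ : Fin M → ℝ) (e : Fin K ⊕ Fin M) {x : ℝ}
    (hx : x ∈ edgeSet ℓ e) : uIcc 0 x ⊆ edgeSet ℓ e := by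
  cases e with
  | inl k =>
    have h : (0 : ℝ) ≤ x := hx
    rw [uIcc_of_le h]
    exact fun y hy => hy.1
  | inr m =>
    have h : x ∈ Icc 0 (ℓ m) := hx
    rw [uIcc_of_le h.1]
    exact fun y hy => ⟨hy.1, hy.2.trans h.2⟩

theorem measurableSet_edgeSet {K M : ℕ} (ℓ : Fin M → ℝ) (e : Fin K ⊕ Fin M) :
    MeasurableSet (edgeSet ℓ e) := by
  cases e with
  | inl k => exact measurableSet_Ici
  | inr m => exact measurableSet_Icc

theorem intervalIntegrable_of_memLp {K M : ℕ} {ℓ : Fin M → ℝ} {e : Fin K ⊕ Fin M} {q : ℝ → ℂ}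
    (hq : MemLp q 2 (edgeMeasure ℓ e)) {x : ℝ} (hx : x ∈ edgeSet ℓ e) :
    IntervalIntegrable q volume 0 x := by
  have h1 : MemLp q 2 (volume.restrict (uIcc 0 x)) :=
    hq.mono_measure (Measure.restrict_mono (edgeSet_sub ℓ e hx) le_rfl)
  have : IsFiniteMeasure (volume.restrict (uIcc 0 x)) :=
    ⟨by rw [Measure.restrict_apply_univ]; exact isCompact_uIcc.measure_lt_top⟩
  have h2 : IntegrableOn q (uIcc 0 x) volume := h1.integrable (by norm_num)
  exact h2.intervalIntegrable

theorem IsH2.zero (S : Set ℝ) : IsH2 S 0 0 0 :=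
  ⟨MemLp.zero, MemLp.zero, MemLp.zero, by simp, by simp⟩

theorem IsH2.add {K M : ℕ} {ℓ : Fin M → ℝ} {e : Fin K ⊕ Fin M} {u u' u'' v v' v'' : ℝ → ℂ}
    (hu : IsH2 (edgeSet ℓ e) u u' u'') (hv : IsH2 (edgeSet ℓ e) v v' v'') :
    IsH2 (edgeSet ℓ e) (u + v) (u' + v') (u'' + v'') := by
  refine ⟨hu.memLp.add hv.memLp, hu.memLp'.add hv.memLp', hu.memLp''.add hv.memLp'', ?_, ?_⟩
  · intro x hx
    simp only [Pi.add_apply]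
    rw [intervalIntegral.integral_add (intervalIntegrable_of_memLp hu.memLp' hx)
      (intervalIntegrable_of_memLp hv.memLp' hx), hu.eq_integral x hx, hv.eq_integral x hx]
    ring
  · intro x hx
    simp only [Pi.add_apply]
    rw [intervalIntegral.integral_add (intervalIntegrable_of_memLp hu.memLp'' hx)
      (intervalIntegrable_of_memLp hv.memLp'' hx), hu.eq_integral' x hx, hv.eq_integral' x hx]
    ring

theorem IsH2.smul {S : Set ℝ} {u u' u'' : ℝ → ℂ} (hu : IsH2 S u u' u'') (a : ℂ) :
    IsH2 S (a • u) (a • u') (a • u'') := by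
  refine ⟨hu.memLp.const_smul a, hu.memLp'.const_smul a, hu.memLp''.const_smul a, ?_, ?_⟩
  · intro x hx
    simp only [Pi.smul_apply]
    rw [intervalIntegral.integral_smul, hu.eq_integral x hx, smul_add]
  · intro x hx
    simp only [Pi.smul_apply]
    rw [intervalIntegral.integral_smul, hu.eq_integral' x hx, smul_add]

/-- A primitive that vanishes almost everywhere has an integrand that vanishes almost
everywhere. -/
theorem ae_zero_of_primitive {K M : ℕ} {ℓ : Fin M → ℝ} {e : Fin K ⊕ Fin M} {v w : ℝ → ℂ}
    (hw : MemLp w 2 (edgeMeasure ℓ e)) (hv : v =ᵐ[edgeMeasure ℓ e] 0)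
    (h : ∀ x ∈ edgeSet ℓ e, v x = v 0 + ∫ t in (0 : ℝ)..x, w t) :
    w =ᵐ[edgeMeasure ℓ e] 0 := by
  classical
  set S := edgeSet ℓ e with hS
  have hSm : MeasurableSet S := measurableSet_edgeSet ℓ e
  have hfr : volume (S \ interior S) = 0 := by
    rw [hS]
    cases e with
    | inl k => simp [edgeSet]
    | inr m =>
      refine measure_mono_null (t := {0, ℓ m}) ?_ (by simp [Set.toFinite, Set.Finite.measure_zero])
      intro x hx
      have h1 : x ∈ Icc 0 (ℓ m) := hx.1
      have h2 : x ∉ Ioo 0 (ℓ m) := by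
        have := hx.2
        simpa [edgeSet] using this
      simp only [mem_Icc, mem_Ioo, mem_insert_iff, mem_singleton_iff] at *
      grind
  set W : ℝ → ℂ := S.indicator w with hW
  have hWL : MemLp W 2 volume := (memLp_indicator_iff_restrict hSm).2 hw
  have hWloc : LocallyIntegrable W volume := MemLp.locallyIntegrable hWL (by norm_num)
  have hWint : ∀ a b, IntervalIntegrable W volume a b := fun a b =>
    ((LocallyIntegrable.integrableOn_isCompact hWloc isCompact_uIcc).intervalIntegrable)
  set V : ℝ → ℂ := fun x => v 0 + ∫ t in (0 : ℝ)..x, W t with hV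
  have hVc : Continuous V := continuous_const.add
    (intervalIntegral.continuous_primitive hWint 0)
  have hVv : ∀ x ∈ S, V x = v x := by
    intro x hx
    rw [h x hx, hV]
    simp only
    congr 1
    apply intervalIntegral.integral_congr
    intro t ht
    exact indicator_of_mem (edgeSet_sub ℓ e hx ht) w
  have hV0 : V =ᵐ[volume.restrict (interior S)] 0 := by
    have h1 : v =ᵐ[volume.restrict (interior S)] 0 :=
      ae_mono (Measure.restrict_mono interior_subset le_rfl) hv
    filter_upwards [h1, ae_restrict_mem isOpen_interior.measurableSet] with x hx hxS
    rw [hVv x (interior_subset hxS), hx]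
  have hV1 : EqOn V 0 (interior S) :=
    Measure.eqOn_open_of_ae_eq hV0 isOpen_interior hVc.continuousOn continuousOn_const
  have hWae : ∀ᵐ x, x ∈ interior S → W x = 0 := by
    filter_upwards [LocallyIntegrable.ae_hasDerivAt_integral hWloc] with x hx hxS
    have hd := (hx 0).const_add (v 0)
    have hz : HasDerivAt V 0 x := by
      refine (hasDerivAt_const x (0 : ℂ)).congr_of_eventuallyEq ?_
      filter_upwards [isOpen_interior.mem_nhds hxS] with y hy using hV1 hy
    exact hd.unique hz
  have hnull : ∀ᵐ x, x ∉ S \ interior S := measure_eq_zero_iff_ae_notMem.1 hfr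
  rw [Filter.EventuallyEq, ae_restrict_iff' hSm]
  filter_upwards [hWae, hnull] with x h1 h2 hxS
  have hxi : x ∈ interior S := by
    by_contra hc
    exact h2 ⟨hxS, hc⟩
  have := h1 hxi
  rwa [hW, indicator_of_mem hxS] at this

theorem HamiltonianRel.add {J K M : ℕ} {G : LeadGraph J K M} {ℓ : Fin M → ℝ}
    {u f v g : L2 K ℓ} (hu : HamiltonianRel G ℓ u f) (hv : HamiltonianRel G ℓ v g) :
    HamiltonianRel G ℓ (u + v) (f + g) := by
  obtain ⟨U, U', U'', h1, h2, h3, ⟨c, c1, c2, c3⟩, h5⟩ := hu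
  obtain ⟨V, V', V'', k1, k2, k3, ⟨d, d1, d2, d3⟩, k5⟩ := hv
  refine ⟨fun e => U e + V e, fun e => U' e + V' e, fun e => U'' e + V'' e,
    fun e => (h1 e).add (k1 e), fun e => ?_, fun e => ?_, ⟨c + d, ?_, ?_, ?_⟩, ?_⟩
  · exact (Lp.coeFn_add (u e) (v e)).trans ((h2 e).add (k2 e))
  · refine (Lp.coeFn_add (f e) (g e)).trans ?_
    filter_upwards [h3 e, k3 e] with x hx hy
    simp only [Pi.add_apply, hx, hy]
    ring
  · intro k
    simp [c1, d1]
  · intro m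
    simp [c2, d2]
  · intro m
    simp [c3, d3]
  · intro w
    have := congrArg₂ (· + ·) (h5 w) (k5 w)
    simp only [Pi.add_apply, neg_add, Finset.sum_add_distrib]
    simp only [add_zero] at this
    rw [← this]
    ring

theorem HamiltonianRel.smul {J K M : ℕ} {G : LeadGraph J K M} {ℓ : Fin M → ℝ}
    {u f : L2 K ℓ} (hu : HamiltonianRel G ℓ u f) (a : ℂ) :
    HamiltonianRel G ℓ (a • u) (a • f) := by
  obtain ⟨U, U', U'', h1, h2, h3, ⟨c, c1, c2, c3⟩, h5⟩ := hu
  refine ⟨fun e => a • U e, fun e => a • U' e, fun e => a • U'' e,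
    fun e => (h1 e).smul a, fun e => ?_, fun e => ?_, ⟨a • c, ?_, ?_, ?_⟩, ?_⟩
  · exact (Lp.coeFn_smul a (u e)).trans ((h2 e).const_smul a)
  · refine (Lp.coeFn_smul a (f e)).trans ?_
    filter_upwards [h3 e] with x hx
    simp [hx]
  · intro k
    simp [c1]
  · intro m
    simp [c2]
  · intro m
    simp [c3]
  · intro w
    have := congrArg (a * ·) (h5 w)
    simp only [Pi.smul_apply, smul_eq_mul, ← mul_neg, ← Finset.mul_sum]
    simp only [mul_zero] at this
    rw [← this]
    ring

theorem HamiltonianRel.zero {J K M : ℕ} (G : LeadGraph J K M) (ℓ : Fin M → ℝ) :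
    HamiltonianRel G ℓ 0 0 := by
  refine ⟨fun _ => 0, fun _ => 0, fun _ => 0, fun e => IsH2.zero _, fun e => ?_, fun e => ?_,
    ⟨0, by simp, by simp, by simp⟩, fun v => by simp⟩
  · exact Lp.coeFn_zero _ _ _
  · filter_upwards [Lp.coeFn_zero ℂ 2 (edgeMeasure ℓ e)] with x hx
    simpa using hx

end helpers

/-- The graph of the Hamiltonian as a subspace of `L² × L²`. -/
def hamiltonianGraph {J K M : ℕ} (G : LeadGraph J K M) (ℓ : Fin M → ℝ) :
    Submodule ℂ (L2 K ℓ × L2 K ℓ) where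
  carrier := {p | HamiltonianRel G ℓ p.1 p.2}
  add_mem' hp hq := HamiltonianRel.add hp hq
  zero_mem' := HamiltonianRel.zero G ℓ
  smul_mem' a _ hp := HamiltonianRel.smul hp a

/-- `-u''` is determined by `u`. -/
theorem hamiltonianGraph_functional {J K M : ℕ} (G : LeadGraph J K M) (ℓ : Fin M → ℝ) :
    ∀ p ∈ hamiltonianGraph G ℓ, p.1 = 0 → p.2 = 0 := by
  rintro ⟨u, f⟩ ⟨U, U', U'', h1, h2, h3, -, -⟩ (hu : u = 0)
  subst hu
  have key : ∀ e, f e = 0 := by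
    intro e
    have hU : U e =ᵐ[edgeMeasure ℓ e] 0 :=
      (h2 e).symm.trans (Lp.coeFn_zero ℂ 2 (edgeMeasure ℓ e))
    have hU' := ae_zero_of_primitive (h1 e).memLp' hU (h1 e).eq_integral
    have hU'' := ae_zero_of_primitive (h1 e).memLp'' hU' (h1 e).eq_integral'
    rw [Lp.eq_zero_iff_ae_eq_zero]
    filter_upwards [h3 e, hU''] with x hx hy
    simp [hx, hy]
  ext1 e
  exact key e

/-- The quantum graph Hamiltonian `P` as an unbounded operator on `L²`: `(P u)_m = -u_m''` on the
functions that are of class `H²` on every edge, continuous at the vertices, and satisfy the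
Kirchhoff condition. -/
def hamiltonian {J K M : ℕ} (G : LeadGraph J K M) (ℓ : Fin M → ℝ) :
    L2 K ℓ →ₗ.[ℂ] L2 K ℓ :=
  (hamiltonianGraph G ℓ).toLinearPMap

/-- `P u = f` means what it should. -/
theorem mem_graph_hamiltonian {J K M : ℕ} (G : LeadGraph J K M) (ℓ : Fin M → ℝ)
    (u f : L2 K ℓ) : (u, f) ∈ (hamiltonian G ℓ).graph ↔ HamiltonianRel G ℓ u f := by
  rw [hamiltonian, Submodule.toLinearPMap_graph_eq _ (hamiltonianGraph_functional G ℓ)]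
  exact Iff.rfl

/-- The part of an edge in the truncation at distance `ρ`: `[0, ρ]` for a lead, everything for a
finite edge. -/
def truncatedEdge {K M : ℕ} (ℓ : Fin M → ℝ) (ρ : ℝ) : Fin K ⊕ Fin M → Set ℝ
  | Sum.inl _ => Icc 0 ρ
  | Sum.inr m => Icc 0 (ℓ m)

theorem measurableSet_truncatedEdge {K M : ℕ} (ℓ : Fin M → ℝ) (ρ : ℝ) (e : Fin K ⊕ Fin M) :
    MeasurableSet (truncatedEdge ℓ ρ e) := by
  cases e with
  | inl k => exact measurableSet_Icc
  | inr m => exact measurableSet_Icc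

/-- Multiplication of an `L²` function by the indicator function of a set. -/
def indicatorLp {μ : Measure ℝ} {S : Set ℝ} (hS : MeasurableSet S) (f : Lp ℂ 2 μ) : Lp ℂ 2 μ :=
  ((Lp.memLp f).indicator hS).toLp (S.indicator f)

theorem coeFn_indicatorLp {μ : Measure ℝ} {S : Set ℝ} (hS : MeasurableSet S) (f : Lp ℂ 2 μ) :
    (indicatorLp hS f : ℝ → ℂ) =ᵐ[μ] S.indicator (f : ℝ → ℂ) := by
  rw [indicatorLp]
  exact MemLp.coeFn_toLp _

theorem indicatorLp_add {μ : Measure ℝ} {S : Set ℝ} (hS : MeasurableSet S) (f g : Lp ℂ 2 μ) :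
    indicatorLp hS (f + g) = indicatorLp hS f + indicatorLp hS g := by
  apply Lp.ext
  filter_upwards [Lp.coeFn_add f g, coeFn_indicatorLp hS (f + g), coeFn_indicatorLp hS f,
    coeFn_indicatorLp hS g, Lp.coeFn_add (indicatorLp hS f) (indicatorLp hS g)]
    with x h1 h2 h3 h4 h5
  rw [h2, h5, Pi.add_apply, h3, h4]
  by_cases h : x ∈ S
  · rw [indicator_of_mem h, indicator_of_mem h, indicator_of_mem h, h1, Pi.add_apply]
  · rw [indicator_of_notMem h, indicator_of_notMem h, indicator_of_notMem h, add_zero]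

theorem indicatorLp_smul {μ : Measure ℝ} {S : Set ℝ} (hS : MeasurableSet S) (a : ℂ)
    (f : Lp ℂ 2 μ) : indicatorLp hS (a • f) = a • indicatorLp hS f := by
  apply Lp.ext
  filter_upwards [Lp.coeFn_smul a f, coeFn_indicatorLp hS (a • f), coeFn_indicatorLp hS f,
    Lp.coeFn_smul a (indicatorLp hS f)] with x h1 h2 h3 h4
  rw [h2, h4, Pi.smul_apply, h3]
  by_cases h : x ∈ S
  · rw [indicator_of_mem h, indicator_of_mem h, h1, Pi.smul_apply]
  · rw [indicator_of_notMem h, indicator_of_notMem h, smul_zero]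

theorem norm_indicatorLp_le {μ : Measure ℝ} {S : Set ℝ} (hS : MeasurableSet S) (f : Lp ℂ 2 μ) :
    ‖indicatorLp hS f‖ ≤ 1 * ‖f‖ := by
  rw [one_mul]
  apply Lp.norm_le_norm_of_ae_le
  filter_upwards [coeFn_indicatorLp hS f] with x hx
  rw [hx]
  exact norm_indicator_le_norm_self _ _

/-- Multiplication by the indicator function of a set as a bounded operator. -/
def indicatorCLM (μ : Measure ℝ) {S : Set ℝ} (hS : MeasurableSet S) :
    Lp ℂ 2 μ →L[ℂ] Lp ℂ 2 μ :=
  LinearMap.mkContinuous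
    { toFun := indicatorLp hS
      map_add' := indicatorLp_add hS
      map_smul' := indicatorLp_smul hS }
    1 (norm_indicatorLp_le hS)

/-- The cutoff `1_{x ≤ ρ}`: restriction of a function to the finite edges and to the parts
`[0, ρ]` of the leads. -/
def cutoff {K M : ℕ} (ℓ : Fin M → ℝ) (ρ : ℝ) : L2 K ℓ →L[ℂ] L2 K ℓ :=
  ((PiLp.continuousLinearEquiv 2 ℂ
      (fun e : Fin K ⊕ Fin M => Lp ℂ 2 (edgeMeasure ℓ e))).symm :
        ((e : Fin K ⊕ Fin M) → Lp ℂ 2 (edgeMeasure ℓ e)) →L[ℂ] L2 K ℓ) ∘L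
    ContinuousLinearMap.pi (fun e =>
      indicatorCLM (edgeMeasure ℓ e) (measurableSet_truncatedEdge ℓ ρ e) ∘L
        PiLp.proj 2 (fun e : Fin K ⊕ Fin M => Lp ℂ 2 (edgeMeasure ℓ e)) e)

/-- The truncated space `𝓗_R`, as the subspace of those `u` in `L²` that vanish on the leads
beyond distance `R`. -/
def truncatedSpace {K M : ℕ} (ℓ : Fin M → ℝ) (R : ℝ) : Set (L2 K ℓ) :=
  {u | ∀ e, ∀ᵐ x ∂(edgeMeasure ℓ e), x ∉ truncatedEdge ℓ R e → u e x = 0}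

/-- `B` is the resolvent `(P - z²)⁻¹`, the bounded two-sided inverse of `P - z²`. -/
def IsResolvent {J K M : ℕ} (G : LeadGraph J K M) (ℓ : Fin M → ℝ) (z : ℂ)
    (B : L2 K ℓ →L[ℂ] L2 K ℓ) : Prop :=
  (∀ f : L2 K ℓ, ∃ h : B f ∈ (hamiltonian G ℓ).domain,
    hamiltonian G ℓ ⟨B f, h⟩ - z ^ 2 • B f = f) ∧
  (∀ u : (hamiltonian G ℓ).domain, B (hamiltonian G ℓ u - z ^ 2 • (u : L2 K ℓ)) = u)

/-- `F` is a meromorphic continuation to `ℂ` of the cut-off resolvent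
`1_{x ≤ ρ} (P - z²)⁻¹ 1_{x ≤ ρ}`, given in the physical half-plane `Im z > 0`, as a family of
bounded operators on `L²`. -/
def IsCutoffContinuation {J K M : ℕ} (G : LeadGraph J K M) (ℓ : Fin M → ℝ) (ρ : ℝ)
    (F : ℂ → (L2 K ℓ →L[ℂ] L2 K ℓ)) : Prop :=
  MeromorphicOn F univ ∧
  ∀ z : ℂ, 0 < z.im → ∃ B : L2 K ℓ →L[ℂ] L2 K ℓ, IsResolvent G ℓ z B ∧
    F z = cutoff ℓ ρ ∘L B ∘L cutoff ℓ ρ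

/-- The resonances of `P`: the poles of the meromorphic continuation of `z ↦ (P - z²)⁻¹` from
`Im z > 0` to `ℂ`, as a family of operators from compactly supported to locally `L²` functions;
that is, the poles of the continuations of the cut-off resolvents. -/
def resonances {J K M : ℕ} (G : LeadGraph J K M) (ℓ : Fin M → ℝ) : Set ℂ :=
  {z | ∃ ρ > 0, ∃ F : ℂ → (L2 K ℓ →L[ℂ] L2 K ℓ),
    IsCutoffContinuation G ℓ ρ F ∧ meromorphicOrderAt F z < 0}

end QGraph

end

/-! ### Lower bounds for holomorphic families on small circles -/

noncomputable section

namespace QGraph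

open Polynomial Topology Filter

/-! Suppose that the disc of radius `r = ε ^ γ` about `λ₀` contains no resonance. Then the
resolvent, cut off at distance `R`, continues to an analytic family `A` on this disc. Since `P` is
local, `(P - λ²) u` lives in the truncated graph together with `u`, so `A(λ) (P - λ²) u = u` for `Im
λ > 0`, and by the identity theorem also at the centre. Hence `1 = ‖u‖ ≤ ‖A(λ₀)‖ ε`. It remains to
contradict this with a bound `‖A(λ₀)‖ = o(1/ε)`, uniform in graph and lengths.

Two estimates produce this bound. In the upper half plane Green's formula gives `‖A(λ)‖ ≤ 1 / (|λ|
Im λ)` (`IsRealization.energy_le`, `HamiltonianRel.norm_le`). In the whole half disc there is a much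
weaker bound `C r ^ (-N)` with a fixed `N` (`exists_polynomial_bound`). The
`semiclassical_maximum_principle` combines them into `‖A(λ₀)‖ ≤ C' r ^ (-1 - 2η)` for any `η > 0`
and small `r`; as `γ < 1`, a small `η` makes this `o(1/ε)`.

The polynomial bound comes from an explicit formula. On an edge the solutions of `-u'' - λ² u = f`
are two plane waves with amplitudes given by variation of constants. The vertex conditions, together
with the absence of incoming waves on the leads, form a square linear system of fixed size, entire
in `λ` and jointly continuous in `λ` and the lengths. Cramer's rule writes the cut-off resolvent as
`numer / denom` with entire `numer` and `denom`. The numerator is bounded uniformly in the lengths.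
The denominator has no zero in the upper half plane, because a zero would give a nontrivial solution
there, against the energy estimate; so no function of the family vanishes identically, and
compactness of the set of pairs (centre, lengths) yields `|denom| ≥ c r ^ N` on some circle with
radius between `r / 2` and `r` (`exists_uniform_circle`). The maximum principle moves the bound from
the circle to the inside, across possible zeros of `denom`.

The same linear system, with the closedness of `P` and density of truncated data, shows that the
resolvent exists, so that `numer / denom` really is a meromorphic continuation
(`isCutoffContinuation_continued`). Finally, only finitely many graphs have given `J`, `K`, `M`. -/

/-- A polynomial is not small on a well chosen circle. -/
theorem exists_circle_le_norm_eval (p : ℂ[X]) {r : ℝ} (hr : 0 < r) :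
    ∃ s ∈ Ioo (r / 2) r, ∀ ζ : ℂ, ‖ζ‖ = s →
      ‖p.leadingCoeff‖ * (r / (4 * (p.natDegree + 2))) ^ p.natDegree ≤ ‖p.eval ζ‖ := by
  set n := p.natDegree with hn
  -- The candidate radii `σ 0, …, σ n` are spaced by `2δ`; the `n + 2` keeps the largest one
  -- strictly below `r`.
  set δ : ℝ := r / (4 * (n + 2)) with hδ
  have hn2 : (0 : ℝ) < 4 * (n + 2) := by positivity
  have hδ0 : 0 < δ := by positivity
  have hrδ : r = δ * (4 * (n + 2)) := by rw [hδ]; field_simp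
  let σ : ℕ → ℝ := fun j => r / 2 + (j + 1) * (2 * δ)
  -- Pigeonhole: the modulus of a root lies within less than `δ` of at most one candidate, and there
  -- are `n + 1` candidates for at most `n` roots.
  have hsep : ∃ j ∈ Finset.range (n + 1), ∀ w ∈ p.roots, δ ≤ |σ j - ‖w‖| := by
    by_contra! hcon
    choose! w hw1 hw2 using hcon
    have hinj : Set.InjOn w (Finset.range (n + 1)) := by
      intro i hi j hj hij
      have h1 := abs_lt.1 (hw2 i hi)
      have h2 := abs_lt.1 (hw2 j hj)
      rw [hij] at h1
      simp only [σ] at h1 h2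
      have h3 : ((i : ℝ) - j) < 1 := by
        by_contra! hc
        nlinarith
      have h4 : ((j : ℝ) - i) < 1 := by
        by_contra! hc
        nlinarith
      have h5 : (i : ℝ) < j + 1 := by linarith
      have h6 : (j : ℝ) < i + 1 := by linarith
      norm_cast at h5 h6
      omega
    have hcard := Finset.card_le_card_of_injOn (s := Finset.range (n + 1)) (t := p.roots.toFinset)
      w (fun j hj => by simpa using hw1 j hj) hinj
    have h2 := (Multiset.toFinset_card_le p.roots).trans (Polynomial.card_roots' p)
    rw [Finset.card_range] at hcard
    omega
  obtain ⟨j, hj, hsep⟩ := hsep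
  have hjn : (j : ℝ) + 1 ≤ n + 1 := by
    have := Finset.mem_range.1 hj
    norm_cast
  refine ⟨σ j, ⟨?_, ?_⟩, fun ζ hζ => ?_⟩
  · simp only [σ]
    have : 0 < ((j : ℝ) + 1) * (2 * δ) := by positivity
    linarith
  · simp only [σ]
    nlinarith
  · have hsplit := IsAlgClosed.splits p
    rw [hsplit.eval_eq_prod_roots, norm_mul]
    refine mul_le_mul_of_nonneg_left ?_ (norm_nonneg _)
    have hroots : Multiset.card p.roots = n := by
      rw [hn]
      exact hsplit.natDegree_eq_card_roots.symm
    have : ∀ S : Multiset ℂ, (∀ w ∈ S, δ ≤ ‖ζ - w‖) →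
        δ ^ (Multiset.card S) ≤ ‖(S.map (fun w => ζ - w)).prod‖ := by
      intro S
      induction S using Multiset.induction_on with
      | empty => intro _; simp
      | cons a S ih =>
        intro h
        rw [Multiset.card_cons, Multiset.map_cons, Multiset.prod_cons, norm_mul, pow_succ, mul_comm]
        exact mul_le_mul (h a (by simp)) (ih fun w hw => h w (by simp [hw])) (by positivity)
          (norm_nonneg _)
    rw [← hroots]
    refine this p.roots fun w hw => (hsep w hw).trans ?_
    rw [← hζ]
    exact abs_norm_sub_norm_le ζ w

/-- Taylor's formula for an entire function, with a bound of the remainder. -/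
theorem norm_sub_taylor_le {f : ℂ → ℂ} (hf : Differentiable ℂ f) {c : ℂ} {B : ℝ}
    (hB : ∀ z ∈ Metric.sphere c 1, ‖f z‖ ≤ B) (N : ℕ) {ζ : ℂ} (hζ : ‖ζ‖ ≤ 1 / 2) :
    ‖f (c + ζ) - ∑ j ∈ Finset.range (N + 1), ((j.factorial : ℂ)⁻¹ * iteratedDeriv j f c) * ζ ^ j‖
      ≤ 2 * B * ‖ζ‖ ^ (N + 1) := by
  have hsum := Complex.hasSum_taylorSeries_of_entire hf c (c + ζ)
  -- Cauchy's estimate on the unit circle bounds all Taylor coefficients by `B`.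
  have hcoef : ∀ j, ‖(j.factorial : ℂ)⁻¹ * iteratedDeriv j f c‖ ≤ B := by
    intro j
    have := Complex.norm_iteratedDeriv_le_of_forall_mem_sphere_norm_le j one_pos
      hf.diffContOnCl hB
    rw [norm_mul, norm_inv, Complex.norm_natCast]
    have hj : (0 : ℝ) < j.factorial := by positivity
    rw [inv_mul_le_iff₀ hj]
    simpa using this
  have hB0 : 0 ≤ B := (norm_nonneg _).trans (hcoef 0)
  have hsum' : HasSum (fun j => ((j.factorial : ℂ)⁻¹ * iteratedDeriv j f c) * ζ ^ j)
      (f (c + ζ)) := by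
    refine hsum.congr_fun ?_ |> fun h => h
    intro j
    simp only [add_sub_cancel_left, smul_eq_mul]
    ring
  have htail := (hasSum_nat_add_iff' (N + 1)).2 hsum'
  rw [← htail.tsum_eq]
  have hgeo : HasSum (fun j : ℕ => B * ‖ζ‖ ^ (N + 1) * ‖ζ‖ ^ j)
      (B * ‖ζ‖ ^ (N + 1) * (1 - ‖ζ‖)⁻¹) :=
    (hasSum_geometric_of_lt_one (norm_nonneg _) (by linarith)).mul_left _
  refine (tsum_of_norm_bounded hgeo fun j => ?_).trans ?_
  · rw [norm_mul, norm_pow, pow_add, mul_assoc B, mul_comm (‖ζ‖ ^ (N + 1))]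
    exact mul_le_mul_of_nonneg_right (hcoef _) (by positivity)
  -- The factor `2` is the sum of the geometric tail for `‖ζ‖ ≤ 1 / 2`.
  · have : (1 - ‖ζ‖)⁻¹ ≤ 2 := by
      rw [inv_le_comm₀ (by linarith) (by norm_num)]
      linarith
    calc B * ‖ζ‖ ^ (N + 1) * (1 - ‖ζ‖)⁻¹ ≤ B * ‖ζ‖ ^ (N + 1) * 2 :=
          mul_le_mul_of_nonneg_left this (by positivity)
      _ = 2 * B * ‖ζ‖ ^ (N + 1) := by ring

/-- An entire function with a Taylor coefficient bounded from below is not small on a well chosen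
small circle. -/
theorem exists_circle_le_norm_of_coeff {f : ℂ → ℂ} (hf : Differentiable ℂ f) {c : ℂ} {B κ : ℝ}
    (hB : ∀ z ∈ Metric.sphere c 1, ‖f z‖ ≤ B) {N : ℕ} (hκ : 0 < κ)
    (hN : κ ≤ ‖(N.factorial : ℂ)⁻¹ * iteratedDeriv N f c‖) {r : ℝ} (hr : 0 < r) (hr2 : r ≤ 1 / 2)
    (hr' : 4 * B * r ≤ κ * (1 / (4 * (N + 2))) ^ N) :
    ∃ s ∈ Ioo (r / 2) r, ∀ z ∈ Metric.sphere c s,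
      κ * (1 / (4 * (N + 2))) ^ N / 2 * r ^ N ≤ ‖f z‖ := by
  set a : ℕ → ℂ := fun j => (j.factorial : ℂ)⁻¹ * iteratedDeriv j f c with ha
  have haN : a N ≠ 0 := by
    intro h
    have : ‖a N‖ = 0 := by rw [h, norm_zero]
    linarith [hN.trans_eq this]
  set p : ℂ[X] := ∑ j ∈ Finset.range (N + 1), C (a j) * X ^ j with hp
  have hcoeff : p.coeff N = a N := by
    rw [hp, finsetSum_coeff]
    simp only [coeff_C_mul_X_pow]
    simp
  -- The degree is exactly `N`; nothing is known about the lower coefficients, and the bound for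
  -- polynomials involves only the leading one.
  have hdeg : p.natDegree = N := by
    apply le_antisymm
    · rw [hp]
      refine natDegree_sum_le_of_forall_le _ _ fun j hj => ?_
      refine (natDegree_C_mul_X_pow_le _ _).trans ?_
      have := Finset.mem_range.1 hj
      omega
    · exact le_natDegree_of_ne_zero (by rw [hcoeff]; exact haN)
  have hlead : p.leadingCoeff = a N := by rw [leadingCoeff, hdeg, hcoeff]
  obtain ⟨s, hs, hcirc⟩ := exists_circle_le_norm_eval p hr
  refine ⟨s, hs, fun z hz => ?_⟩
  have hζ : ‖z - c‖ = s := by simpa [dist_eq_norm] using hz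
  have h1 := hcirc (z - c) hζ
  rw [hlead, hdeg] at h1
  have h2 := norm_sub_taylor_le hf hB N (ζ := z - c) (by rw [hζ]; linarith [hs.2])
  rw [add_sub_cancel] at h2
  have heval : p.eval (z - c) = ∑ j ∈ Finset.range (N + 1), a j * (z - c) ^ j := by
    rw [hp, eval_finsetSum]
    simp
  change ‖f z - ∑ j ∈ Finset.range (N + 1), a j * (z - c) ^ j‖ ≤ _ at h2
  rw [← heval, hζ] at h2
  have h3 : ‖p.eval (z - c)‖ ≤ ‖f z‖ + ‖f z - p.eval (z - c)‖ := by
    have := norm_sub_norm_le (p.eval (z - c)) (f z)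
    rw [norm_sub_rev] at this
    linarith
  have hB0 : 0 ≤ B := by
    have := hB (c + 1) (by simp)
    exact (norm_nonneg _).trans this
  have hs0 : 0 < s := by linarith [hs.1]
  have h4 : s ^ (N + 1) ≤ r ^ (N + 1) := pow_le_pow_left₀ hs0.le hs.2.le _
  have h5 : κ * (r / (4 * (N + 2))) ^ N ≤ ‖a N‖ * (r / (4 * (N + 2))) ^ N :=
    mul_le_mul_of_nonneg_right hN (by positivity)
  have h6 : (r / (4 * ((N : ℝ) + 2))) ^ N = (1 / (4 * (N + 2))) ^ N * r ^ N := by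
    rw [← mul_pow]
    ring
  -- `hr'` is the condition that makes the Taylor remainder at most half of the lower bound for the
  -- polynomial.
  have h7 : 2 * B * s ^ (N + 1) ≤ κ * (1 / (4 * (N + 2))) ^ N / 2 * r ^ N := by
    calc 2 * B * s ^ (N + 1) ≤ 2 * B * r ^ (N + 1) :=
          mul_le_mul_of_nonneg_left h4 (by positivity)
      _ = (4 * B * r) * r ^ N / 2 := by ring
      _ ≤ (κ * (1 / (4 * (N + 2))) ^ N) * r ^ N / 2 := by
          have : (0 : ℝ) ≤ r ^ N := by positivity
          have := mul_le_mul_of_nonneg_right hr' this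
          linarith
      _ = _ := by ring
  rw [h6] at h5 h1
  linarith

/-- A family of entire functions that depends continuously on a parameter in a compact set and
contains no zero function is bounded from below on well chosen small circles, uniformly. -/
theorem exists_uniform_circle {Y : Type*} [TopologicalSpace Y] {D : ℂ → Y → ℂ}
    (hD : Continuous (Function.uncurry D)) (hdiff : ∀ y, Differentiable ℂ fun z => D z y)
    {S : Set (ℂ × Y)} (hS : IsCompact S) (hne : ∀ p ∈ S, ∃ z, D z p.2 ≠ 0) :
    ∃ (N : ℕ) (c r₀ : ℝ), 0 < c ∧ 0 < r₀ ∧ r₀ ≤ 1 ∧ ∀ p ∈ S, ∀ r : ℝ, 0 < r → r ≤ r₀ →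
      ∃ s ∈ Ioo (r / 2) r, ∀ z ∈ Metric.sphere p.1 s, c * r ^ N ≤ ‖D z p.2‖ := by
  let P : Set (ℂ × Y) → Prop := fun S => ∃ (N : ℕ) (c r₀ : ℝ), 0 < c ∧ 0 < r₀ ∧ r₀ ≤ 1 ∧
    ∀ p ∈ S, ∀ r : ℝ, 0 < r → r ≤ r₀ →
      ∃ s ∈ Ioo (r / 2) r, ∀ z ∈ Metric.sphere p.1 s, c * r ^ N ≤ ‖D z p.2‖
  -- The property is trivial for the empty set, monotone, stable under unions and true near every
  -- point, hence true on the compact set.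
  refine hS.induction_on (p := P) ?_ ?_ ?_ ?_
  · exact ⟨0, 1, 1, one_pos, one_pos, le_rfl, fun p hp => hp.elim⟩
  · rintro s t hst ⟨N, c, r₀, h1, h2, h3, h4⟩
    exact ⟨N, c, r₀, h1, h2, h3, fun p hp => h4 p (hst hp)⟩
  · rintro s t ⟨N, c, r₀, h1, h2, h3, h4⟩ ⟨N', c', r₀', h1', h2', h3', h4'⟩
    refine ⟨max N N', min c c', min r₀ r₀', lt_min h1 h1', lt_min h2 h2',
      (min_le_left _ _).trans h3, fun p hp r hr hr0 => ?_⟩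
    -- This is the purpose of `r₀ ≤ 1`: for `r ≤ 1` the exponent may be raised to the maximum of the
    -- two.
    have hr1 : r ≤ 1 := hr0.trans ((min_le_left _ _).trans h3)
    rcases hp with hp | hp
    · obtain ⟨σ, hσ, h⟩ := h4 p hp r hr (hr0.trans (min_le_left _ _))
      refine ⟨σ, hσ, fun z hz => le_trans ?_ (h z hz)⟩
      exact mul_le_mul (min_le_left _ _) (pow_le_pow_of_le_one hr.le hr1 (le_max_left _ _))
        (by positivity) h1.le
    · obtain ⟨σ, hσ, h⟩ := h4' p hp r hr (hr0.trans (min_le_right _ _))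
      refine ⟨σ, hσ, fun z hz => le_trans ?_ (h z hz)⟩
      exact mul_le_mul (min_le_right _ _) (pow_le_pow_of_le_one hr.le hr1 (le_max_right _ _))
        (by positivity) h1'.le
  · rintro ⟨c₁, y₁⟩ hp
    obtain ⟨z₀, hz₀⟩ := hne _ hp
    -- An entire function that is not identically zero has a nonzero Taylor coefficient. It need not
    -- be the first one.
    have hex : ∃ N, iteratedDeriv N (fun z => D z y₁) c₁ ≠ 0 := by
      by_contra! hall
      have := Complex.hasSum_taylorSeries_of_entire (hdiff y₁) c₁ z₀
      simp only [hall, smul_zero] at this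
      exact hz₀ (this.unique hasSum_zero)
    obtain ⟨N, hN⟩ := hex
    -- Half of the coefficient: a perturbation by less than `κ` on the unit circle changes the
    -- coefficient by at most `κ`, by Cauchy's estimate, so at least `κ` remains for nearby centres
    -- and parameters.
    set κ : ℝ := ‖(N.factorial : ℂ)⁻¹ * iteratedDeriv N (fun z => D z y₁) c₁‖ / 2 with hκ
    have hκ0 : 0 < κ := by
      rw [hκ]
      have : (N.factorial : ℂ) ≠ 0 := by exact_mod_cast N.factorial_ne_zero
      exact half_pos (norm_pos_iff.2 (mul_ne_zero (inv_ne_zero this) hN))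
    have hsph : IsCompact (Metric.sphere (0 : ℂ) 1) := isCompact_sphere _ _
    have hgcont : Continuous fun q : (ℂ × Y) × ℂ => D (q.1.1 + q.2) q.1.2 :=
      hD.comp (by fun_prop : Continuous fun q : (ℂ × Y) × ℂ => (q.1.1 + q.2, q.1.2))
    have hclose : ∀ᶠ q in 𝓝 (c₁, y₁), ∀ ζ ∈ Metric.sphere (0 : ℂ) 1,
        ‖D (q.1 + ζ) q.2 - D (c₁ + ζ) y₁‖ < κ := by
      refine hsph.eventually_forall_of_forall_eventually fun ζ _ => ?_
      have hc : Continuous fun q : (ℂ × Y) × ℂ =>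
          ‖D (q.1.1 + q.2) q.1.2 - D (c₁ + q.2) y₁‖ := by
        refine (hgcont.sub ?_).norm
        exact hD.comp (by fun_prop : Continuous fun q : (ℂ × Y) × ℂ => (c₁ + q.2, y₁))
      refine hc.continuousAt.eventually_lt continuousAt_const ?_
      simpa using hκ0
    obtain ⟨B₁, hB₁⟩ : ∃ B₁, ∀ ζ ∈ Metric.sphere (0 : ℂ) 1, ‖D (c₁ + ζ) y₁‖ ≤ B₁ := by
      obtain ⟨B₁, hB₁⟩ := hsph.exists_bound_of_continuousOn (f := fun ζ => D (c₁ + ζ) y₁)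
        (hD.comp (by fun_prop : Continuous fun ζ : ℂ => (c₁ + ζ, y₁))).continuousOn
      exact ⟨B₁, hB₁⟩
    have hB₁0 : 0 ≤ B₁ := (norm_nonneg _).trans (hB₁ 1 (by simp))
    set B := B₁ + κ with hBdef
    have hB0 : 0 < B := by positivity
    set κ' : ℝ := κ * (1 / (4 * (N + 2))) ^ N with hκ'
    have hκ'0 : 0 < κ' := by positivity
    refine ⟨{q | ∀ ζ ∈ Metric.sphere (0 : ℂ) 1, ‖D (q.1 + ζ) q.2 - D (c₁ + ζ) y₁‖ < κ},
      mem_nhdsWithin_of_mem_nhds hclose, N, κ' / 2, min (1 / 2) (κ' / (4 * B)), by positivity,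
      by positivity, (min_le_left _ _).trans (by norm_num), ?_⟩
    rintro ⟨c, y⟩ hq r hr hr0
    have hq' : ∀ ζ ∈ Metric.sphere (0 : ℂ) 1, ‖D (c + ζ) y - D (c₁ + ζ) y₁‖ < κ := hq
    refine exists_circle_le_norm_of_coeff (hdiff y) (B := B) ?_ hκ0 ?_ hr
      (hr0.trans (min_le_left _ _)) ?_
    · intro z hz
      have hz' : z - c ∈ Metric.sphere (0 : ℂ) 1 := by simpa [dist_eq_norm] using hz
      have h1 := hq' _ hz'
      have h2 := hB₁ _ hz'
      rw [add_sub_cancel] at h1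
      have := norm_le_norm_add_norm_sub' (D z y) (D (c₁ + (z - c)) y₁)
      rw [hBdef]
      linarith
    · set f : ℂ → ℂ := fun ζ => D (c + ζ) y with hf
      set f₁ : ℂ → ℂ := fun ζ => D (c₁ + ζ) y₁ with hf₁
      have hfd : Differentiable ℂ f := (hdiff y).comp (differentiable_id.const_add c)
      have hf₁d : Differentiable ℂ f₁ := (hdiff y₁).comp (differentiable_id.const_add c₁)
      have e1 : iteratedDeriv N (fun z => D z y) c = iteratedDeriv N f 0 := by
        have := congrFun (iteratedDeriv_comp_const_add N (fun z => D z y) c) 0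
        simpa [hf] using this.symm
      have e2 : iteratedDeriv N (fun z => D z y₁) c₁ = iteratedDeriv N f₁ 0 := by
        have := congrFun (iteratedDeriv_comp_const_add N (fun z => D z y₁) c₁) 0
        simpa [hf₁] using this.symm
      have h1 := Complex.norm_iteratedDeriv_le_of_forall_mem_sphere_norm_le N one_pos
        (hfd.sub hf₁d).diffContOnCl (c := 0) (C := κ) (fun ζ hζ => (hq' ζ hζ).le)
      have e3 : iteratedDeriv N (f - f₁) 0 = iteratedDeriv N f 0 - iteratedDeriv N f₁ 0 :=
        iteratedDeriv_sub (hfd.contDiff.contDiffAt) (hf₁d.contDiff.contDiffAt)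
      rw [e3] at h1
      have h2 : ‖(N.factorial : ℂ)⁻¹ * iteratedDeriv N f 0
          - (N.factorial : ℂ)⁻¹ * iteratedDeriv N f₁ 0‖ ≤ κ := by
        rw [← mul_sub, norm_mul, norm_inv, Complex.norm_natCast,
          inv_mul_le_iff₀ (by positivity)]
        simpa using h1
      rw [e1]
      rw [e2] at hκ
      have h3 := norm_le_norm_add_norm_sub ((N.factorial : ℂ)⁻¹ * iteratedDeriv N f 0)
        ((N.factorial : ℂ)⁻¹ * iteratedDeriv N f₁ 0)
      linarith
    · have := hr0.trans (min_le_right _ _)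
      rw [le_div_iff₀ (by positivity)] at this
      linarith

end QGraph
end

/-! ### The semiclassical maximum principle -/

noncomputable section

namespace QGraph

open Topology Filter

/-- Powers are beaten by exponentials of negative powers at `0`. -/
theorem eventually_exp_neg_rpow_mul_le_one (N : ℕ) {η b : ℝ} (hη : 0 < η) (hb : 0 < b) :
    ∀ᶠ r : ℝ in 𝓝[>] 0, Real.exp (-(b * r ^ (-η))) * (r ^ N)⁻¹ ≤ 1 := by
  have h1 : Tendsto (fun r : ℝ => r ^ (-η)) (𝓝[>] 0) atTop :=
    tendsto_rpow_neg_nhdsGT_zero (by linarith)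
  have h2 := (tendsto_rpow_mul_exp_neg_mul_atTop_nhds_zero (N / η) b hb).comp h1
  filter_upwards [h2.eventually (gt_mem_nhds one_pos), self_mem_nhdsWithin] with r hr hr0
  have hr0 : 0 < r := hr0
  simp only [Function.comp] at hr
  have h3 : (r ^ (-η)) ^ ((N : ℝ) / η) = (r ^ N)⁻¹ := by
    rw [← Real.rpow_mul hr0.le, ← Real.rpow_natCast, ← Real.rpow_neg hr0.le]
    congr 1
    field_simp
  rw [h3] at hr
  rw [mul_comm, ← neg_mul]
  exact hr.le

/-- The semiclassical maximum principle: a function that is holomorphic and polynomially bounded in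
a disc of radius `r` around a real point, and bounded by `C / Im z` in the upper half of it, is
bounded by almost `C / r` at the centre. -/
theorem semiclassical_maximum_principle (N : ℕ) (C : ℝ) (hC : 0 ≤ C) {η : ℝ} (hη : 0 < η) :
    ∃ r₀ > 0, ∀ (E : Type) [NormedAddCommGroup E] [NormedSpace ℂ E] (F : ℂ → E) (x₀ r : ℝ),
      0 < r → r < r₀ → DifferentiableOn ℂ F (Metric.ball (x₀ : ℂ) r) →
      (∀ z ∈ Metric.closedBall (x₀ : ℂ) (r / 2), ‖F z‖ ≤ C * (r ^ N)⁻¹) →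
      (∀ z ∈ Metric.closedBall (x₀ : ℂ) (r / 2), 0 < z.im → ‖F z‖ ≤ C / z.im) →
      ‖F x₀‖ ≤ Real.exp 2 * C / r ^ (1 + 2 * η) := by
  have hsmall : ∀ᶠ r : ℝ in 𝓝[>] 0, r ^ η ≤ 1 / 4 := by
    have h1 : Tendsto (fun r : ℝ => r ^ η) (𝓝[>] 0) (𝓝 0) := by
      have := (Real.continuous_rpow_const hη.le).tendsto 0
      rw [Real.zero_rpow hη.ne'] at this
      exact this.mono_left nhdsWithin_le_nhds
    exact (h1.eventually (gt_mem_nhds (by norm_num : (0 : ℝ) < 1 / 4))).mono fun r h => h.le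
  have hall := (hsmall.and (eventually_exp_neg_rpow_mul_le_one N hη one_pos)).and
    (eventually_exp_neg_rpow_mul_le_one N (η := 2 * η) (by linarith)
      (by norm_num : (0 : ℝ) < 1 / 16))
  obtain ⟨r₁, hr₁, hr₁'⟩ := mem_nhdsGT_iff_exists_Ioo_subset.1 hall
  have hr₁0 : (0 : ℝ) < r₁ := hr₁
  refine ⟨min r₁ 1, lt_min hr₁0 one_pos, ?_⟩
  intro E _ _ F x₀ r hr hrr hF hN hup
  obtain ⟨⟨hs, he1⟩, he2⟩ := hr₁' ⟨hr, hrr.trans_le (min_le_left _ _)⟩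
  have hr1 : r < 1 := hrr.trans_le (min_le_right _ _)
  -- The maximum principle is applied in the rectangle `|Re z - x₀| < r / 4`, `-δ < Im z < δ'`. It
  -- is thin, and thinner above the axis than below: `δ / δ' = r ^ (-η)` and `(r / δ) ^ 2 = r ^
  -- (-2η)` both tend to infinity.
  set δ := r ^ (1 + η) with hδ
  set δ' := r ^ (1 + 2 * η) with hδ'
  have hδ0 : 0 < δ := Real.rpow_pos_of_pos hr _
  have hδ'0 : 0 < δ' := Real.rpow_pos_of_pos hr _
  have hle : δ' ≤ δ := Real.rpow_le_rpow_of_exponent_ge hr hr1.le (by linarith)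
  have hδr : δ ≤ r / 4 := by
    rw [hδ, Real.rpow_add hr, Real.rpow_one]
    nlinarith
  have hδ'1 : δ' ≤ 1 := by linarith
  have hq1 : δ / δ' = r ^ (-η) := by
    rw [hδ, hδ', ← Real.rpow_sub hr]
    congr 1
    ring
  have hq2 : (r / 4) ^ 2 / δ ^ 2 = 1 / 16 * r ^ (-(2 * η)) := by
    have : r ^ 2 / δ ^ 2 = r ^ (-(2 * η)) := by
      rw [hδ, ← Real.rpow_natCast r 2, ← Real.rpow_natCast _ 2, ← Real.rpow_mul hr.le,
        ← Real.rpow_sub hr]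
      congr 1
      push_cast
      ring
    rw [← this]
    ring
  -- The weight `exp φ` equals `1` at the centre. Its Gaussian factor is tiny on the vertical sides,
  -- its exponential factor is tiny on the bottom side, and on the closed rectangle `Re φ ≤ 2`. So
  -- the polynomial bound suffices on three sides, and the bound `C / Im z = C / δ'` enters on the
  -- top.
  set φ : ℂ → ℂ := fun z => -(z - x₀) ^ 2 / (δ : ℂ) ^ 2 - Complex.I * (z - x₀) / δ' with hφ
  have hφre : ∀ z : ℂ, (φ z).re = -((z.re - x₀) ^ 2 - z.im ^ 2) / δ ^ 2 + z.im / δ' := by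
    intro z
    have e : φ z = ((-((z.re - x₀) ^ 2 - z.im ^ 2) / δ ^ 2 + z.im / δ' : ℝ) : ℂ)
        + ((-(2 * (z.re - x₀) * z.im) / δ ^ 2 - (z.re - x₀) / δ' : ℝ) : ℂ) * Complex.I := by
      rw [hφ]
      simp only
      conv_lhs => rw [← Complex.re_add_im z]
      push_cast
      linear_combination ((z.im : ℂ) ^ 2 / (δ : ℂ) ^ 2 * (-1) - (z.im : ℂ) / δ')
        * Complex.I_sq
    rw [e]
    simp only [Complex.add_re, Complex.ofReal_re, Complex.re_ofReal_mul, Complex.I_re, mul_zero,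
      add_zero]
  set G : ℂ → E := fun z => Complex.exp (φ z) • F z with hG
  set U : Set ℂ := Ioo (x₀ - r / 4) (x₀ + r / 4) ×ℂ Ioo (-δ) δ' with hU
  have hcl : closure U = Icc (x₀ - r / 4) (x₀ + r / 4) ×ℂ Icc (-δ) δ' := by
    rw [hU, Complex.closure_reProdIm, closure_Ioo (by linarith), closure_Ioo (by linarith)]
  have hball : closure U ⊆ Metric.closedBall (x₀ : ℂ) (r / 2) := by
    rw [hcl]
    rintro z ⟨⟨h1, h2⟩, h3, h4⟩
    rw [Metric.mem_closedBall, dist_eq_norm]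
    refine (Complex.norm_le_abs_re_add_abs_im _).trans ?_
    simp only [Complex.sub_re, Complex.ofReal_re, Complex.sub_im, Complex.ofReal_im, sub_zero]
    have h5 : |z.re - x₀| ≤ r / 4 := abs_le.2 ⟨by linarith, by linarith⟩
    have h6 : |z.im| ≤ r / 4 := abs_le.2 ⟨by linarith, by linarith⟩
    linarith
  have hballs : Metric.closedBall (x₀ : ℂ) (r / 2) ⊆ Metric.ball (x₀ : ℂ) r :=
    Metric.closedBall_subset_ball (by linarith)
  have hGd : DifferentiableOn ℂ G (closure U) := by
    have h1 : Differentiable ℂ fun z => Complex.exp (φ z) := by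
      rw [hφ]
      fun_prop
    exact h1.differentiableOn.smul (hF.mono (hball.trans hballs))
  have hbdd : Bornology.IsBounded U :=
    Metric.isBounded_closedBall.subset (subset_closure.trans hball)
  have hmain : ∀ z ∈ frontier U, ‖G z‖ ≤ Real.exp 2 * C / δ' := by
    intro z hz
    have hzU : z ∈ closure U := frontier_subset_closure hz
    have hzb := hball hzU
    have hzU' := hzU
    rw [hcl] at hzU'
    obtain ⟨⟨h1, h2⟩, h3, h4⟩ := hzU'
    have him2 : z.im ^ 2 / δ ^ 2 ≤ 1 := by
      rw [div_le_one (by positivity)]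
      apply sq_le_sq'
      · linarith
      · linarith
    have him1 : z.im / δ' ≤ 1 := by
      rw [div_le_one hδ'0]
      exact h4
    have hexp2 : Real.exp 2 * C ≤ Real.exp 2 * C / δ' := by
      rw [le_div_iff₀ hδ'0]
      have : 0 ≤ Real.exp 2 * C := by positivity
      nlinarith
    have hGn : ‖G z‖ = Real.exp ((φ z).re) * ‖F z‖ := by
      rw [hG]
      simp only
      rw [norm_smul, Complex.norm_exp]
    have hsq : 0 ≤ (z.re - x₀) ^ 2 / δ ^ 2 := by positivity
    have hsplit : (φ z).re = -((z.re - x₀) ^ 2 / δ ^ 2) + z.im ^ 2 / δ ^ 2 + z.im / δ' := by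
      rw [hφre]
      ring
    -- Sides where the weight is at most `exp (2 - t)`, with `exp (-t)` beating `r ^ (-N)`.
    have hpoly : ∀ t : ℝ, (φ z).re ≤ 2 - t → Real.exp (-t) * (r ^ N)⁻¹ ≤ 1 →
        ‖G z‖ ≤ Real.exp 2 * C / δ' := by
      intro t ht1 ht2
      refine le_trans ?_ hexp2
      rw [hGn]
      calc Real.exp (φ z).re * ‖F z‖ ≤ Real.exp (2 - t) * (C * (r ^ N)⁻¹) :=
            mul_le_mul (Real.exp_le_exp.2 ht1) (hN z hzb) (norm_nonneg _) (Real.exp_pos _).le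
        _ = Real.exp 2 * C * (Real.exp (-t) * (r ^ N)⁻¹) := by
            rw [sub_eq_add_neg, Real.exp_add]
            ring
        _ ≤ Real.exp 2 * C * 1 := mul_le_mul_of_nonneg_left ht2 (by positivity)
        _ = _ := mul_one _
    rw [hU, Complex.frontier_reProdIm, frontier_Ioo (by linarith), frontier_Ioo (by linarith),
      closure_Ioo (by linarith), closure_Ioo (by linarith)] at hz
    rcases hz with ⟨-, hz⟩ | ⟨hz, -⟩
    · have hz' : z.im = -δ ∨ z.im = δ' := by simpa using hz
      rcases hz' with hz' | hz'
      · refine hpoly (1 * r ^ (-η)) ?_ he1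
        rw [one_mul, ← hq1, hsplit, hz', neg_div]
        rw [hz'] at him2
        linarith
      · have hz0 : 0 < z.im := by rw [hz']; exact hδ'0
        rw [hGn]
        have h7 := hup z hzb hz0
        rw [hz'] at h7
        calc Real.exp (φ z).re * ‖F z‖ ≤ Real.exp 2 * (C / δ') := by
              refine mul_le_mul (Real.exp_le_exp.2 ?_) h7 (norm_nonneg _) (Real.exp_pos _).le
              rw [hsplit]
              linarith
          _ = _ := by ring
    · refine hpoly (1 / 16 * r ^ (-(2 * η))) ?_ he2
      rw [← hq2, hsplit]
      have hz' : (z.re - x₀) ^ 2 = (r / 4) ^ 2 := by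
        have : z.re = x₀ - r / 4 ∨ z.re = x₀ + r / 4 := by simpa using hz
        rcases this with h | h <;> rw [h] <;> ring
      rw [hz']
      linarith
  have hx₀ : (x₀ : ℂ) ∈ closure U := by
    apply subset_closure
    rw [hU]
    refine ⟨⟨?_, ?_⟩, ?_, ?_⟩ <;> simp <;> linarith
  have hfin := Complex.norm_le_of_forall_mem_frontier_norm_le hbdd hGd.diffContOnCl hmain hx₀
  have hG0 : G x₀ = F x₀ := by
    rw [hG, hφ]
    simp
  rwa [hG0] at hfin

end QGraph
end

/-! ### Integration by parts, traces and the energy estimate -/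

noncomputable section

namespace QGraph

open Topology Filter
open scoped ComplexConjugate

/-- Primitives of complex valued functions are absolutely continuous. -/
theorem absolutelyContinuousOnInterval_primitive {f : ℝ → ℂ} {X : ℝ}
    (h : IntervalIntegrable f volume 0 X) :
    AbsolutelyContinuousOnInterval (fun x => ∫ t in (0 : ℝ)..x, f t) 0 X := by
  have hre : IntervalIntegrable (fun t => (f t).re) volume 0 X := ⟨h.1.re, h.2.re⟩
  have him : IntervalIntegrable (fun t => (f t).im) volume 0 X := ⟨h.1.im, h.2.im⟩
  have hconst : ∀ k : ℂ, AbsolutelyContinuousOnInterval (fun _ : ℝ => k) 0 X := fun k =>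
    (LipschitzWith.const k).lipschitzOnWith.absolutelyContinuousOnInterval
  have h1 : AbsolutelyContinuousOnInterval (fun x => ∫ t in (0 : ℝ)..x, (f t).re) 0 X :=
    hre.absolutelyContinuousOnInterval_intervalIntegral (by simp)
  have h2 : AbsolutelyContinuousOnInterval (fun x => ∫ t in (0 : ℝ)..x, (f t).im) 0 X :=
    him.absolutelyContinuousOnInterval_intervalIntegral (by simp)
  have h3 := (h1.smul (hconst 1)).add (h2.smul (hconst Complex.I))
  -- The splitting into real and imaginary parts is justified only on the interval, where `f` is
  -- integrable. The definition by `ε` and `δ` evaluates the functions only there.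
  rw [absolutelyContinuousOnInterval_iff] at h3 ⊢
  intro ε hε
  obtain ⟨δ, hδ, h4⟩ := h3 ε hε
  refine ⟨δ, hδ, fun E hE hE' => ?_⟩
  have hE2 := hE.1
  refine lt_of_eq_of_lt (Finset.sum_congr rfl fun i hi => ?_) (h4 E hE hE')
  have hval : ∀ x ∈ uIcc 0 X, ∫ t in (0 : ℝ)..x, f t
      = ((fun x => ∫ t in (0 : ℝ)..x, (f t).re) • fun _ => (1 : ℂ)) x
        + ((fun x => ∫ t in (0 : ℝ)..x, (f t).im) • fun _ => Complex.I) x := by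
    intro x hx
    have hx' : IntervalIntegrable f volume 0 x :=
      h.mono_set (uIcc_subset_uIcc_left hx)
    have e := intervalIntegral.integral_add (μ := volume) (a := 0) (b := x)
      (f := fun t => ((f t).re : ℂ)) (g := fun t => ((f t).im : ℂ) * Complex.I)
      (⟨hx'.1.re.ofReal, hx'.2.re.ofReal⟩)
      (IntervalIntegrable.mul_const ⟨hx'.1.im.ofReal, hx'.2.im.ofReal⟩ _)
    simp only [Complex.re_add_im] at e
    rw [e, intervalIntegral.integral_ofReal, intervalIntegral.integral_mul_const,
      intervalIntegral.integral_ofReal]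
    simp [Complex.real_smul]
  rw [hval _ (hE2 i hi).1, hval _ (hE2 i hi).2]
  rfl

/-- The product rule for absolutely continuous functions. -/
theorem mul_eq_add_integral_of_ac {A B A' B' : ℝ → ℂ} {X : ℝ}
    (hA : AbsolutelyContinuousOnInterval A 0 X) (hB : AbsolutelyContinuousOnInterval B 0 X)
    (hA' : IntervalIntegrable A' volume 0 X) (hB' : IntervalIntegrable B' volume 0 X)
    (hdA : ∀ᵐ x, x ∈ uIcc 0 X → HasDerivAt A (A' x) x)
    (hdB : ∀ᵐ x, x ∈ uIcc 0 X → HasDerivAt B (B' x) x) :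
    A X * B X = A 0 * B 0 + ∫ t in (0 : ℝ)..X, (A' t * B t + A t * B' t) := by
  have hint : IntervalIntegrable (fun t => A' t * B t + A t * B' t) volume 0 X :=
    (hA'.mul_continuousOn hB.continuousOn).add (hB'.continuousOn_mul hA.continuousOn)
  -- `A B` minus the candidate primitive is absolutely continuous with derivative zero almost
  -- everywhere, hence constant.
  have hW : AbsolutelyContinuousOnInterval
      (fun x => A x • B x - ∫ t in (0 : ℝ)..x, (A' t * B t + A t * B' t)) 0 X :=
    AbsolutelyContinuousOnInterval.sub (hA.smul hB)
      (absolutelyContinuousOnInterval_primitive hint)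
  have hd : ∀ᵐ x, x ∈ uIcc 0 X → HasDerivAt
      (fun x => A x • B x - ∫ t in (0 : ℝ)..x, (A' t * B t + A t * B' t)) 0 x := by
    filter_upwards [hdA, hdB, hint.ae_hasDerivAt_integral] with x h1 h2 h3 hx
    have d3 := ((h1 hx).mul (h2 hx)).sub (h3 hx 0 (by simp))
    rw [sub_self] at d3
    exact d3
  obtain ⟨C, hC⟩ := hW.const_of_ae_hasDerivAt_zero hd
  have h0 := hC 0 (by simp)
  have hX := hC X (by simp)
  rw [intervalIntegral.integral_same, sub_zero, smul_eq_mul] at h0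
  rw [smul_eq_mul, ← h0] at hX
  rw [← hX]
  ring

/-- The product rule for primitives of integrable functions. -/
theorem primitive_mul {a b a' b' : ℝ → ℂ} {X : ℝ} (ha' : IntervalIntegrable a' volume 0 X)
    (hb' : IntervalIntegrable b' volume 0 X)
    (ha : ∀ x ∈ uIcc 0 X, a x = a 0 + ∫ t in (0 : ℝ)..x, a' t)
    (hb : ∀ x ∈ uIcc 0 X, b x = b 0 + ∫ t in (0 : ℝ)..x, b' t) :
    a X * b X = a 0 * b 0 + ∫ t in (0 : ℝ)..X, (a' t * b t + a t * b' t) := by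
  have hconst : ∀ k : ℂ, AbsolutelyContinuousOnInterval (fun _ : ℝ => k) 0 X := fun k =>
    (LipschitzWith.const k).lipschitzOnWith.absolutelyContinuousOnInterval
  have hAac : AbsolutelyContinuousOnInterval (fun x => a 0 + ∫ t in (0 : ℝ)..x, a' t) 0 X :=
    (hconst _).add (absolutelyContinuousOnInterval_primitive ha')
  have hBac : AbsolutelyContinuousOnInterval (fun x => b 0 + ∫ t in (0 : ℝ)..x, b' t) 0 X :=
    (hconst _).add (absolutelyContinuousOnInterval_primitive hb')
  have key := mul_eq_add_integral_of_ac hAac hBac ha' hb'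
    (by
      filter_upwards [ha'.ae_hasDerivAt_integral] with x h1 hx
      exact (h1 hx 0 (by simp)).const_add (a 0))
    (by
      filter_upwards [hb'.ae_hasDerivAt_integral] with x h1 hx
      exact (h1 hx 0 (by simp)).const_add (b 0))
  rw [← ha X (by simp), ← hb X (by simp), intervalIntegral.integral_same,
    intervalIntegral.integral_same, add_zero, add_zero] at key
  rw [key]
  congr 1
  apply intervalIntegral.integral_congr
  intro t ht
  simp only
  rw [ha t ht, hb t ht]

theorem primitive_conj {a a' : ℝ → ℂ} {x : ℝ} (h : a x = a 0 + ∫ t in (0 : ℝ)..x, a' t) :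
    conj (a x) = conj (a 0) + ∫ t in (0 : ℝ)..x, conj (a' t) := by
  rw [h, map_add, intervalIntegral.intervalIntegral_conj]

theorem memLp_Icc_of_subset {S : Set ℝ} {q : ℝ → ℂ} (hq : MemLp q 2 (volume.restrict S)) {X : ℝ}
    (hS : Icc 0 X ⊆ S) : MemLp q 2 (volume.restrict (Icc 0 X)) :=
  hq.mono_measure (Measure.restrict_mono hS le_rfl)

theorem integrableOn_of_memLp {S : Set ℝ} {q : ℝ → ℂ} (hq : MemLp q 2 (volume.restrict S)) {X : ℝ}
    (hS : Icc 0 X ⊆ S) : IntegrableOn q (Icc 0 X) volume := by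
  have : IsFiniteMeasure (volume.restrict (Icc (0 : ℝ) X)) :=
    ⟨by rw [Measure.restrict_apply_univ]; exact isCompact_Icc.measure_lt_top⟩
  exact (memLp_Icc_of_subset hq hS).integrable (by norm_num)

theorem intervalIntegrable_of_memLp_restrict {S : Set ℝ} {q : ℝ → ℂ}
    (hq : MemLp q 2 (volume.restrict S)) {X : ℝ} (hX : 0 ≤ X) (hS : Icc 0 X ⊆ S) :
    IntervalIntegrable q volume 0 X := by
  have h := integrableOn_of_memLp hq hS
  rw [← uIcc_of_le hX] at h
  exact h.intervalIntegrable

theorem memLp_conj {μ : Measure ℝ} {q : ℝ → ℂ} (hq : MemLp q 2 μ) :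
    MemLp (fun x => conj (q x)) 2 μ := hq.star

/-- Green's formula on a bounded interval. -/
theorem IsH2.green {S : Set ℝ} {u u' u'' : ℝ → ℂ} (h : IsH2 S u u' u'') {X : ℝ}
    (hX : 0 ≤ X) (hS : Icc 0 X ⊆ S) :
    ∫ t in (0 : ℝ)..X, conj (u t) * u'' t
      = conj (u X) * u' X - conj (u 0) * u' 0 - ∫ t in (0 : ℝ)..X, conj (u' t) * u' t := by
  have hsub : ∀ x ∈ uIcc 0 X, x ∈ S := fun x hx => hS (by rwa [uIcc_of_le hX] at hx)
  have i1 := intervalIntegrable_of_memLp_restrict (memLp_conj h.memLp') hX hS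
  have i2 := intervalIntegrable_of_memLp_restrict h.memLp'' hX hS
  have key := primitive_mul (a := fun x => conj (u x)) (b := u') i1 i2
    (fun x hx => primitive_conj (h.eq_integral x (hsub x hx)))
    (fun x hx => h.eq_integral' x (hsub x hx))
  have m0 := memLp_Icc_of_subset (memLp_conj h.memLp) hS
  have m0' := memLp_Icc_of_subset (memLp_conj h.memLp') hS
  have m1 := memLp_Icc_of_subset h.memLp' hS
  have m2 := memLp_Icc_of_subset h.memLp'' hS
  have j1 : IntervalIntegrable (fun t => conj (u' t) * u' t) volume 0 X := by
    have : IntegrableOn (fun t => conj (u' t) * u' t) (Icc 0 X) volume := m0'.integrable_mul m1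
    rw [← uIcc_of_le hX] at this
    exact this.intervalIntegrable
  have j2 : IntervalIntegrable (fun t => conj (u t) * u'' t) volume 0 X := by
    have : IntegrableOn (fun t => conj (u t) * u'' t) (Icc 0 X) volume := m0.integrable_mul m2
    rw [← uIcc_of_le hX] at this
    exact this.intervalIntegrable
  rw [intervalIntegral.integral_add j1 j2] at key
  rw [key]
  ring

theorem integral_conj_mul_self (μ : Measure ℝ) (q : ℝ → ℂ) :
    ∫ t, conj (q t) * q t ∂μ = ((∫ t, ‖q t‖ ^ 2 ∂μ : ℝ) : ℂ) := by
  rw [← integral_complex_ofReal]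
  congr 1
  ext t
  rw [Complex.conj_mul']
  push_cast
  rfl

/-- Green's formula on a compact interval. -/
theorem IsH2.integral_Icc {l : ℝ} {u u' u'' : ℝ → ℂ} (h : IsH2 (Icc 0 l) u u' u'') (hl : 0 ≤ l) :
    ∫ t in Icc 0 l, conj (u t) * -u'' t
      = ((∫ t in Icc 0 l, ‖u' t‖ ^ 2 : ℝ) : ℂ) + conj (u 0) * u' 0 - conj (u l) * u' l := by
  have h1 := h.green hl subset_rfl
  rw [intervalIntegral.integral_of_le hl, intervalIntegral.integral_of_le hl,
    ← integral_Icc_eq_integral_Ioc, ← integral_Icc_eq_integral_Ioc, integral_conj_mul_self] at h1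
  simp only [mul_neg]
  rw [integral_neg, h1]
  ring

/-- Green's formula on a half line. -/
theorem IsH2.integral_Ici {u u' u'' : ℝ → ℂ} (h : IsH2 (Ici 0) u u' u'') :
    ∫ t in Ici 0, conj (u t) * -u'' t
      = ((∫ t in Ici 0, ‖u' t‖ ^ 2 : ℝ) : ℂ) + conj (u 0) * u' 0 := by
  have i1 : IntegrableOn (fun t => conj (u t) * u'' t) (Ici 0) :=
    (memLp_conj h.memLp).integrable_mul h.memLp''
  have i2 : IntegrableOn (fun t => conj (u' t) * u' t) (Ici 0) :=
    (memLp_conj h.memLp').integrable_mul h.memLp'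
  have i3 : IntegrableOn (fun t => conj (u t) * u' t) (Ici 0) :=
    (memLp_conj h.memLp).integrable_mul h.memLp'
  have t1 := intervalIntegral_tendsto_integral_Ioi (μ := volume) 0
    (i1.mono_set Ioi_subset_Ici_self) tendsto_id
  have t2 := intervalIntegral_tendsto_integral_Ioi (μ := volume) 0
    (i2.mono_set Ioi_subset_Ici_self) tendsto_id
  simp only [id] at t1 t2
  have t3 : Tendsto (fun X : ℝ => conj (u X) * u' X) atTop
      (𝓝 ((∫ t in Ioi 0, conj (u t) * u'' t) + conj (u 0) * u' 0
        + ∫ t in Ioi 0, conj (u' t) * u' t)) := by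
    refine ((t1.add_const (conj (u 0) * u' 0)).add t2).congr' ?_
    filter_upwards [eventually_ge_atTop 0] with X hX
    rw [h.green hX Icc_subset_Ici_self]
    ring
  -- The boundary term at infinity has a limit, and this limit is zero since `conj u * u'` is
  -- integrable on the half line.
  have hz : (∫ t in Ioi 0, conj (u t) * u'' t) + conj (u 0) * u' 0
        + ∫ t in Ioi 0, conj (u' t) * u' t = 0 := by
    refine IntegrableAtFilter.eq_zero_of_tendsto (μ := volume) ⟨Ici 0, Ici_mem_atTop 0, i3⟩ ?_ t3
    intro s hs
    obtain ⟨b, hb⟩ := mem_atTop_sets.1 hs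
    rw [← top_le_iff, ← Real.volume_Ici (a := b)]
    exact measure_mono hb
  rw [← integral_Ici_eq_integral_Ioi, ← integral_Ici_eq_integral_Ioi,
    integral_conj_mul_self] at hz
  simp only [mul_neg]
  rw [integral_neg]
  linear_combination -hz

/-- The Cauchy-Schwarz inequality on a bounded interval. -/
theorem integral_norm_le_sqrt_mul {S : Set ℝ} {q : ℝ → ℂ} (hq : MemLp q 2 (volume.restrict S))
    {X : ℝ} (hX : 0 ≤ X) (hS : Icc 0 X ⊆ S) :
    ∫ t in (0 : ℝ)..X, ‖q t‖ ≤ √X * (eLpNorm q 2 (volume.restrict S)).toReal := by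
  have hq' := memLp_Icc_of_subset hq hS
  rw [intervalIntegral.integral_of_le hX, ← integral_Icc_eq_integral_Ioc]
  have h1 := integrableOn_of_memLp hq hS
  have h2 := eLpNorm_le_eLpNorm_mul_rpow_measure_univ (p := 1) (q := 2) (by norm_num)
    hq'.aestronglyMeasurable
  have h3 : ∫ t in Icc 0 X, ‖q t‖ = (eLpNorm q 1 (volume.restrict (Icc 0 X))).toReal := by
    rw [eLpNorm_one_eq_lintegral_enorm, integral_norm_eq_lintegral_enorm h1.aestronglyMeasurable]
  rw [h3]
  have h4 : (volume.restrict (Icc 0 X) univ) ^ (1 / (1 : ENNReal).toReal - 1 / (2 : ENNReal).toReal)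
      = ENNReal.ofReal (√X) := by
    rw [Measure.restrict_apply_univ, Real.volume_Icc, sub_zero, Real.sqrt_eq_rpow,
      ENNReal.ofReal_rpow_of_nonneg hX (by norm_num)]
    norm_num
  rw [h4] at h2
  have h5 : eLpNorm q 2 (volume.restrict (Icc 0 X)) ≤ eLpNorm q 2 (volume.restrict S) :=
    eLpNorm_mono_measure _ (Measure.restrict_mono hS le_rfl)
  have h6 := h2.trans (mul_le_mul_left h5 _)
  have h7 := ENNReal.toReal_mono
    (ENNReal.mul_ne_top hq.eLpNorm_ne_top ENNReal.ofReal_ne_top) h6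
  rw [ENNReal.toReal_mul, ENNReal.toReal_ofReal (Real.sqrt_nonneg _)] at h7
  linarith

/-- The value at the end point of an interval is controlled by the `H¹` norm. -/
theorem norm_trace_le {S : Set ℝ} {v w : ℝ → ℂ} (hv : MemLp v 2 (volume.restrict S))
    (hw : MemLp w 2 (volume.restrict S)) {X : ℝ} (hX : 0 < X) (hS : Icc 0 X ⊆ S)
    (h : ∀ x ∈ S, v x = v 0 + ∫ t in (0 : ℝ)..x, w t) :
    ‖v 0‖ ≤ (√X / X) * (eLpNorm v 2 (volume.restrict S)).toReal
      + √X * (eLpNorm w 2 (volume.restrict S)).toReal := by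
  have iw := intervalIntegrable_of_memLp_restrict hw hX.le hS
  have iv := intervalIntegrable_of_memLp_restrict hv hX.le hS
  set c := ∫ t in (0 : ℝ)..X, ‖w t‖ with hc
  -- Integrating this pointwise inequality over `[0, X]` replaces point values of `v` by its mean,
  -- which the Cauchy-Schwarz inequality bounds.
  have hpt : ∀ x ∈ Icc 0 X, ‖v 0‖ - c ≤ ‖v x‖ := by
    intro x hx
    have h1 : ‖∫ t in (0 : ℝ)..x, w t‖ ≤ c := by
      refine (intervalIntegral.norm_integral_le_integral_norm hx.1).trans ?_
      exact intervalIntegral.integral_mono_interval le_rfl hx.1 hx.2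
        (ae_of_all _ fun t => norm_nonneg _) iw.norm
    have h2 : v 0 = v x - ∫ t in (0 : ℝ)..x, w t := by
      rw [h x (hS hx)]
      ring
    have h3 := norm_sub_le (v x) (∫ t in (0 : ℝ)..x, w t)
    rw [← h2] at h3
    linarith
  have h1 : ∫ t in (0 : ℝ)..X, (‖v 0‖ - c) ≤ ∫ t in (0 : ℝ)..X, ‖v t‖ :=
    intervalIntegral.integral_mono_on hX.le (by simp) iv.norm hpt
  rw [intervalIntegral.integral_const, sub_zero, smul_eq_mul] at h1
  have h2 := integral_norm_le_sqrt_mul hv hX.le hS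
  have h3 := integral_norm_le_sqrt_mul hw hX.le hS
  have h4 : ‖v 0‖ - c ≤ (√X / X) * (eLpNorm v 2 (volume.restrict S)).toReal := by
    rw [div_mul_eq_mul_div, le_div_iff₀ hX]
    linarith
  linarith

/-- `U`, `U'`, `U''` are the functions of class `H²` behind `P u = f`. -/
structure IsRealization {J K M : ℕ} (G : LeadGraph J K M) (ℓ : Fin M → ℝ) (u f : L2 K ℓ)
    (U U' U'' : Fin K ⊕ Fin M → ℝ → ℂ) : Prop where
  isH2 : ∀ e, IsH2 (edgeSet ℓ e) (U e) (U' e) (U'' e)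
  coe_eq : ∀ e, u e =ᵐ[edgeMeasure ℓ e] U e
  coe_eq'' : ∀ e, f e =ᵐ[edgeMeasure ℓ e] fun x => -U'' e x
  continuous : ContinuousAtVertices G ℓ U
  kirchhoff : Kirchhoff G ℓ U'

variable {J K M : ℕ} {G : LeadGraph J K M} {ℓ : Fin M → ℝ}

theorem hamiltonianRel_iff {u f : L2 K ℓ} :
    HamiltonianRel G ℓ u f ↔ ∃ U U' U'', IsRealization G ℓ u f U U' U'' :=
  ⟨fun ⟨U, U', U'', h1, h2, h3, h4, h5⟩ => ⟨U, U', U'', h1, h2, h3, h4, h5⟩,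
    fun ⟨U, U', U'', h1, h2, h3, h4, h5⟩ => ⟨U, U', U'', h1, h2, h3, h4, h5⟩⟩

/-- The Dirichlet integral. -/
def dirichlet (ℓ : Fin M → ℝ) (U' : Fin K ⊕ Fin M → ℝ → ℂ) : ℝ :=
  ∑ e, ∫ t, ‖U' e t‖ ^ 2 ∂(edgeMeasure ℓ e)

theorem dirichlet_nonneg (U' : Fin K ⊕ Fin M → ℝ → ℂ) : 0 ≤ dirichlet ℓ U' :=
  Finset.sum_nonneg fun _ _ => integral_nonneg fun _ => by positivity

theorem inner_L2_eq_sum (u f : L2 K ℓ) :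
    inner ℂ u f = ∑ e, ∫ t, conj (u e t) * f e t ∂(edgeMeasure ℓ e) := by
  rw [PiLp.inner_apply]
  refine Finset.sum_congr rfl fun e _ => ?_
  rw [L2.inner_def]
  congr 1
  ext t
  rw [RCLike.inner_apply']

/-- Green's formula on the graph: the boundary terms cancel. -/
theorem IsRealization.inner_eq {u f : L2 K ℓ} {U U' U'' : Fin K ⊕ Fin M → ℝ → ℂ}
    (h : IsRealization G ℓ u f U U' U'') (hℓ : ∀ m, 0 < ℓ m) :
    inner ℂ u f = (dirichlet ℓ U' : ℂ) := by
  have h1 : ∀ e, ∫ t, conj (u e t) * f e t ∂(edgeMeasure ℓ e)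
      = ∫ t, conj (U e t) * -U'' e t ∂(edgeMeasure ℓ e) := by
    intro e
    apply integral_congr_ae
    filter_upwards [h.coe_eq e, h.coe_eq'' e] with t h1 h2
    rw [h1, h2]
  rw [inner_L2_eq_sum, dirichlet]
  simp only [h1]
  rw [Fintype.sum_sum_type, Fintype.sum_sum_type]
  have h2 : ∀ k : Fin K, ∫ t, conj (U (Sum.inl k) t) * -U'' (Sum.inl k) t
        ∂(edgeMeasure ℓ (Sum.inl k : Fin K ⊕ Fin M))
      = ((∫ t, ‖U' (Sum.inl k) t‖ ^ 2 ∂(edgeMeasure ℓ (Sum.inl k : Fin K ⊕ Fin M)) : ℝ) : ℂ)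
        + conj (U (Sum.inl k) 0) * U' (Sum.inl k) 0 := fun k => (h.isH2 (Sum.inl k)).integral_Ici
  have h3 : ∀ m : Fin M, ∫ t, conj (U (Sum.inr m) t) * -U'' (Sum.inr m) t
        ∂(edgeMeasure ℓ (Sum.inr m : Fin K ⊕ Fin M))
      = ((∫ t, ‖U' (Sum.inr m) t‖ ^ 2 ∂(edgeMeasure ℓ (Sum.inr m : Fin K ⊕ Fin M)) : ℝ) : ℂ)
        + conj (U (Sum.inr m) 0) * U' (Sum.inr m) 0
        - conj (U (Sum.inr m) (ℓ m)) * U' (Sum.inr m) (ℓ m) :=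
    fun m => (h.isH2 (Sum.inr m)).integral_Icc (hℓ m).le
  obtain ⟨c, c1, c2, c3⟩ := h.continuous
  -- Grouped by vertices, the boundary terms at `v` have the common factor `conj (c v)`, which
  -- multiplies the Kirchhoff sum at `v`.
  have hbd : ∑ k, conj (U (Sum.inl k) 0) * U' (Sum.inl k) 0
      + ∑ m, (conj (U (Sum.inr m) 0) * U' (Sum.inr m) 0
        - conj (U (Sum.inr m) (ℓ m)) * U' (Sum.inr m) (ℓ m)) = 0 := by
    have hk : ∑ v : Fin J, conj (c v) * ((∑ k with G.leadVertex k = v, -U' (Sum.inl k) 0)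
        + (∑ m with G.source m = v, -U' (Sum.inr m) 0)
        + (∑ m with G.target m = v, U' (Sum.inr m) (ℓ m))) = 0 :=
      Finset.sum_eq_zero fun v _ => by rw [h.kirchhoff v, mul_zero]
    simp only [mul_add, Finset.sum_add_distrib, Finset.mul_sum] at hk
    have hfib : ∀ {n : ℕ} (p : Fin n → Fin J) (q : Fin n → ℂ),
        ∑ v, ∑ i with p i = v, conj (c v) * q i = ∑ i, conj (c (p i)) * q i := by
      intro n p q
      rw [← Finset.sum_fiberwise (s := Finset.univ) p (fun i => conj (c (p i)) * q i)]
      refine Finset.sum_congr rfl fun v _ => Finset.sum_congr rfl fun i hi => ?_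
      rw [(Finset.mem_filter.1 hi).2]
    rw [hfib, hfib, hfib] at hk
    simp only [c1, c2, c3, Finset.sum_sub_distrib]
    simp only [mul_neg, Finset.sum_neg_distrib] at hk
    linear_combination -hk
  simp only [h2, h3]
  push_cast
  simp only [Finset.sum_add_distrib, Finset.sum_sub_distrib] at hbd ⊢
  linear_combination hbd

/-- The energy estimate for `P u = g + z² u` in the physical half plane. -/
theorem IsRealization.energy_le {u g : L2 K ℓ} {z : ℂ} {U U' U'' : Fin K ⊕ Fin M → ℝ → ℂ}
    (h : IsRealization G ℓ u (g + z ^ 2 • u) U U' U'') (hℓ : ∀ m, 0 < ℓ m) :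
    z.im * (dirichlet ℓ U' + ‖z‖ ^ 2 * ‖u‖ ^ 2) ≤ ‖z‖ * (‖u‖ * ‖g‖) := by
  have h1 := h.inner_eq hℓ
  rw [inner_add_right, inner_smul_right, inner_self_eq_norm_sq_to_K] at h1
  -- After multiplication by `conj z` the Dirichlet integral and `‖u‖²` enter the imaginary part
  -- with the same sign. Without it `‖u‖²` would carry the factor `Im z²`, which is useless near the
  -- imaginary axis.
  have h2 : conj z * inner ℂ u g = conj z * (dirichlet ℓ U' : ℂ) - z * ((‖z‖ ^ 2 * ‖u‖ ^ 2 : ℝ)) := by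
    have hzz : conj z * z = ((‖z‖ ^ 2 : ℝ) : ℂ) := by
      rw [Complex.conj_mul']
      push_cast
      rfl
    rw [← h1]
    push_cast at hzz ⊢
    rw [← hzz]
    simp only [RCLike.ofReal_eq_complex_ofReal] at *
    ring
  have h3 : (conj z * inner ℂ u g).im = -(z.im * (dirichlet ℓ U' + ‖z‖ ^ 2 * ‖u‖ ^ 2)) := by
    rw [h2, Complex.sub_im, Complex.im_mul_ofReal, Complex.im_mul_ofReal, Complex.conj_im]
    ring
  have h4 := Complex.abs_im_le_norm (conj z * inner ℂ u g)
  rw [h3, norm_mul, RCLike.norm_conj, abs_neg] at h4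
  calc z.im * (dirichlet ℓ U' + ‖z‖ ^ 2 * ‖u‖ ^ 2)
      ≤ |z.im * (dirichlet ℓ U' + ‖z‖ ^ 2 * ‖u‖ ^ 2)| := le_abs_self _
    _ ≤ ‖z‖ * ‖inner ℂ u g‖ := h4
    _ ≤ ‖z‖ * (‖u‖ * ‖g‖) :=
        mul_le_mul_of_nonneg_left (norm_inner_le_norm u g) (norm_nonneg _)

/-- The resolvent estimate in the physical half plane. -/
theorem HamiltonianRel.norm_le {u g : L2 K ℓ} {z : ℂ}
    (h : HamiltonianRel G ℓ u (g + z ^ 2 • u)) (hℓ : ∀ m, 0 < ℓ m) (hz : 0 < z.im) :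
    ‖u‖ ≤ ‖g‖ / (‖z‖ * z.im) := by
  obtain ⟨U, U', U'', hr⟩ := hamiltonianRel_iff.1 h
  have h1 := hr.energy_le hℓ
  have hz0 : 0 < ‖z‖ := norm_pos_iff.2 fun h0 => by simp [h0] at hz
  have h2 := dirichlet_nonneg (ℓ := ℓ) U'
  rw [le_div_iff₀ (by positivity)]
  rcases (norm_nonneg u).eq_or_lt with hu | hu
  · rw [← hu, zero_mul]
    exact norm_nonneg g
  · have h3 : z.im * (‖z‖ ^ 2 * ‖u‖ ^ 2) ≤ ‖z‖ * (‖u‖ * ‖g‖) := by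
      have := mul_nonneg hz.le h2
      linarith
    have h4 : (‖z‖ * ‖u‖) * (‖u‖ * (‖z‖ * z.im)) ≤ (‖z‖ * ‖u‖) * ‖g‖ := by
      linarith
    exact le_of_mul_le_mul_left h4 (by positivity)

end QGraph
end

/-! ### The Hamiltonian is closed -/

noncomputable section

namespace QGraph

open Topology Filter
open scoped ComplexConjugate

variable {J K M : ℕ} {G : LeadGraph J K M} {ℓ : Fin M → ℝ}

theorem cauchySeq_of_norm_sub_le {A B C : Type*} [SeminormedAddCommGroup A]
    [SeminormedAddCommGroup B] [SeminormedAddCommGroup C] {a : ℕ → A} {b : ℕ → B} {c : ℕ → C}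
    {k₁ k₂ : ℝ} (hk₁ : 0 ≤ k₁) (hk₂ : 0 ≤ k₂) (hb : CauchySeq b) (hc : CauchySeq c)
    (h : ∀ n m, ‖a n - a m‖ ≤ k₁ * ‖b n - b m‖ + k₂ * ‖c n - c m‖) : CauchySeq a := by
  rw [Metric.cauchySeq_iff] at hb hc ⊢
  intro ε hε
  obtain ⟨N₁, h1⟩ := hb (ε / (2 * (k₁ + 1))) (by positivity)
  obtain ⟨N₂, h2⟩ := hc (ε / (2 * (k₂ + 1))) (by positivity)
  refine ⟨max N₁ N₂, fun m hm n hn => ?_⟩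
  have h3 := h1 m (le_of_max_le_left hm) n (le_of_max_le_left hn)
  have h4 := h2 m (le_of_max_le_right hm) n (le_of_max_le_right hn)
  rw [dist_eq_norm, lt_div_iff₀ (by positivity)] at h3 h4
  rw [dist_eq_norm]
  have h5 := h m n
  have h6 := norm_nonneg (b m - b n)
  have h7 := norm_nonneg (c m - c n)
  nlinarith

/-- By Cauchy-Schwarz, integration over `[0, x]` is a bounded functional on `L²`, of norm at most
`√x`. -/
theorem tendsto_primitive_of_Lp {S : Set ℝ} {q : ℕ → ℝ → ℂ} {Q : ℝ → ℂ}
    {g : ℕ → Lp ℂ 2 (volume.restrict S)} {g₀ : Lp ℂ 2 (volume.restrict S)}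
    (hg : Tendsto g atTop (𝓝 g₀)) (hq : ∀ n, g n =ᵐ[volume.restrict S] q n)
    (hQ : g₀ =ᵐ[volume.restrict S] Q) {x : ℝ} (hx : 0 ≤ x) (hS : Icc 0 x ⊆ S) :
    Tendsto (fun n => ∫ t in (0 : ℝ)..x, q n t) atTop (𝓝 (∫ t in (0 : ℝ)..x, Q t)) := by
  have hqm : ∀ n, MemLp (q n) 2 (volume.restrict S) := fun n => (memLp_congr_ae (hq n)).1 (Lp.memLp _)
  have hQm : MemLp Q 2 (volume.restrict S) := (memLp_congr_ae hQ).1 (Lp.memLp _)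
  have hbound : ∀ n, ‖(∫ t in (0 : ℝ)..x, q n t) - ∫ t in (0 : ℝ)..x, Q t‖ ≤ √x * ‖g n - g₀‖ := by
    intro n
    rw [← intervalIntegral.integral_sub (intervalIntegrable_of_memLp_restrict (hqm n) hx hS)
      (intervalIntegrable_of_memLp_restrict hQm hx hS)]
    refine (intervalIntegral.norm_integral_le_integral_norm hx).trans ?_
    refine (integral_norm_le_sqrt_mul ((hqm n).sub hQm) hx hS).trans_eq ?_
    rw [Lp.norm_def]
    congr 2
    apply eLpNorm_congr_ae
    exact ((hq n).symm.sub hQ.symm).trans (Lp.coeFn_sub _ _).symm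
  rw [tendsto_iff_norm_sub_tendsto_zero] at hg ⊢
  refine squeeze_zero (fun _ => norm_nonneg _) hbound ?_
  simpa using hg.const_mul (√x)

/-- A subsequence of an `L²` convergent sequence converges almost everywhere, so its limit must be
the pointwise one. This identifies abstract limits with the concrete primitives below. -/
theorem ae_eq_of_tendsto_Lp {S : Set ℝ} (hS : MeasurableSet S) {q : ℕ → ℝ → ℂ} {Q : ℝ → ℂ}
    {g : ℕ → Lp ℂ 2 (volume.restrict S)} {g₀ : Lp ℂ 2 (volume.restrict S)}
    (hg : Tendsto g atTop (𝓝 g₀)) (hq : ∀ n, g n =ᵐ[volume.restrict S] q n)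
    (hQ : ∀ x ∈ S, Tendsto (fun n => q n x) atTop (𝓝 (Q x))) :
    g₀ =ᵐ[volume.restrict S] Q := by
  obtain ⟨ns, hns, h⟩ := (tendstoInMeasure_of_tendsto_Lp hg).exists_seq_tendsto_ae
  filter_upwards [h, ae_all_iff.2 hq, ae_restrict_mem hS] with x h1 h2 h3
  have h4 := (hQ x h3).comp hns.tendsto_atTop
  have h5 : (fun i => g (ns i) x) = (fun n => q n x) ∘ ns := by
    ext i
    exact h2 (ns i)
  rw [h5] at h1
  exact tendsto_nhds_unique h1 h4

theorem IsH2.sub {S : Set ℝ} (hS : ∀ x ∈ S, 0 ≤ x ∧ Icc 0 x ⊆ S) {u u' u'' v v' v'' : ℝ → ℂ}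
    (hu : IsH2 S u u' u'') (hv : IsH2 S v v' v'') :
    IsH2 S (fun x => u x - v x) (fun x => u' x - v' x) (fun x => u'' x - v'' x) := by
  refine ⟨hu.memLp.sub hv.memLp, hu.memLp'.sub hv.memLp', hu.memLp''.sub hv.memLp'', ?_, ?_⟩
  · intro x hx
    rw [intervalIntegral.integral_sub
      (intervalIntegrable_of_memLp_restrict hu.memLp' (hS x hx).1 (hS x hx).2)
      (intervalIntegrable_of_memLp_restrict hv.memLp' (hS x hx).1 (hS x hx).2),
      hu.eq_integral x hx, hv.eq_integral x hx]
    ring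
  · intro x hx
    rw [intervalIntegral.integral_sub
      (intervalIntegrable_of_memLp_restrict hu.memLp'' (hS x hx).1 (hS x hx).2)
      (intervalIntegrable_of_memLp_restrict hv.memLp'' (hS x hx).1 (hS x hx).2),
      hu.eq_integral' x hx, hv.eq_integral' x hx]
    ring

theorem nonneg_and_Icc_subset_of_mem_edgeSet {e : Fin K ⊕ Fin M} {x : ℝ}
    (hx : x ∈ edgeSet ℓ e) : 0 ≤ x ∧ Icc 0 x ⊆ edgeSet ℓ e := by
  have h0 : 0 ≤ x := by
    cases e with
    | inl k => exact hx
    | inr m => exact hx.1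
  refine ⟨h0, ?_⟩
  rw [← uIcc_of_le h0]
  exact edgeSet_sub ℓ e hx

theorem IsRealization.sub {u f v g : L2 K ℓ} {U U' U'' V V' V'' : Fin K ⊕ Fin M → ℝ → ℂ}
    (hu : IsRealization G ℓ u f U U' U'') (hv : IsRealization G ℓ v g V V' V'') :
    IsRealization G ℓ (u - v) (f - g) (fun e x => U e x - V e x) (fun e x => U' e x - V' e x)
      (fun e x => U'' e x - V'' e x) := by
  refine ⟨fun e => (hu.isH2 e).sub (fun x hx => nonneg_and_Icc_subset_of_mem_edgeSet hx)
    (hv.isH2 e), fun e => ?_, fun e => ?_, ?_, ?_⟩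
  · exact (Lp.coeFn_sub (u e) (v e)).trans ((hu.coe_eq e).sub (hv.coe_eq e))
  · refine (Lp.coeFn_sub (f e) (g e)).trans ?_
    filter_upwards [hu.coe_eq'' e, hv.coe_eq'' e] with x h1 h2
    rw [Pi.sub_apply, h1, h2]
    ring
  · obtain ⟨c, c1, c2, c3⟩ := hu.continuous
    obtain ⟨d, d1, d2, d3⟩ := hv.continuous
    exact ⟨c - d, fun k => by simp [c1, d1], fun m => by simp [c2, d2], fun m => by simp [c3, d3]⟩
  · intro w
    have h1 := hu.kirchhoff w
    have h2 := hv.kirchhoff w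
    simp only [neg_sub, Finset.sum_sub_distrib, Finset.sum_neg_distrib] at h1 h2 ⊢
    linear_combination h1 - h2

theorem eLpNorm_toReal_sq {μ : Measure ℝ} {q : ℝ → ℂ} (hq : MemLp q 2 μ) :
    (eLpNorm q 2 μ).toReal ^ 2 = ∫ t, ‖q t‖ ^ 2 ∂μ := by
  have h := hq.eLpNorm_eq_integral_rpow_norm (by norm_num) (by norm_num)
  have h0 : 0 ≤ ∫ t, ‖q t‖ ^ 2 ∂μ := integral_nonneg fun _ => by positivity
  simp only [ENNReal.toReal_ofNat, Real.rpow_ofNat] at h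
  rw [h, ENNReal.toReal_ofReal (by positivity), ← one_div, ← Real.sqrt_eq_rpow, Real.sq_sqrt h0]

/-- The `L²` norm of the derivative is controlled by those of the function and of its image under
the Hamiltonian. -/
theorem IsRealization.eLpNorm_deriv_sq_le {u f : L2 K ℓ} {U U' U'' : Fin K ⊕ Fin M → ℝ → ℂ}
    (h : IsRealization G ℓ u f U U' U'') (hℓ : ∀ m, 0 < ℓ m) (e : Fin K ⊕ Fin M) :
    (eLpNorm (U' e) 2 (edgeMeasure ℓ e)).toReal ^ 2 ≤ ‖u‖ * ‖f‖ := by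
  rw [eLpNorm_toReal_sq (h.isH2 e).memLp']
  have h1 : ∫ t, ‖U' e t‖ ^ 2 ∂(edgeMeasure ℓ e) ≤ dirichlet ℓ U' :=
    Finset.single_le_sum (f := fun e => ∫ t, ‖U' e t‖ ^ 2 ∂(edgeMeasure ℓ e))
      (fun _ _ => integral_nonneg fun _ => by positivity) (Finset.mem_univ e)
  have h2 := norm_inner_le_norm (𝕜 := ℂ) u f
  rw [h.inner_eq hℓ, Complex.norm_real, Real.norm_of_nonneg (dirichlet_nonneg U')] at h2
  exact h1.trans h2

/-- The length of a bounded initial piece of an edge. -/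
def pieceLength (ℓ : Fin M → ℝ) : Fin K ⊕ Fin M → ℝ
  | Sum.inl _ => 1
  | Sum.inr m => ℓ m

theorem pieceLength_pos (hℓ : ∀ m, 0 < ℓ m) (e : Fin K ⊕ Fin M) : 0 < pieceLength ℓ e := by
  cases e with
  | inl k => exact one_pos
  | inr m => exact hℓ m

theorem Icc_pieceLength_subset (e : Fin K ⊕ Fin M) : Icc 0 (pieceLength ℓ e) ⊆ edgeSet ℓ e := by
  cases e with
  | inl k => exact Icc_subset_Ici_self
  | inr m => exact subset_rfl

theorem zero_mem_edgeSet (hℓ : ∀ m, 0 < ℓ m) (e : Fin K ⊕ Fin M) : (0 : ℝ) ∈ edgeSet ℓ e :=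
  Icc_pieceLength_subset e ⟨le_rfl, (pieceLength_pos hℓ e).le⟩

theorem norm_apply_le (u : L2 K ℓ) (e : Fin K ⊕ Fin M) : ‖u e‖ ≤ ‖u‖ := PiLp.norm_apply_le u e

/-- The Hamiltonian is closed. -/
theorem hamiltonianRel_of_tendsto (hℓ : ∀ m, 0 < ℓ m) {u f : ℕ → L2 K ℓ} {u₀ f₀ : L2 K ℓ}
    (hrel : ∀ n, HamiltonianRel G ℓ (u n) (f n)) (hu : Tendsto u atTop (𝓝 u₀))
    (hf : Tendsto f atTop (𝓝 f₀)) : HamiltonianRel G ℓ u₀ f₀ := by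
  have hrel' : ∀ n, ∃ U U' U'', IsRealization G ℓ (u n) (f n) U U' U'' := fun n =>
    hamiltonianRel_iff.1 (hrel n)
  choose U U' U'' hr using hrel'
  have hue : ∀ e, Tendsto (fun n => u n e) atTop (𝓝 (u₀ e)) := fun e =>
    ((PiLp.continuous_apply 2 _ e).tendsto u₀).comp hu
  have hfe : ∀ e, Tendsto (fun n => f n e) atTop (𝓝 (f₀ e)) := fun e =>
    ((PiLp.continuous_apply 2 _ e).tendsto f₀).comp hf
  let p : ∀ (n : ℕ) (e : Fin K ⊕ Fin M), Lp ℂ 2 (edgeMeasure ℓ e) := fun n e =>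
    ((hr n).isH2 e).memLp'.toLp (U' n e)
  have hp : ∀ n e, p n e =ᵐ[edgeMeasure ℓ e] U' n e := fun n e => MemLp.coeFn_toLp _
  have hpc : ∀ e, CauchySeq fun n => p n e := by
    intro e
    -- Convergence of the derivatives is not assumed; Green's formula for the differences provides
    -- it.
    have hb : ∀ n m, ‖p n e - p m e‖ ^ 2 ≤ ‖u n - u m‖ * ‖f n - f m‖ := by
      intro n m
      refine le_of_eq_of_le ?_ (((hr n).sub (hr m)).eLpNorm_deriv_sq_le hℓ e)
      rw [Lp.norm_def]
      congr 2
      exact eLpNorm_congr_ae ((Lp.coeFn_sub _ _).trans ((hp n e).sub (hp m e)))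
    have hu' := hu.cauchySeq
    have hf' := hf.cauchySeq
    rw [Metric.cauchySeq_iff] at hu' hf' ⊢
    intro ε hε
    obtain ⟨N₁, h1⟩ := hu' ε hε
    obtain ⟨N₂, h2⟩ := hf' ε hε
    refine ⟨max N₁ N₂, fun m hm n hn => ?_⟩
    have h3 := h1 m (le_of_max_le_left hm) n (le_of_max_le_left hn)
    have h4 := h2 m (le_of_max_le_right hm) n (le_of_max_le_right hn)
    rw [dist_eq_norm] at h3 h4 ⊢
    have h5 : ‖p m e - p n e‖ ^ 2 < ε ^ 2 := by
      refine (hb m n).trans_lt ?_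
      rw [sq]
      exact mul_lt_mul'' h3 h4 (norm_nonneg _) (norm_nonneg _)
    exact lt_of_pow_lt_pow_left₀ 2 hε.le h5
  have hlim : ∀ e, ∃ q, Tendsto (fun n => p n e) atTop (𝓝 q) := fun e =>
    cauchySeq_tendsto_of_complete (hpc e)
  choose q hq using hlim
  -- The initial values of `U n` and, below, of `U' n` converge because the trace inequality bounds
  -- them by `L²` norms of Cauchy sequences.
  have hc0 : ∀ e, ∃ c, Tendsto (fun n => U n e 0) atTop (𝓝 c) := by
    intro e
    refine cauchySeq_tendsto_of_complete ?_
    refine cauchySeq_of_norm_sub_le (k₁ := √(pieceLength ℓ e) / pieceLength ℓ e)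
      (k₂ := √(pieceLength ℓ e)) (by have := pieceLength_pos hℓ e; positivity) (by positivity)
      (hue e).cauchySeq (hpc e) fun n m => ?_
    have h := ((hr n).sub (hr m)).isH2 e
    refine (norm_trace_le h.memLp h.memLp' (pieceLength_pos hℓ e) (Icc_pieceLength_subset e)
      h.eq_integral).trans_eq ?_
    rw [Lp.norm_def, Lp.norm_def]
    congr 3
    · exact eLpNorm_congr_ae
        ((((hr n).coe_eq e).symm.sub ((hr m).coe_eq e).symm).trans (Lp.coeFn_sub _ _).symm)
    · exact eLpNorm_congr_ae (((hp n e).symm.sub (hp m e).symm).trans (Lp.coeFn_sub _ _).symm)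
  have hc1 : ∀ e, ∃ c, Tendsto (fun n => U' n e 0) atTop (𝓝 c) := by
    intro e
    refine cauchySeq_tendsto_of_complete ?_
    refine cauchySeq_of_norm_sub_le (k₁ := √(pieceLength ℓ e) / pieceLength ℓ e)
      (k₂ := √(pieceLength ℓ e)) (by have := pieceLength_pos hℓ e; positivity) (by positivity)
      (hpc e) (hfe e).cauchySeq fun n m => ?_
    have h := ((hr n).sub (hr m)).isH2 e
    refine (norm_trace_le h.memLp' h.memLp'' (pieceLength_pos hℓ e) (Icc_pieceLength_subset e)
      h.eq_integral').trans_eq ?_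
    rw [Lp.norm_def, Lp.norm_def]
    congr 3
    · exact eLpNorm_congr_ae (((hp n e).symm.sub (hp m e).symm).trans (Lp.coeFn_sub _ _).symm)
    · rw [← eLpNorm_neg]
      refine eLpNorm_congr_ae ?_
      filter_upwards [(hr n).coe_eq'' e, (hr m).coe_eq'' e, Lp.coeFn_sub (f n e) (f m e)]
        with x h1 h2 h3
      rw [h3, Pi.sub_apply, h1, h2, Pi.neg_apply]
      ring
  choose c₀ hc₀ using hc0
  choose c₁ hc₁ using hc1
  -- The limit is rebuilt by integrating `-f₀` twice from the limits of the initial values. Thus it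
  -- satisfies the `H²` identities by construction, and it is the limit of `U n` at every point,
  -- endpoints included, so the vertex conditions pass to the limit.
  set W'' : Fin K ⊕ Fin M → ℝ → ℂ := fun e x => -(f₀ e x) with hW''
  set W' : Fin K ⊕ Fin M → ℝ → ℂ := fun e x => c₁ e + ∫ t in (0 : ℝ)..x, W'' e t with hW'
  set W : Fin K ⊕ Fin M → ℝ → ℂ := fun e x => c₀ e + ∫ t in (0 : ℝ)..x, W' e t with hW
  have hlim' : ∀ e, ∀ x ∈ edgeSet ℓ e, Tendsto (fun n => U' n e x) atTop (𝓝 (W' e x)) := by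
    intro e x hx
    obtain ⟨h0, hsub⟩ := nonneg_and_Icc_subset_of_mem_edgeSet hx
    have h1 := tendsto_primitive_of_Lp (hfe e) (fun n => (hr n).coe_eq'' e)
      (Q := fun x => f₀ e x) (ae_eq_refl _) h0 hsub
    have h2 : W' e x = c₁ e - ∫ t in (0 : ℝ)..x, f₀ e t := by
      simp only [hW', hW'', intervalIntegral.integral_neg]
      ring
    rw [h2]
    refine ((hc₁ e).sub h1).congr fun n => ?_
    rw [((hr n).isH2 e).eq_integral' x hx, intervalIntegral.integral_neg]
    ring
  have hqW' : ∀ e, q e =ᵐ[edgeMeasure ℓ e] W' e := fun e =>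
    ae_eq_of_tendsto_Lp (measurableSet_edgeSet ℓ e) (hq e) (fun n => hp n e) (hlim' e)
  have hlim0 : ∀ e, ∀ x ∈ edgeSet ℓ e, Tendsto (fun n => U n e x) atTop (𝓝 (W e x)) := by
    intro e x hx
    obtain ⟨h0, hsub⟩ := nonneg_and_Icc_subset_of_mem_edgeSet hx
    have h1 := tendsto_primitive_of_Lp (hq e) (fun n => hp n e) (hqW' e) h0 hsub
    refine ((hc₀ e).add h1).congr fun n => ?_
    rw [((hr n).isH2 e).eq_integral x hx]
  have huW : ∀ e, u₀ e =ᵐ[edgeMeasure ℓ e] W e := fun e =>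
    ae_eq_of_tendsto_Lp (measurableSet_edgeSet ℓ e) (hue e) (fun n => (hr n).coe_eq e) (hlim0 e)
  refine hamiltonianRel_iff.2 ⟨W, W', W'', fun e => ⟨?_, ?_, ?_, ?_, ?_⟩, huW, fun e => ?_, ?_, ?_⟩
  · exact (memLp_congr_ae (huW e)).1 (Lp.memLp _)
  · exact (memLp_congr_ae (hqW' e)).1 (Lp.memLp _)
  · exact (Lp.memLp (f₀ e)).neg
  · intro x _
    simp [hW]
  · intro x _
    simp [hW']
  · simp only [hW'', neg_neg]
    exact ae_eq_refl _
  · have hend : ∀ m, ℓ m ∈ edgeSet ℓ (Sum.inr m : Fin K ⊕ Fin M) := fun m => ⟨(hℓ m).le, le_rfl⟩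
    have hcont : ∀ v : Fin J, ∃ c : ℂ, (∀ k, G.leadVertex k = v → W (Sum.inl k) 0 = c) ∧
        (∀ m, G.source m = v → W (Sum.inr m) 0 = c) ∧
        (∀ m, G.target m = v → W (Sum.inr m) (ℓ m) = c) := by
      intro v
      choose c c1 c2 c3 using fun n => (hr n).continuous
      have e1 : ∀ k, G.leadVertex k = v →
          Tendsto (fun n => c n v) atTop (𝓝 (W (Sum.inl k) 0)) := fun k hk =>
        (hlim0 (Sum.inl k) 0 (zero_mem_edgeSet hℓ _)).congr fun n => by rw [c1, hk]
      have e2 : ∀ m, G.source m = v →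
          Tendsto (fun n => c n v) atTop (𝓝 (W (Sum.inr m) 0)) := fun m hm =>
        (hlim0 (Sum.inr m) 0 (zero_mem_edgeSet hℓ _)).congr fun n => by rw [c2, hm]
      have e3 : ∀ m, G.target m = v →
          Tendsto (fun n => c n v) atTop (𝓝 (W (Sum.inr m) (ℓ m))) := fun m hm =>
        (hlim0 (Sum.inr m) (ℓ m) (hend m)).congr fun n => by rw [c3, hm]
      -- If some edge ends at `v`, the sequence `c n v` converges; otherwise the value is irrelevant
      -- and all three conditions are vacuous.
      refine ⟨limUnder atTop fun n => c n v, fun k hk => ?_, fun m hm => ?_, fun m hm => ?_⟩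
      · exact (e1 k hk).limUnder_eq.symm
      · exact (e2 m hm).limUnder_eq.symm
      · exact (e3 m hm).limUnder_eq.symm
    choose c hc using hcont
    exact ⟨c, fun k => (hc _).1 k rfl, fun m => (hc _).2.1 m rfl, fun m => (hc _).2.2 m rfl⟩
  · intro v
    have hend : ∀ m, ℓ m ∈ edgeSet ℓ (Sum.inr m : Fin K ⊕ Fin M) := fun m => ⟨(hℓ m).le, le_rfl⟩
    have h1 : Tendsto (fun n => (∑ k with G.leadVertex k = v, -U' n (Sum.inl k) 0)
        + (∑ m with G.source m = v, -U' n (Sum.inr m) 0)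
        + (∑ m with G.target m = v, U' n (Sum.inr m) (ℓ m))) atTop
        (𝓝 ((∑ k with G.leadVertex k = v, -W' (Sum.inl k) 0)
        + (∑ m with G.source m = v, -W' (Sum.inr m) 0)
        + (∑ m with G.target m = v, W' (Sum.inr m) (ℓ m)))) := by
      refine ((tendsto_finsetSum _ fun k _ => ?_).add (tendsto_finsetSum _ fun m _ => ?_)).add
        (tendsto_finsetSum _ fun m _ => ?_)
      · exact (hlim' _ 0 (zero_mem_edgeSet hℓ _)).neg
      · exact (hlim' _ 0 (zero_mem_edgeSet hℓ _)).neg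
      · exact hlim' _ _ (hend m)
    have h2 : (fun n => (∑ k with G.leadVertex k = v, -U' n (Sum.inl k) 0)
        + (∑ m with G.source m = v, -U' n (Sum.inr m) 0)
        + (∑ m with G.target m = v, U' n (Sum.inr m) (ℓ m))) = fun _ => (0 : ℂ) :=
      funext fun n => (hr n).kirchhoff v
    rw [h2] at h1
    exact (tendsto_nhds_unique h1 tendsto_const_nhds)

end QGraph
end

/-! ### Cutoffs and existence of the resolvent -/

noncomputable section

namespace QGraph

open Topology Filter
open scoped ComplexConjugate

variable {J K M : ℕ} {G : LeadGraph J K M} {ℓ : Fin M → ℝ}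

theorem HamiltonianRel.sub {u f v g : L2 K ℓ} (hu : HamiltonianRel G ℓ u f)
    (hv : HamiltonianRel G ℓ v g) : HamiltonianRel G ℓ (u - v) (f - g) := by
  have := hu.add (hv.smul (-1))
  simpa [sub_eq_add_neg] using this

theorem hamiltonianRel_coe (u : (hamiltonian G ℓ).domain) :
    HamiltonianRel G ℓ u (hamiltonian G ℓ u) :=
  (mem_graph_hamiltonian G ℓ _ _).1 (LinearPMap.mem_graph _ u)

theorem HamiltonianRel.exists_mem_domain {u f : L2 K ℓ} (h : HamiltonianRel G ℓ u f) :
    ∃ hu : u ∈ (hamiltonian G ℓ).domain, hamiltonian G ℓ ⟨u, hu⟩ = f := by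
  obtain ⟨y, h1, h2⟩ := LinearPMap.mem_graph_iff _ |>.1 ((mem_graph_hamiltonian G ℓ u f).2 h)
  subst h1
  exact ⟨y.2, h2⟩

theorem cutoff_apply (ρ : ℝ) (f : L2 K ℓ) (e : Fin K ⊕ Fin M) :
    cutoff ℓ ρ f e = indicatorLp (measurableSet_truncatedEdge ℓ ρ e) (f e) := rfl

theorem coeFn_cutoff (ρ : ℝ) (f : L2 K ℓ) (e : Fin K ⊕ Fin M) :
    cutoff ℓ ρ f e =ᵐ[edgeMeasure ℓ e] (truncatedEdge ℓ ρ e).indicator (f e) := by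
  rw [cutoff_apply]
  exact coeFn_indicatorLp _ _

theorem norm_cutoff_apply_le (ρ : ℝ) (f : L2 K ℓ) : ‖cutoff ℓ ρ f‖ ≤ ‖f‖ := by
  rw [PiLp.norm_eq_of_L2, PiLp.norm_eq_of_L2]
  refine Real.sqrt_le_sqrt (Finset.sum_le_sum fun e _ => ?_)
  rw [cutoff_apply]
  have := norm_indicatorLp_le (measurableSet_truncatedEdge ℓ ρ e) (f e)
  rw [one_mul] at this
  exact pow_le_pow_left₀ (norm_nonneg _) this 2

theorem norm_cutoff_le (ρ : ℝ) : ‖(cutoff ℓ ρ : L2 K ℓ →L[ℂ] L2 K ℓ)‖ ≤ 1 :=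
  ContinuousLinearMap.opNorm_le_bound _ zero_le_one fun f => by
    rw [one_mul]; exact norm_cutoff_apply_le ρ f

/-- Dominated convergence on every edge: at a fixed point the cutoff is eventually inactive. The
shift `n + 1` keeps the radii positive, as needed when the equation is solved for truncated data. -/
theorem tendsto_cutoff (f : L2 K ℓ) :
    Tendsto (fun n : ℕ => cutoff ℓ (n + 1) f) atTop (𝓝 f) := by
  have hcomp : ∀ e, Tendsto (fun n : ℕ => cutoff ℓ (n + 1) f e) atTop (𝓝 (f e)) := by
    intro e
    rw [tendsto_iff_norm_sub_tendsto_zero]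
    have hsq : Tendsto (fun n : ℕ => ‖cutoff ℓ (n + 1) f e - f e‖ ^ 2) atTop (𝓝 0) := by
      have h1 : ∀ n : ℕ, ‖cutoff ℓ (n + 1) f e - f e‖ ^ 2
          = ∫ t, ‖(truncatedEdge ℓ (n + 1) e).indicator (f e) t - f e t‖ ^ 2
            ∂(edgeMeasure ℓ e) := by
        intro n
        rw [Lp.norm_def, eLpNorm_toReal_sq (Lp.memLp _)]
        apply integral_congr_ae
        filter_upwards [Lp.coeFn_sub (cutoff ℓ (n + 1) f e) (f e), coeFn_cutoff (n + 1) f e]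
          with t h1 h2
        rw [h1, Pi.sub_apply, h2]
      simp only [h1]
      have h0 : (0 : ℝ) = ∫ _, (0 : ℝ) ∂(edgeMeasure ℓ e) := by simp
      rw [h0]
      refine tendsto_integral_of_dominated_convergence (fun t => ‖f e t‖ ^ 2) ?_ ?_ ?_ ?_
      · intro n
        exact ((((Lp.aestronglyMeasurable (f e)).indicator
          (measurableSet_truncatedEdge ℓ (n + 1) e)).sub (Lp.aestronglyMeasurable (f e))).norm.pow 2)
      · exact (Lp.memLp (f e)).integrable_norm_pow (by norm_num)
      · intro n
        refine ae_of_all _ fun t => ?_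
        by_cases ht : t ∈ truncatedEdge ℓ (n + 1) e
        · rw [indicator_of_mem ht]
          simp
        · rw [indicator_of_notMem ht]
          simp
      · filter_upwards [ae_restrict_mem (measurableSet_edgeSet ℓ e)] with t ht
        refine tendsto_const_nhds.congr' ?_
        obtain ⟨N, hN⟩ := exists_nat_ge t
        filter_upwards [eventually_ge_atTop N] with n hn
        have hmem : t ∈ truncatedEdge ℓ (n + 1) e := by
          cases e with
          | inl k =>
            have h3 : (N : ℝ) ≤ n := by exact_mod_cast hn
            exact ⟨ht, by linarith⟩
          | inr m => exact ht
        rw [indicator_of_mem hmem]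
        simp
    have := hsq.sqrt
    simpa using this
  have h := (PiLp.continuous_toLp 2 (fun e : Fin K ⊕ Fin M => Lp ℂ 2 (edgeMeasure ℓ e))).tendsto
    (fun e => f e)
  exact h.comp (tendsto_pi_nhds.2 hcomp)

/-- If `P u - z² u = f` can be solved for truncated `f`, then the resolvent exists. -/
theorem exists_isResolvent (hℓ : ∀ m, 0 < ℓ m) {z : ℂ} (hz : 0 < z.im)
    (hsol : ∀ (ρ : ℝ), 0 < ρ → ∀ f : L2 K ℓ, ∃ u : L2 K ℓ,
      HamiltonianRel G ℓ u (cutoff ℓ ρ f + z ^ 2 • u)) :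
    ∃ B : L2 K ℓ →L[ℂ] L2 K ℓ, IsResolvent G ℓ z B ∧ ‖B‖ ≤ 1 / (‖z‖ * z.im) ∧
      ∀ u f, HamiltonianRel G ℓ u (f + z ^ 2 • u) → B f = u := by
  have hz0 : 0 < ‖z‖ := norm_pos_iff.2 fun h0 => by simp [h0] at hz
  have hsub : ∀ {u v f g : L2 K ℓ}, HamiltonianRel G ℓ u (f + z ^ 2 • u) →
      HamiltonianRel G ℓ v (g + z ^ 2 • v) →
      HamiltonianRel G ℓ (u - v) ((f - g) + z ^ 2 • (u - v)) := by
    intro u v f g h1 h2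
    have := h1.sub h2
    convert this using 1
    rw [smul_sub]
    abel
  have huniq : ∀ {u v f : L2 K ℓ}, HamiltonianRel G ℓ u (f + z ^ 2 • u) →
      HamiltonianRel G ℓ v (f + z ^ 2 • v) → u = v := by
    intro u v f h1 h2
    have := (hsub h1 h2).norm_le hℓ hz
    rw [sub_self, norm_zero, zero_div] at this
    exact sub_eq_zero.1 (norm_le_zero_iff.1 this)
  have hex : ∀ f : L2 K ℓ, ∃ u : L2 K ℓ, HamiltonianRel G ℓ u (f + z ^ 2 • u) := by
    intro f
    choose v hv using fun n : ℕ => hsol (n + 1) (by positivity) f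
    have hf := tendsto_cutoff f
    -- The resolvent estimate applied to differences turns convergence of the data into convergence
    -- of the solutions; closedness then gives the equation for the limit.
    have hc : CauchySeq v := by
      refine cauchySeq_of_norm_sub_le (k₁ := 1 / (‖z‖ * z.im)) (k₂ := 0) (by positivity) le_rfl
        hf.cauchySeq hf.cauchySeq fun n m => ?_
      refine ((hsub (hv n) (hv m)).norm_le hℓ hz).trans_eq ?_
      ring
    obtain ⟨u, hu⟩ := cauchySeq_tendsto_of_complete hc
    exact ⟨u, hamiltonianRel_of_tendsto hℓ hv hu (hf.add (hu.const_smul (z ^ 2)))⟩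
  choose b hb using hex
  let B : L2 K ℓ →L[ℂ] L2 K ℓ := LinearMap.mkContinuous
    { toFun := b
      map_add' := fun f g => huniq (hb (f + g)) (by
        have := (hb f).add (hb g)
        convert this using 1
        rw [smul_add]
        abel)
      map_smul' := fun a f => huniq (hb (a • f)) (by
        have := (hb f).smul a
        rw [smul_add, smul_comm a] at this
        exact this) }
    (1 / (‖z‖ * z.im)) (fun f => ((hb f).norm_le hℓ hz).trans_eq (by ring))
  have hB : ∀ f, B f = b f := fun f => rfl
  refine ⟨B, ⟨fun f => ?_, fun u => ?_⟩, LinearMap.mkContinuous_norm_le _ (by positivity) _,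
    fun u f h => huniq (hb f) h⟩
  · have h : HamiltonianRel G ℓ (B f) (f + z ^ 2 • B f) := hb f
    obtain ⟨h1, h2⟩ := h.exists_mem_domain
    refine ⟨h1, ?_⟩
    rw [h2]
    abel
  · rw [hB]
    refine huniq (hb _) ?_
    rw [sub_add_cancel]
    exact hamiltonianRel_coe u

end QGraph
end

/-! ### Variation of constants on an edge -/

noncomputable section

namespace QGraph

open Topology Filter
open scoped ComplexConjugate

section variationOfConstants

/-- The plane wave `e^{izx}`. -/
def wave (z : ℂ) (x : ℝ) : ℂ := Complex.exp (Complex.I * z * x)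

theorem continuous_wave (z : ℂ) : Continuous (wave z) := by
  unfold wave
  fun_prop

theorem wave_zero_right (z : ℂ) : wave z 0 = 1 := by simp [wave]

theorem wave_mul_wave_neg (z : ℂ) (x : ℝ) : wave z x * wave (-z) x = 1 := by
  rw [wave, wave, ← Complex.exp_add]
  simp

theorem norm_wave (z : ℂ) (x : ℝ) : ‖wave z x‖ = Real.exp (-(z.im * x)) := by
  rw [wave, Complex.norm_exp]
  congr 1
  simp

theorem norm_wave_le (z : ℂ) {x L : ℝ} (hx : x ∈ Icc 0 L) : ‖wave z x‖ ≤ Real.exp (‖z‖ * L) := by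
  rw [norm_wave]
  apply Real.exp_le_exp.2
  have h1 := neg_le_of_abs_le (Complex.abs_im_le_norm z)
  have h2 := norm_nonneg z
  have h3 := hx.1
  have h4 := hx.2
  nlinarith

theorem hasDerivAt_wave (z : ℂ) (x : ℝ) :
    HasDerivAt (wave z) (Complex.I * z * wave z x) x := by
  have h1 : HasDerivAt (fun x : ℝ => Complex.I * z * (x : ℂ)) (Complex.I * z) x := by
    simpa using (Complex.ofRealCLM.hasDerivAt (x := x)).const_mul (Complex.I * z)
  exact h1.cexp.congr_deriv (mul_comm _ _)

theorem wave_eq_primitive (z : ℂ) (x : ℝ) :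
    wave z x = wave z 0 + ∫ t in (0 : ℝ)..x, Complex.I * z * wave z t := by
  rw [intervalIntegral.integral_eq_sub_of_hasDerivAt (fun t _ => hasDerivAt_wave z t)
    ((continuous_const.mul (continuous_wave z)).intervalIntegrable _ _)]
  ring

/-- The coefficient of `e^{izx}` in the solution of `-u'' - z² u = φ` by variation of constants;
`-waveCoeff (-z) ...` gives the coefficient of `e^{-izx}`. -/
def waveCoeff (z α : ℂ) (φ : ℝ → ℂ) (x : ℝ) : ℂ :=
  α + Complex.I / 2 * z⁻¹ * ∫ t in (0 : ℝ)..x, wave (-z) t * φ t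

/-- The solution of `-u'' - z² u = φ` by variation of constants. -/
def waveSol (z α β : ℂ) (φ : ℝ → ℂ) (x : ℝ) : ℂ :=
  waveCoeff z α φ x * wave z x + waveCoeff (-z) β φ x * wave (-z) x

/-- The derivative of `waveSol`. -/
def waveSol' (z α β : ℂ) (φ : ℝ → ℂ) (x : ℝ) : ℂ :=
  Complex.I * z * (waveCoeff z α φ x * wave z x - waveCoeff (-z) β φ x * wave (-z) x)

/-- The second derivative of `waveSol`. -/
def waveSol'' (z α β : ℂ) (φ : ℝ → ℂ) (x : ℝ) : ℂ :=
  -(z ^ 2 * waveSol z α β φ x) - φ x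

variable {z α β : ℂ} {φ : ℝ → ℂ}

theorem intervalIntegrable_wave_mul (hφ : Integrable φ) (w : ℂ) (a b : ℝ) :
    IntervalIntegrable (fun t => wave w t * φ t) volume a b :=
  hφ.intervalIntegrable.continuousOn_mul (continuous_wave w).continuousOn

theorem continuous_waveCoeff (hφ : Integrable φ) : Continuous (waveCoeff z α φ) :=
  continuous_const.add (continuous_const.mul
    (intervalIntegral.continuous_primitive (intervalIntegrable_wave_mul hφ (-z)) 0))

theorem continuous_waveSol (hφ : Integrable φ) : Continuous (waveSol z α β φ) :=
  ((continuous_waveCoeff hφ).mul (continuous_wave z)).add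
    ((continuous_waveCoeff hφ).mul (continuous_wave (-z)))

theorem continuous_waveSol' (hφ : Integrable φ) : Continuous (waveSol' z α β φ) :=
  continuous_const.mul (((continuous_waveCoeff hφ).mul (continuous_wave z)).sub
    ((continuous_waveCoeff hφ).mul (continuous_wave (-z))))

theorem waveCoeff_zero : waveCoeff z α φ 0 = α := by simp [waveCoeff]

theorem waveCoeff_eq_primitive (x : ℝ) : waveCoeff z α φ x = waveCoeff z α φ 0
    + ∫ t in (0 : ℝ)..x, Complex.I / 2 * z⁻¹ * (wave (-z) t * φ t) := by
  rw [waveCoeff_zero, waveCoeff, intervalIntegral.integral_const_mul]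

/-- The product rule, in which `e^{izt} e^{-izt} = 1` removes the oscillation from the term with
`φ`. Used for `z` and `-z`, it yields both first order identities below. -/
theorem waveCoeff_mul_wave (hφ : Integrable φ) (x : ℝ) :
    waveCoeff z α φ x * wave z x = α + ∫ t in (0 : ℝ)..x,
      (Complex.I / 2 * z⁻¹ * φ t + Complex.I * z * (waveCoeff z α φ t * wave z t)) := by
  have h := primitive_mul (a := waveCoeff z α φ) (b := wave z) (X := x)
    (b' := fun t => Complex.I * z * wave z t)
    ((intervalIntegrable_wave_mul hφ (-z) 0 x).const_mul (Complex.I / 2 * z⁻¹))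
    ((continuous_const.mul (continuous_wave z)).intervalIntegrable _ _)
    (fun y _ => waveCoeff_eq_primitive y) (fun y _ => wave_eq_primitive z y)
  rw [h, waveCoeff_zero, wave_zero_right, mul_one]
  congr 1
  apply intervalIntegral.integral_congr
  intro t _
  simp only
  linear_combination (Complex.I / 2 * z⁻¹ * φ t) * wave_mul_wave_neg z t

theorem intervalIntegrable_waveCoeff_deriv (hφ : Integrable φ) (x : ℝ) :
    IntervalIntegrable (fun t => Complex.I / 2 * z⁻¹ * φ t
      + Complex.I * z * (waveCoeff z α φ t * wave z t)) volume 0 x :=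
  (hφ.intervalIntegrable.const_mul _).add (((continuous_const.mul
    ((continuous_waveCoeff hφ).mul (continuous_wave z))).intervalIntegrable _ _))

/-- The contributions of `φ` to the derivatives of the two summands carry the factors `z⁻¹` and
`(-z)⁻¹` and cancel. -/
theorem waveSol_eq_primitive (hφ : Integrable φ) (x : ℝ) :
    waveSol z α β φ x = waveSol z α β φ 0 + ∫ t in (0 : ℝ)..x, waveSol' z α β φ t := by
  have h0 : waveSol z α β φ 0 = α + β := by
    simp [waveSol, waveCoeff_zero, wave_zero_right]
  rw [h0, waveSol, waveCoeff_mul_wave hφ, waveCoeff_mul_wave hφ]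
  have h1 := intervalIntegral.integral_add (intervalIntegrable_waveCoeff_deriv (z := z) (α := α) hφ x)
    (intervalIntegrable_waveCoeff_deriv (z := -z) (α := β) hφ x)
  have h2 : ∫ t in (0 : ℝ)..x, waveSol' z α β φ t = ∫ t in (0 : ℝ)..x,
      ((Complex.I / 2 * z⁻¹ * φ t + Complex.I * z * (waveCoeff z α φ t * wave z t))
      + (Complex.I / 2 * (-z)⁻¹ * φ t
        + Complex.I * (-z) * (waveCoeff (-z) β φ t * wave (-z) t))) := by
    apply intervalIntegral.integral_congr
    intro t _
    simp only [waveSol', inv_neg]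
    ring
  rw [h2, h1]
  ring

/-- Here the two contributions of `φ` add up, and `z * z⁻¹ = 1` is what makes the coefficient of `φ`
equal to `-1`. -/
theorem waveSol'_eq_primitive (hz : z ≠ 0) (hφ : Integrable φ) (x : ℝ) :
    waveSol' z α β φ x = waveSol' z α β φ 0 + ∫ t in (0 : ℝ)..x, waveSol'' z α β φ t := by
  have h0 : waveSol' z α β φ 0 = Complex.I * z * (α - β) := by
    simp [waveSol', waveCoeff_zero, wave_zero_right]
  rw [h0, waveSol', waveCoeff_mul_wave hφ, waveCoeff_mul_wave hφ]
  have h1 := intervalIntegral.integral_sub (intervalIntegrable_waveCoeff_deriv (z := z) (α := α) hφ x)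
    (intervalIntegrable_waveCoeff_deriv (z := -z) (α := β) hφ x)
  have h2 : ∫ t in (0 : ℝ)..x, waveSol'' z α β φ t = Complex.I * z * ∫ t in (0 : ℝ)..x,
      ((Complex.I / 2 * z⁻¹ * φ t + Complex.I * z * (waveCoeff z α φ t * wave z t))
      - (Complex.I / 2 * (-z)⁻¹ * φ t
        + Complex.I * (-z) * (waveCoeff (-z) β φ t * wave (-z) t))) := by
    rw [← intervalIntegral.integral_const_mul]
    apply intervalIntegral.integral_congr
    intro t _
    simp only [waveSol'', waveSol, inv_neg]
    have hzz : z * z⁻¹ = 1 := mul_inv_cancel₀ hz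
    linear_combination (-(z ^ 2 * (waveCoeff z α φ t * wave z t
      + waveCoeff (-z) β φ t * wave (-z) t)) - φ t * (z * z⁻¹)) * Complex.I_sq
      + (-φ t) * (-1) * hzz
  rw [h2, h1]
  ring

theorem memLp_waveSol'' {S : Set ℝ} (h : MemLp (waveSol z α β φ) 2 (volume.restrict S))
    (hφ2 : MemLp φ 2 volume) : MemLp (waveSol'' z α β φ) 2 (volume.restrict S) :=
  ((h.const_mul (z ^ 2)).neg).sub (hφ2.restrict S)

theorem memLp_Icc_of_continuous {q : ℝ → ℂ} (hq : Continuous q) (l : ℝ) :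
    MemLp q 2 (volume.restrict (Icc 0 l)) := by
  obtain ⟨C, hC⟩ := (isCompact_Icc (a := (0 : ℝ)) (b := l)).exists_bound_of_continuousOn
    hq.continuousOn
  have : IsFiniteMeasure (volume.restrict (Icc (0 : ℝ) l)) :=
    ⟨by rw [Measure.restrict_apply_univ]; exact isCompact_Icc.measure_lt_top⟩
  refine MemLp.of_bound hq.aestronglyMeasurable C ?_
  filter_upwards [ae_restrict_mem measurableSet_Icc] with x hx using hC x hx

theorem isH2_Icc_waveSol (hz : z ≠ 0) (hφ : Integrable φ) (hφ2 : MemLp φ 2 volume) (l : ℝ) :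
    IsH2 (Icc 0 l) (waveSol z α β φ) (waveSol' z α β φ) (waveSol'' z α β φ) := by
  have h := memLp_Icc_of_continuous (continuous_waveSol (z := z) (α := α) (β := β) hφ) l
  exact ⟨h, memLp_Icc_of_continuous (continuous_waveSol' hφ) l, memLp_waveSol'' h hφ2,
    fun x _ => waveSol_eq_primitive hφ x, fun x _ => waveSol'_eq_primitive hz hφ x⟩

theorem memLp_wave_Ici (hz : 0 < z.im) : MemLp (wave z) 2 (volume.restrict (Ici 0)) := by
  rw [memLp_two_iff_integrable_sq_norm (continuous_wave z).aestronglyMeasurable]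
  have h : IntegrableOn (fun x : ℝ => Real.exp (-(2 * z.im) * x)) (Ici 0) := by
    rw [integrableOn_Ici_iff_integrableOn_Ioi]
    exact integrableOn_exp_mul_Ioi (by linarith) 0
  refine h.congr (ae_of_all _ fun x => ?_)
  simp only
  rw [norm_wave, ← Real.exp_nat_mul]
  congr 1
  push_cast
  ring

/-- A continuous function that is a multiple of a decaying wave far out is square integrable. -/
theorem memLp_Ici_of_eq_wave {q : ℝ → ℂ} (hq : Continuous q) (hz : 0 < z.im) {k : ℂ} {ρ : ℝ}
    (h : ∀ x, ρ ≤ x → q x = k * wave z x) : MemLp q 2 (volume.restrict (Ici 0)) := by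
  obtain ⟨C, hC⟩ := (isCompact_Icc (a := (0 : ℝ)) (b := ρ)).exists_bound_of_continuousOn
    hq.continuousOn
  -- On `[0, ρ]` the wave has modulus at least `exp (-Im z ρ)`, so the first summand of the constant
  -- dominates `C` there; the second one serves beyond `ρ`. `max C 0` covers an empty interval.
  refine ((memLp_wave_Ici hz).const_mul ((max C 0 * Real.exp (z.im * ρ) + ‖k‖ : ℝ) : ℂ)).of_le
    hq.aestronglyMeasurable ?_
  filter_upwards [ae_restrict_mem measurableSet_Ici] with x hx
  have hx0 : 0 ≤ x := hx
  have h0 : 0 ≤ max C 0 * Real.exp (z.im * ρ) := by positivity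
  rw [norm_mul, Complex.norm_real, Real.norm_of_nonneg (by positivity), add_mul]
  rcases le_total ρ x with hρ | hρ
  · rw [h x hρ, norm_mul]
    have := mul_nonneg h0 (norm_nonneg (wave z x))
    linarith
  · have h1 : 1 ≤ Real.exp (z.im * ρ) * ‖wave z x‖ := by
      rw [norm_wave, ← Real.exp_add]
      apply Real.one_le_exp
      nlinarith
    have h2 := (hC x ⟨hx0, hρ⟩).trans (le_max_left C 0)
    have h3 : max C 0 * 1 ≤ max C 0 * (Real.exp (z.im * ρ) * ‖wave z x‖) :=
      mul_le_mul_of_nonneg_left h1 (le_max_right _ _)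
    have h4 : 0 ≤ ‖k‖ * ‖wave z x‖ := by positivity
    linarith

theorem waveCoeff_eq_of_le (hφ : Integrable φ) {ρ : ℝ} (hsupp : ∀ x, ρ < x → φ x = 0) {x : ℝ}
    (hx : ρ ≤ x) : waveCoeff z α φ x = waveCoeff z α φ ρ := by
  have h1 : ∫ t in ρ..x, wave (-z) t * φ t = 0 := by
    rw [intervalIntegral.integral_of_le hx]
    refine setIntegral_eq_zero_of_forall_eq_zero fun t ht => ?_
    rw [hsupp t ht.1, mul_zero]
  rw [waveCoeff, waveCoeff, ← intervalIntegral.integral_add_adjacent_intervals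
    (intervalIntegrable_wave_mul hφ (-z) 0 ρ) (intervalIntegrable_wave_mul hφ (-z) ρ x), h1, add_zero]

/-- Beyond the support of `φ` the amplitudes are constant. The condition `hβ` removes the wave
`e^{-izx}`, which grows for `Im z > 0`, and leaves a decaying multiple of `e^{izx}`: this is the
outgoing condition. -/
theorem isH2_Ici_waveSol (hz : 0 < z.im) (hφ : Integrable φ) (hφ2 : MemLp φ 2 volume) {ρ : ℝ}
    (hsupp : ∀ x, ρ < x → φ x = 0) (hβ : waveCoeff (-z) β φ ρ = 0) :
    IsH2 (Ici 0) (waveSol z α β φ) (waveSol' z α β φ) (waveSol'' z α β φ) := by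
  have hz0 : z ≠ 0 := fun h0 => by simp [h0] at hz
  have h : MemLp (waveSol z α β φ) 2 (volume.restrict (Ici 0)) := by
    refine memLp_Ici_of_eq_wave (continuous_waveSol hφ) hz (k := waveCoeff z α φ ρ) (ρ := ρ)
      fun x hx => ?_
    rw [waveSol, waveCoeff_eq_of_le hφ hsupp hx, waveCoeff_eq_of_le hφ hsupp hx, hβ]
    ring
  have h' : MemLp (waveSol' z α β φ) 2 (volume.restrict (Ici 0)) := by
    refine memLp_Ici_of_eq_wave (continuous_waveSol' hφ) hz
      (k := Complex.I * z * waveCoeff z α φ ρ) (ρ := ρ) fun x hx => ?_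
    rw [waveSol', waveCoeff_eq_of_le hφ hsupp hx, waveCoeff_eq_of_le hφ hsupp hx, hβ]
    ring
  exact ⟨h, h', memLp_waveSol'' h hφ2, fun x _ => waveSol_eq_primitive hφ x,
    fun x _ => waveSol'_eq_primitive hz0 hφ x⟩

end variationOfConstants

end QGraph
end

/-! ### Operators on an edge that depend holomorphically on `z` -/

noncomputable section

namespace QGraph

open Topology Filter Asymptotics
open scoped ComplexConjugate

section edgeOperators

theorem memLp_mul_of_bound {μ : Measure ℝ} {m f : ℝ → ℂ} (hm : Measurable m) {C : ℝ}
    (hC : ∀ x, ‖m x‖ ≤ C) (hf : MemLp f 2 μ) : MemLp (fun x => m x * f x) 2 μ := by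
  refine hf.of_le_mul (c := C) (hm.aestronglyMeasurable.mul hf.aestronglyMeasurable) ?_
  refine ae_of_all _ fun x => ?_
  rw [norm_mul]
  exact mul_le_mul_of_nonneg_right (hC x) (norm_nonneg _)

theorem norm_le_of_coeFn_mul {μ : Measure ℝ} {m : ℝ → ℂ} {C : ℝ} (hC : ∀ x, ‖m x‖ ≤ C)
    {f g : Lp ℂ 2 μ} (h : g =ᵐ[μ] fun x => m x * f x) : ‖g‖ ≤ C * ‖f‖ := by
  refine Lp.norm_le_mul_norm_of_ae_le_mul ?_
  filter_upwards [h] with x hx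
  rw [hx, norm_mul]
  exact mul_le_mul_of_nonneg_right (hC x) (norm_nonneg _)

/-- Multiplication by a bounded measurable function. -/
def mulCLM (μ : Measure ℝ) (m : ℝ → ℂ) (hm : Measurable m) (C : ℝ) (hC : ∀ x, ‖m x‖ ≤ C) :
    Lp ℂ 2 μ →L[ℂ] Lp ℂ 2 μ :=
  LinearMap.mkContinuous
    { toFun := fun f => (memLp_mul_of_bound hm hC (Lp.memLp f)).toLp _
      map_add' := fun f g => by
        apply Lp.ext
        filter_upwards [MemLp.coeFn_toLp (memLp_mul_of_bound hm hC (Lp.memLp (f + g))),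
          MemLp.coeFn_toLp (memLp_mul_of_bound hm hC (Lp.memLp f)),
          MemLp.coeFn_toLp (memLp_mul_of_bound hm hC (Lp.memLp g)), Lp.coeFn_add f g,
          Lp.coeFn_add ((memLp_mul_of_bound hm hC (Lp.memLp f)).toLp _)
            ((memLp_mul_of_bound hm hC (Lp.memLp g)).toLp _)] with x h1 h2 h3 h4 h5
        rw [h1, h5, Pi.add_apply, h2, h3, h4, Pi.add_apply, mul_add]
      map_smul' := fun a f => by
        apply Lp.ext
        filter_upwards [MemLp.coeFn_toLp (memLp_mul_of_bound hm hC (Lp.memLp (a • f))),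
          MemLp.coeFn_toLp (memLp_mul_of_bound hm hC (Lp.memLp f)), Lp.coeFn_smul a f,
          Lp.coeFn_smul a ((memLp_mul_of_bound hm hC (Lp.memLp f)).toLp _)] with x h1 h2 h3 h4
        rw [RingHom.id_apply, h1, h4, Pi.smul_apply, h2, h3, Pi.smul_apply, smul_eq_mul,
          smul_eq_mul]
        ring }
    C (fun f => norm_le_of_coeFn_mul hC
      (MemLp.coeFn_toLp (memLp_mul_of_bound hm hC (Lp.memLp f))))

theorem coeFn_mulCLM {μ : Measure ℝ} {m : ℝ → ℂ} (hm : Measurable m) {C : ℝ}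
    (hC : ∀ x, ‖m x‖ ≤ C) (f : Lp ℂ 2 μ) : mulCLM μ m hm C hC f =ᵐ[μ] fun x => m x * f x :=
  MemLp.coeFn_toLp (memLp_mul_of_bound hm hC (Lp.memLp f))

theorem norm_mulCLM_le {μ : Measure ℝ} {m : ℝ → ℂ} (hm : Measurable m) {C : ℝ}
    (hC : ∀ x, ‖m x‖ ≤ C) : ‖mulCLM μ m hm C hC‖ ≤ C :=
  ContinuousLinearMap.opNorm_le_bound _ ((norm_nonneg _).trans (hC 0)) fun f =>
    norm_le_of_coeFn_mul hC (coeFn_mulCLM hm hC f)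

/-- A plane wave cut off to `[0, L]`. -/
def cutWave (L : ℝ) (z : ℂ) : ℝ → ℂ := (Icc 0 L).indicator (wave z)

theorem measurable_cutWave (L : ℝ) (z : ℂ) : Measurable (cutWave L z) :=
  (continuous_wave z).measurable.indicator measurableSet_Icc

theorem norm_cutWave_le (L : ℝ) (z : ℂ) (x : ℝ) : ‖cutWave L z x‖ ≤ Real.exp (‖z‖ * L) := by
  by_cases hx : x ∈ Icc 0 L
  · rw [cutWave, indicator_of_mem hx]
    exact norm_wave_le z hx
  · rw [cutWave, indicator_of_notMem hx, norm_zero]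
    exact (Real.exp_pos _).le

/-- Multiplication by a plane wave cut off to `[0, L]`. -/
def waveMul (μ : Measure ℝ) (L : ℝ) (z : ℂ) : Lp ℂ 2 μ →L[ℂ] Lp ℂ 2 μ :=
  mulCLM μ (cutWave L z) (measurable_cutWave L z) (Real.exp (‖z‖ * L)) (norm_cutWave_le L z)

theorem coeFn_waveMul {μ : Measure ℝ} {L : ℝ} {z : ℂ} (f : Lp ℂ 2 μ) :
    waveMul μ L z f =ᵐ[μ] fun x => cutWave L z x * f x := coeFn_mulCLM _ _ f

theorem norm_waveMul_le (μ : Measure ℝ) (L : ℝ) (z : ℂ) :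
    ‖waveMul μ L z‖ ≤ Real.exp (‖z‖ * L) := norm_mulCLM_le _ _

/-- The derivative in `z` of a plane wave cut off to `[0, L]`. -/
def cutWave' (L : ℝ) (z : ℂ) (x : ℝ) : ℂ := Complex.I * x * cutWave L z x

theorem norm_cutWave'_le {L : ℝ} (hL : 0 ≤ L) (z : ℂ) (x : ℝ) :
    ‖cutWave' L z x‖ ≤ L * Real.exp (‖z‖ * L) := by
  by_cases hx : x ∈ Icc 0 L
  · rw [cutWave', norm_mul, norm_mul, Complex.norm_I, one_mul, Complex.norm_real,
      Real.norm_of_nonneg hx.1]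
    exact mul_le_mul hx.2 (norm_cutWave_le L z x) (norm_nonneg _) hL
  · rw [cutWave', cutWave, indicator_of_notMem hx, mul_zero, norm_zero]
    positivity

theorem measurable_cutWave' (L : ℝ) (z : ℂ) : Measurable (cutWave' L z) :=
  (measurable_const.mul Complex.measurable_ofReal).mul (measurable_cutWave L z)

/-- After factoring out `e^{izx}` this is `|e^w - 1 - w| ≤ |w|²` for `|w| ≤ 1`. Uniformity in `x`
turns the bound into one for operator norms, so `waveMul` is complex differentiable in operator
norm. -/
theorem norm_cutWave_taylor_le {L : ℝ} (z h : ℂ) (hh : ‖h‖ * L ≤ 1) (x : ℝ) :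
    ‖cutWave L (z + h) x - cutWave L z x - h * cutWave' L z x‖
      ≤ Real.exp (‖z‖ * L) * (‖h‖ * L) ^ 2 := by
  by_cases hx : x ∈ Icc 0 L
  · have e1 : cutWave L (z + h) x - cutWave L z x - h * cutWave' L z x
        = cutWave L z x * (Complex.exp (Complex.I * h * x) - 1 - Complex.I * h * x) := by
      rw [cutWave', cutWave, cutWave, indicator_of_mem hx, indicator_of_mem hx, wave, wave]
      have : Complex.I * (z + h) * x = Complex.I * z * x + Complex.I * h * x := by ring
      rw [this, Complex.exp_add]
      ring
    have e2 : ‖Complex.I * h * x‖ ≤ ‖h‖ * L := by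
      rw [norm_mul, norm_mul, Complex.norm_I, one_mul, Complex.norm_real, Real.norm_of_nonneg hx.1]
      exact mul_le_mul_of_nonneg_left hx.2 (norm_nonneg _)
    rw [e1, norm_mul]
    refine mul_le_mul (norm_cutWave_le L z x) ?_ (norm_nonneg _) (Real.exp_pos _).le
    exact (Complex.norm_exp_sub_one_sub_id_le (e2.trans hh)).trans
      (pow_le_pow_left₀ (norm_nonneg _) e2 2)
  · rw [cutWave', cutWave, cutWave, indicator_of_notMem hx, indicator_of_notMem hx]
    simp only [mul_zero, sub_zero, norm_zero]
    positivity

theorem hasDerivAt_waveMul (μ : Measure ℝ) {L : ℝ} (hL : 0 ≤ L) (z : ℂ) :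
    HasDerivAt (waveMul μ L) (mulCLM μ (cutWave' L z) (measurable_cutWave' L z)
      (L * Real.exp (‖z‖ * L)) (norm_cutWave'_le hL z)) z := by
  rw [hasDerivAt_iff_isLittleO_nhds_zero]
  have hO : (fun h : ℂ => waveMul μ L (z + h) - waveMul μ L z
      - h • mulCLM μ (cutWave' L z) (measurable_cutWave' L z)
      (L * Real.exp (‖z‖ * L)) (norm_cutWave'_le hL z)) =O[𝓝 0] fun h : ℂ => ‖h‖ ^ 2 := by
    refine IsBigO.of_bound (Real.exp (‖z‖ * L) * L ^ 2) ?_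
    have hev : ∀ᶠ h : ℂ in 𝓝 0, ‖h‖ * L < 1 := by
      have hc : Continuous fun h : ℂ => ‖h‖ * L := by fun_prop
      refine hc.continuousAt.eventually_lt continuousAt_const ?_
      simp
    filter_upwards [hev] with h hh
    rw [norm_pow, norm_norm]
    refine ContinuousLinearMap.opNorm_le_bound _ (by positivity) fun f => ?_
    have hb := norm_cutWave_taylor_le z h hh.le
    have := norm_le_of_coeFn_mul hb (f := f) (g := (waveMul μ L (z + h) - waveMul μ L z
      - h • mulCLM μ (cutWave' L z) (measurable_cutWave' L z)
      (L * Real.exp (‖z‖ * L)) (norm_cutWave'_le hL z)) f) ?_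
    · refine this.trans_eq ?_
      ring
    · rw [sub_apply, sub_apply,
        smul_apply]
      filter_upwards [coeFn_waveMul (L := L) (z := z + h) f, coeFn_waveMul (L := L) (z := z) f,
        coeFn_mulCLM (measurable_cutWave' L z) (norm_cutWave'_le hL z) f,
        Lp.coeFn_sub (waveMul μ L (z + h) f - waveMul μ L z f)
          (h • mulCLM μ (cutWave' L z) (measurable_cutWave' L z)
          (L * Real.exp (‖z‖ * L)) (norm_cutWave'_le hL z) f),
        Lp.coeFn_sub (waveMul μ L (z + h) f) (waveMul μ L z f),
        Lp.coeFn_smul h (mulCLM μ (cutWave' L z) (measurable_cutWave' L z)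
          (L * Real.exp (‖z‖ * L)) (norm_cutWave'_le hL z) f)] with x h1 h2 h3 h4 h5 h6
      rw [h4, Pi.sub_apply, h5, Pi.sub_apply, h6, Pi.smul_apply, h1, h2, h3, smul_eq_mul]
      ring
  refine hO.trans_isLittleO ?_
  have := isLittleO_norm_pow_id (E' := ℂ) one_lt_two
  simpa using this

theorem differentiable_waveMul (μ : Measure ℝ) {L : ℝ} (hL : 0 ≤ L) :
    Differentiable ℂ (waveMul μ L) := fun z => (hasDerivAt_waveMul μ hL z).differentiableAt

variable {S : Set ℝ} {L : ℝ}

theorem memLp_indicator_Icc {q : ℝ → ℂ} (hq : ContinuousOn q (Icc 0 L)) :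
    MemLp ((Icc 0 L).indicator q) 2 (volume.restrict S) := by
  obtain ⟨C, hC⟩ := isCompact_Icc.exists_bound_of_continuousOn hq
  have : IsFiniteMeasure (volume.restrict (Icc (0 : ℝ) L)) :=
    ⟨by rw [Measure.restrict_apply_univ]; exact isCompact_Icc.measure_lt_top⟩
  have h : MemLp ((Icc 0 L).indicator q) 2 volume := by
    rw [memLp_indicator_iff_restrict measurableSet_Icc]
    refine MemLp.of_bound (hq.aestronglyMeasurable measurableSet_Icc) C ?_
    filter_upwards [ae_restrict_mem measurableSet_Icc] with x hx using hC x hx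
  exact h.restrict S

theorem eLpNorm_indicator_Icc_le {q : ℝ → ℂ} (hL : 0 ≤ L) {C : ℝ} (hC0 : 0 ≤ C)
    (hC : ∀ x ∈ Icc 0 L, ‖q x‖ ≤ C) :
    (eLpNorm ((Icc 0 L).indicator q) 2 (volume.restrict S)).toReal ≤ √L * C := by
  have h1 : eLpNorm ((Icc 0 L).indicator q) 2 (volume.restrict S)
      ≤ eLpNorm ((Icc 0 L).indicator q) 2 volume :=
    eLpNorm_mono_measure _ Measure.restrict_le_self
  have h0 : eLpNorm ((Icc 0 L).indicator q) 2 volume = eLpNorm q 2 (volume.restrict (Icc 0 L)) :=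
    eLpNorm_indicator_eq_eLpNorm_restrict measurableSet_Icc
  have h2 : eLpNorm q 2 (volume.restrict (Icc 0 L))
      ≤ (volume.restrict (Icc 0 L)) univ ^ (2 : ENNReal).toReal⁻¹ * ENNReal.ofReal C := by
    refine eLpNorm_le_of_ae_bound ?_
    filter_upwards [ae_restrict_mem measurableSet_Icc] with x hx using hC x hx
  have h3 : (volume.restrict (Icc 0 L)) univ ^ (2 : ENNReal).toReal⁻¹ = ENNReal.ofReal (√L) := by
    rw [Measure.restrict_apply_univ, Real.volume_Icc, sub_zero, Real.sqrt_eq_rpow,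
      ENNReal.ofReal_rpow_of_nonneg hL (by norm_num)]
    norm_num
  rw [h3, ← ENNReal.ofReal_mul (Real.sqrt_nonneg _)] at h2
  have h4 := ENNReal.toReal_mono ENNReal.ofReal_ne_top (h1.trans (h0.le.trans h2))
  rwa [ENNReal.toReal_ofReal (by positivity)] at h4

/-- The indicator function of `[0, L]`. -/
def oneLp (S : Set ℝ) (L : ℝ) : Lp ℂ 2 (volume.restrict S) :=
  (memLp_indicator_Icc (S := S) (L := L) (q := fun _ => 1) continuousOn_const).toLp _

theorem coeFn_oneLp : oneLp S L =ᵐ[volume.restrict S] (Icc 0 L).indicator fun _ => 1 :=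
  MemLp.coeFn_toLp _

theorem norm_oneLp_le (hL : 0 ≤ L) : ‖oneLp S L‖ ≤ √L := by
  rw [oneLp, Lp.norm_toLp]
  refine (eLpNorm_indicator_Icc_le hL zero_le_one fun x _ => by simp).trans_eq (mul_one _)

theorem waveMul_oneLp (z : ℂ) :
    waveMul (volume.restrict S) L z (oneLp S L) =ᵐ[volume.restrict S] cutWave L z := by
  filter_upwards [coeFn_waveMul (L := L) (z := z) (oneLp S L), coeFn_oneLp (S := S) (L := L)]
    with x h1 h2
  rw [h1, h2]
  by_cases hx : x ∈ Icc 0 L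
  · rw [indicator_of_mem hx, mul_one]
  · rw [indicator_of_notMem hx, cutWave, indicator_of_notMem hx, mul_zero]

theorem inner_oneLp (hL : 0 ≤ L) (hS : Icc 0 L ⊆ S) (f : Lp ℂ 2 (volume.restrict S)) :
    inner ℂ (oneLp S L) f = ∫ t in (0 : ℝ)..L, f t := by
  rw [L2.inner_def, intervalIntegral.integral_of_le hL, ← integral_Icc_eq_integral_Ioc,
    ← integral_indicator measurableSet_Icc]
  have h1 : ∫ t, (Icc 0 L).indicator (fun t => f t) t ∂volume
      = ∫ t, (Icc 0 L).indicator (fun t => f t) t ∂(volume.restrict S) := by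
    rw [integral_indicator measurableSet_Icc, integral_indicator measurableSet_Icc,
      Measure.restrict_restrict measurableSet_Icc, inter_eq_left.2 hS]
  rw [h1]
  apply integral_congr_ae
  filter_upwards [coeFn_oneLp (S := S) (L := L)] with t ht
  rw [ht, RCLike.inner_apply']
  by_cases hx : t ∈ Icc 0 L
  · rw [indicator_of_mem hx, indicator_of_mem hx]
    simp
  · rw [indicator_of_notMem hx, indicator_of_notMem hx]
    simp

theorem intervalIntegral_congr_ae_restrict {f g : ℝ → ℂ} (h : f =ᵐ[volume.restrict S] g) {x : ℝ}
    (hx : 0 ≤ x) (hS : Icc 0 x ⊆ S) : ∫ t in (0 : ℝ)..x, f t = ∫ t in (0 : ℝ)..x, g t := by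
  rw [intervalIntegral.integral_of_le hx, intervalIntegral.integral_of_le hx,
    ← integral_Icc_eq_integral_Ioc, ← integral_Icc_eq_integral_Ioc]
  exact integral_congr_ae (ae_mono (Measure.restrict_mono hS le_rfl) h)

theorem continuousOn_primitive_Lp (hS : Icc 0 L ⊆ S) (f : Lp ℂ 2 (volume.restrict S)) :
    ContinuousOn (fun x => ∫ t in (0 : ℝ)..x, f t) (Icc 0 L) := by
  have h := integrableOn_of_memLp (Lp.memLp f) hS
  rcases le_or_gt 0 L with hL | hL
  · rw [← uIcc_of_le hL] at h ⊢
    exact intervalIntegral.continuousOn_primitive_interval h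
  · rw [Icc_eq_empty (not_le.2 hL)]
    exact continuousOn_empty _

/-- The Volterra operator on `[0, L]`. -/
def volterra (hL : 0 ≤ L) (hS : Icc 0 L ⊆ S) :
    Lp ℂ 2 (volume.restrict S) →L[ℂ] Lp ℂ 2 (volume.restrict S) :=
  LinearMap.mkContinuous
    { toFun := fun f => (memLp_indicator_Icc (S := S) (continuousOn_primitive_Lp hS f)).toLp _
      map_add' := fun f g => by
        rw [← MemLp.toLp_add]
        congr 1
        rw [← indicator_add']
        refine indicator_congr fun x hx => ?_
        have hsub : Icc 0 x ⊆ S := (Icc_subset_Icc_right hx.2).trans hS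
        rw [intervalIntegral_congr_ae_restrict (Lp.coeFn_add f g) hx.1 hsub]
        exact intervalIntegral.integral_add
          (intervalIntegrable_of_memLp_restrict (Lp.memLp f) hx.1 hsub)
          (intervalIntegrable_of_memLp_restrict (Lp.memLp g) hx.1 hsub)
      map_smul' := fun a f => by
        rw [RingHom.id_apply, ← MemLp.toLp_const_smul]
        congr 1
        have e : a • (Icc 0 L).indicator (fun x => ∫ t in (0 : ℝ)..x, f t)
            = (Icc 0 L).indicator fun x => a • ∫ t in (0 : ℝ)..x, f t :=
          funext fun x => (indicator_const_smul_apply (Icc 0 L) a _ x).symm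
        rw [e]
        refine indicator_congr fun x hx => ?_
        have hsub : Icc 0 x ⊆ S := (Icc_subset_Icc_right hx.2).trans hS
        rw [intervalIntegral_congr_ae_restrict (Lp.coeFn_smul a f) hx.1 hsub]
        exact intervalIntegral.integral_smul a _ }
    L (fun f => by
      change ‖(memLp_indicator_Icc (S := S) (continuousOn_primitive_Lp hS f)).toLp _‖ ≤ _
      rw [Lp.norm_toLp]
      -- Cauchy-Schwarz gives the pointwise bound `√L ‖f‖`; the `L²` norm over `[0, L]` contributes
      -- another `√L`.
      refine (eLpNorm_indicator_Icc_le hL (C := √L * ‖f‖) (by positivity) fun x hx => ?_).trans_eq ?_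
      · have hsub : Icc 0 x ⊆ S := (Icc_subset_Icc_right hx.2).trans hS
        refine (intervalIntegral.norm_integral_le_integral_norm hx.1).trans ?_
        refine (integral_norm_le_sqrt_mul (Lp.memLp f) hx.1 hsub).trans ?_
        rw [Lp.norm_def]
        exact mul_le_mul_of_nonneg_right (Real.sqrt_le_sqrt hx.2) ENNReal.toReal_nonneg
      · rw [← mul_assoc, Real.mul_self_sqrt hL])

theorem coeFn_volterra (hL : 0 ≤ L) (hS : Icc 0 L ⊆ S) (f : Lp ℂ 2 (volume.restrict S)) :
    volterra hL hS f =ᵐ[volume.restrict S]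
      (Icc 0 L).indicator fun x => ∫ t in (0 : ℝ)..x, f t :=
  MemLp.coeFn_toLp (memLp_indicator_Icc (S := S) (continuousOn_primitive_Lp hS f))

theorem norm_volterra_le (hL : 0 ≤ L) (hS : Icc 0 L ⊆ S) : ‖volterra hL hS‖ ≤ L :=
  LinearMap.mkContinuous_norm_le _ hL _

/-- The solution operator of `-u'' - z² u = f` with vanishing initial values, up to the factor
`i / (2 z)`. -/
def initialSol (hL : 0 ≤ L) (hS : Icc 0 L ⊆ S) (z : ℂ) :
    Lp ℂ 2 (volume.restrict S) →L[ℂ] Lp ℂ 2 (volume.restrict S) :=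
  waveMul _ L z ∘L volterra hL hS ∘L waveMul _ L (-z)
    - waveMul _ L (-z) ∘L volterra hL hS ∘L waveMul _ L z

theorem coeFn_waveMul_volterra (hL : 0 ≤ L) (hS : Icc 0 L ⊆ S) (z w : ℂ)
    (f : Lp ℂ 2 (volume.restrict S)) :
    waveMul _ L z (volterra hL hS (waveMul _ L w f)) =ᵐ[volume.restrict S]
      (Icc 0 L).indicator fun x =>
        wave z x * ∫ t in (0 : ℝ)..x, wave w t * (Icc 0 L).indicator f t := by
  filter_upwards [coeFn_waveMul (L := L) (z := z) (volterra hL hS (waveMul _ L w f)),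
    coeFn_volterra hL hS (waveMul _ L w f)] with x h1 h2
  rw [h1, h2]
  by_cases hx : x ∈ Icc 0 L
  · rw [indicator_of_mem hx, indicator_of_mem hx, cutWave, indicator_of_mem hx]
    congr 1
    have hsub : Icc 0 x ⊆ S := (Icc_subset_Icc_right hx.2).trans hS
    rw [intervalIntegral_congr_ae_restrict (coeFn_waveMul (L := L) (z := w) f) hx.1 hsub]
    apply intervalIntegral.integral_congr
    intro t ht
    rw [uIcc_of_le hx.1] at ht
    have ht' : t ∈ Icc 0 L := ⟨ht.1, ht.2.trans hx.2⟩
    simp only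
    rw [cutWave, indicator_of_mem ht', indicator_of_mem ht']
  · rw [indicator_of_notMem hx, indicator_of_notMem hx, mul_zero]

/-- The functional `f ↦ ∫_0^L e^{izy} f(y) dy`. -/
def waveInt (S : Set ℝ) (L : ℝ) (z : ℂ) : Lp ℂ 2 (volume.restrict S) →L[ℂ] ℂ :=
  innerSL ℂ (oneLp S L) ∘L waveMul _ L z

theorem waveInt_apply (hL : 0 ≤ L) (hS : Icc 0 L ⊆ S) (z : ℂ) (f : Lp ℂ 2 (volume.restrict S)) :
    waveInt S L z f = ∫ t in (0 : ℝ)..L, wave z t * (Icc 0 L).indicator f t := by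
  rw [waveInt, ContinuousLinearMap.comp_apply, innerSL_apply_apply, inner_oneLp hL hS,
    intervalIntegral_congr_ae_restrict (coeFn_waveMul (L := L) (z := z) f) hL hS]
  apply intervalIntegral.integral_congr
  intro t ht
  rw [uIcc_of_le hL] at ht
  simp only
  rw [cutWave, indicator_of_mem ht, indicator_of_mem ht]

theorem differentiable_waveInt (hL : 0 ≤ L) : Differentiable ℂ (waveInt S L) :=
  (differentiable_const _).clm_comp (differentiable_waveMul _ hL)

theorem differentiable_initialSol (hL : 0 ≤ L) (hS : Icc 0 L ⊆ S) :
    Differentiable ℂ (initialSol hL hS) := by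
  have h1 := differentiable_waveMul (volume.restrict S) hL
  have h2 : Differentiable ℂ fun z => waveMul (volume.restrict S) L (-z) :=
    h1.comp differentiable_neg
  exact (h1.clm_comp ((differentiable_const _).clm_comp h2)).sub
    (h2.clm_comp ((differentiable_const _).clm_comp h1))

theorem norm_waveInt_le (hL : 0 ≤ L) (z : ℂ) :
    ‖waveInt S L z‖ ≤ √L * Real.exp (‖z‖ * L) := by
  refine (ContinuousLinearMap.opNorm_comp_le _ _).trans ?_
  rw [innerSL_apply_norm]
  exact mul_le_mul (norm_oneLp_le hL) (norm_waveMul_le _ L z) (norm_nonneg _) (Real.sqrt_nonneg _)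

theorem norm_initialSol_le (hL : 0 ≤ L) (hS : Icc 0 L ⊆ S) (z : ℂ) :
    ‖initialSol hL hS z‖ ≤ 2 * L * Real.exp (‖z‖ * L) ^ 2 := by
  have h : ∀ w w' : ℂ, ‖w‖ = ‖z‖ → ‖w'‖ = ‖z‖ →
      ‖waveMul _ L w ∘L volterra hL hS ∘L waveMul _ L w'‖ ≤ L * Real.exp (‖z‖ * L) ^ 2 := by
    intro w w' hw hw'
    have h1 := norm_waveMul_le (volume.restrict S) L w
    have h2 := norm_waveMul_le (volume.restrict S) L w'
    rw [hw] at h1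
    rw [hw'] at h2
    calc _ ≤ ‖waveMul _ L w‖ * (‖volterra hL hS‖ * ‖waveMul _ L w'‖) :=
          (ContinuousLinearMap.opNorm_comp_le _ _).trans (mul_le_mul_of_nonneg_left
            (ContinuousLinearMap.opNorm_comp_le _ _) (norm_nonneg _))
      _ ≤ Real.exp (‖z‖ * L) * (L * Real.exp (‖z‖ * L)) := by
          gcongr
          exact norm_volterra_le hL hS
      _ = _ := by ring
  refine (norm_sub_le _ _).trans ((add_le_add (h z (-z) rfl (norm_neg z))
    (h (-z) z (norm_neg z) rfl)).trans_eq ?_)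
  ring

end edgeOperators

end QGraph
end

/-! ### The vertex conditions as a linear system -/

noncomputable section

namespace QGraph

open Topology Filter
open scoped ComplexConjugate

section system

variable {J K M : ℕ} {G : LeadGraph J K M} {ℓ : Fin M → ℝ}

/-- The length of the truncated edges. -/
def edgeLength (ℓ : Fin M → ℝ) (ρ : ℝ) : Fin K ⊕ Fin M → ℝ
  | Sum.inl _ => ρ
  | Sum.inr m => ℓ m

theorem truncatedEdge_eq (ρ : ℝ) (e : Fin K ⊕ Fin M) :
    truncatedEdge ℓ ρ e = Icc 0 (edgeLength ℓ ρ e) := by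
  cases e <;> rfl

theorem edgeLength_nonneg {ρ : ℝ} (hρ : 0 ≤ ρ) (hℓ : ∀ m, 0 < ℓ m) (e : Fin K ⊕ Fin M) :
    0 ≤ edgeLength ℓ ρ e := by
  cases e with
  | inl k => exact hρ
  | inr m => exact (hℓ m).le

theorem Icc_edgeLength_subset (ℓ : Fin M → ℝ) (ρ : ℝ) (e : Fin K ⊕ Fin M) :
    Icc 0 (edgeLength ℓ ρ e) ⊆ edgeSet ℓ e := by
  cases e with
  | inl k => exact Icc_subset_Ici_self
  | inr m => exact subset_rfl

/-- The unknowns of the boundary value problem: the amplitudes of the two waves on every edge and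
the values at the vertices. -/
abbrev SysIdx (J K M : ℕ) : Type := ((Fin K ⊕ Fin M) ⊕ (Fin K ⊕ Fin M)) ⊕ Fin J

/-- The vertex at `x = 0`. -/
def origin (G : LeadGraph J K M) : Fin K ⊕ Fin M → Fin J
  | Sum.inl k => G.leadVertex k
  | Sum.inr m => G.source m

/-- `1` at the vertices where no edge ends, `0` elsewhere. -/
def isolated (G : LeadGraph J K M) (v : Fin J) : ℂ :=
  if (∃ k, G.leadVertex k = v) ∨ (∃ m, G.source m = v) ∨ ∃ m, G.target m = v then 0 else 1

/-- The left hand side of the boundary value problem. -/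
def sysRow (G : LeadGraph J K M) (ℓ : Fin M → ℝ) (z : ℂ) (X : SysIdx J K M → ℂ) :
    SysIdx J K M → ℂ
  | Sum.inl (Sum.inl e) => X (Sum.inl (Sum.inl e)) + X (Sum.inl (Sum.inr e)) - X (Sum.inr (origin G e))
  -- On a lead the second equation is the outgoing condition: it prescribes the amplitude of
  -- `e^{-izx}` at the vertex so that this amplitude vanishes beyond the cutoff.
  | Sum.inl (Sum.inr (Sum.inl k)) => X (Sum.inl (Sum.inr (Sum.inl k)))
  | Sum.inl (Sum.inr (Sum.inr m)) => X (Sum.inl (Sum.inl (Sum.inr m))) * wave z (ℓ m)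
      + X (Sum.inl (Sum.inr (Sum.inr m))) * wave (-z) (ℓ m) - X (Sum.inr (G.target m))
  -- The Kirchhoff condition divided by `iz`.
  | Sum.inr v =>
      (∑ k with G.leadVertex k = v,
        -(X (Sum.inl (Sum.inl (Sum.inl k))) - X (Sum.inl (Sum.inr (Sum.inl k)))))
      + (∑ m with G.source m = v,
        -(X (Sum.inl (Sum.inl (Sum.inr m))) - X (Sum.inl (Sum.inr (Sum.inr m)))))
      + (∑ m with G.target m = v,
        (X (Sum.inl (Sum.inl (Sum.inr m))) * wave z (ℓ m)
          - X (Sum.inl (Sum.inr (Sum.inr m))) * wave (-z) (ℓ m)))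
      -- At a vertex without edges the Kirchhoff condition is void. This term fixes the otherwise
      -- free value there, without which the matrix would be singular.
      + isolated G v * X (Sum.inr v)

/-- The boundary value problem as a linear map. -/
def sysMap (G : LeadGraph J K M) (ℓ : Fin M → ℝ) (z : ℂ) :
    (SysIdx J K M → ℂ) →ₗ[ℂ] (SysIdx J K M → ℂ) where
  toFun := sysRow G ℓ z
  map_add' X Y := by
    ext i
    rcases i with (e | k | m) | v
    · simp only [sysRow, Pi.add_apply]
      ring
    · simp only [sysRow, Pi.add_apply]
    · simp only [sysRow, Pi.add_apply]
      ring
    · simp only [sysRow, Pi.add_apply, Finset.sum_neg_distrib, Finset.sum_sub_distrib,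
        Finset.sum_add_distrib, add_mul]
      ring
  map_smul' a X := by
    ext i
    rcases i with (e | k | m) | v
    · simp only [sysRow, Pi.smul_apply, RingHom.id_apply, smul_eq_mul]
      ring
    · simp only [sysRow, Pi.smul_apply, RingHom.id_apply, smul_eq_mul]
    · simp only [sysRow, Pi.smul_apply, RingHom.id_apply, smul_eq_mul]
      ring
    · simp only [sysRow, Pi.smul_apply, RingHom.id_apply, smul_eq_mul, Finset.sum_neg_distrib,
        Finset.sum_sub_distrib, mul_assoc, ← Finset.mul_sum]
      ring

/-- The matrix of the boundary value problem. -/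
def sysMatrix (G : LeadGraph J K M) (ℓ : Fin M → ℝ) (z : ℂ) :
    Matrix (SysIdx J K M) (SysIdx J K M) ℂ :=
  LinearMap.toMatrix' (sysMap G ℓ z)

theorem sysMatrix_mulVec (z : ℂ) (X : SysIdx J K M → ℂ) :
    (sysMatrix G ℓ z).mulVec X = sysRow G ℓ z X :=
  LinearMap.toMatrix'_mulVec (sysMap G ℓ z) X

/-- Joint continuity in `z` and the lengths is what allows compactness to produce uniform constants.
The matrix does not involve the cutoff radius. -/
theorem continuous_sysMatrix (G : LeadGraph J K M) :
    Continuous fun p : ℂ × (Fin M → ℝ) => sysMatrix G p.2 p.1 := by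
  refine continuous_matrix fun i j => ?_
  simp only [sysMatrix, LinearMap.toMatrix'_apply, sysMap, LinearMap.coe_mk, AddHom.coe_mk]
  rcases i with (e | k | m) | v
  · simp only [sysRow]
    exact continuous_const
  · simp only [sysRow]
    exact continuous_const
  · simp only [sysRow, wave]
    fun_prop
  · simp only [sysRow, wave]
    fun_prop

theorem differentiable_sysMatrix (i j : SysIdx J K M) :
    Differentiable ℂ fun z => sysMatrix G ℓ z i j := by
  simp only [sysMatrix, LinearMap.toMatrix'_apply, sysMap, LinearMap.coe_mk, AddHom.coe_mk]
  rcases i with (e | k | m) | v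
  · simp only [sysRow]
    exact differentiable_const _
  · simp only [sysRow]
    exact differentiable_const _
  · simp only [sysRow, wave]
    fun_prop
  · simp only [sysRow, wave]
    fun_prop

theorem differentiable_det {n : Type*} [Fintype n] [DecidableEq n] {A : ℂ → Matrix n n ℂ}
    (h : ∀ i j, Differentiable ℂ fun z => A z i j) : Differentiable ℂ fun z => (A z).det := by
  simp only [Matrix.det_apply]
  fun_prop

theorem differentiable_adjugate {n : Type*} [Fintype n] [DecidableEq n] {A : ℂ → Matrix n n ℂ}
    (h : ∀ i j, Differentiable ℂ fun z => A z i j) (i j : n) :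
    Differentiable ℂ fun z => (A z).adjugate i j := by
  simp only [Matrix.adjugate_apply]
  refine differentiable_det fun i' j' => ?_
  by_cases hi : i' = j
  · subst hi
    simp only [Matrix.updateRow_self]
    exact differentiable_const _
  · simp only [Matrix.updateRow_ne hi]
    exact h i' j'

/-- The integral of `e^{izy} f` over a truncated edge. -/
def edgeInt (ℓ : Fin M → ℝ) (ρ : ℝ) (e : Fin K ⊕ Fin M) (z : ℂ) : L2 K ℓ →L[ℂ] ℂ :=
  waveInt (edgeSet ℓ e) (edgeLength ℓ ρ e) z ∘L
    PiLp.proj 2 (fun e : Fin K ⊕ Fin M => Lp ℂ 2 (edgeMeasure ℓ e)) e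

/-- The right hand side of the boundary value problem, up to the factor `1 / z`. -/
def sysRhs (G : LeadGraph J K M) (ℓ : Fin M → ℝ) (ρ : ℝ) (z : ℂ) : SysIdx J K M → L2 K ℓ →L[ℂ] ℂ
  | Sum.inl (Sum.inl _) => 0
  | Sum.inl (Sum.inr (Sum.inl k)) => (Complex.I / 2) • edgeInt ℓ ρ (Sum.inl k) z
  | Sum.inl (Sum.inr (Sum.inr m)) => (-(Complex.I / 2)) •
      (wave z (ℓ m) • edgeInt ℓ ρ (Sum.inr m) (-z) - wave (-z) (ℓ m) • edgeInt ℓ ρ (Sum.inr m) z)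
  | Sum.inr v => (-(Complex.I / 2)) • ∑ m with G.target m = v,
      (wave z (ℓ m) • edgeInt ℓ ρ (Sum.inr m) (-z) + wave (-z) (ℓ m) • edgeInt ℓ ρ (Sum.inr m) z)

/-- The restriction of the data to the truncated edges. -/
def truncFun (ρ : ℝ) (f : L2 K ℓ) (e : Fin K ⊕ Fin M) : ℝ → ℂ :=
  (Icc 0 (edgeLength ℓ ρ e)).indicator (f e)

theorem memLp_truncFun (ρ : ℝ) (f : L2 K ℓ) (e : Fin K ⊕ Fin M) :
    MemLp (truncFun ρ f e) 2 volume := by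
  rw [truncFun, memLp_indicator_iff_restrict measurableSet_Icc]
  exact memLp_Icc_of_subset (Lp.memLp (f e)) (Icc_edgeLength_subset ℓ ρ e)

theorem integrable_truncFun (ρ : ℝ) (f : L2 K ℓ) (e : Fin K ⊕ Fin M) :
    Integrable (truncFun ρ f e) volume := by
  rw [truncFun, integrable_indicator_iff measurableSet_Icc]
  exact integrableOn_of_memLp (Lp.memLp (f e)) (Icc_edgeLength_subset ℓ ρ e)

theorem edgeInt_apply {ρ : ℝ} (hρ : 0 ≤ ρ) (hℓ : ∀ m, 0 < ℓ m) (e : Fin K ⊕ Fin M) (z : ℂ)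
    (f : L2 K ℓ) : edgeInt ℓ ρ e z f
      = ∫ t in (0 : ℝ)..edgeLength ℓ ρ e, wave z t * truncFun ρ f e t :=
  waveInt_apply (edgeLength_nonneg hρ hℓ e) (Icc_edgeLength_subset ℓ ρ e) z (f e)

theorem waveCoeff_edgeLength {ρ : ℝ} (hρ : 0 ≤ ρ) (hℓ : ∀ m, 0 < ℓ m) (e : Fin K ⊕ Fin M)
    (z α : ℂ) (f : L2 K ℓ) : waveCoeff z α (truncFun ρ f e) (edgeLength ℓ ρ e)
      = α + Complex.I / 2 * z⁻¹ * edgeInt ℓ ρ e (-z) f := by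
  rw [edgeInt_apply hρ hℓ, waveCoeff]

/-- A solution of the linear system gives a solution of `P u - z² u = f` for truncated `f`. -/
theorem exists_isRealization_of_sysRow {ρ : ℝ} (hρ : 0 ≤ ρ) (hℓ : ∀ m, 0 < ℓ m) {z : ℂ}
    (hz : 0 < z.im) (f : L2 K ℓ) (X : SysIdx J K M → ℂ)
    (hX : ∀ i, sysRow G ℓ z X i = z⁻¹ * sysRhs G ℓ ρ z i f) :
    ∃ u : L2 K ℓ, IsRealization G ℓ u (cutoff ℓ ρ f + z ^ 2 • u)
      (fun e => waveSol z (X (Sum.inl (Sum.inl e))) (X (Sum.inl (Sum.inr e))) (truncFun ρ f e))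
      (fun e => waveSol' z (X (Sum.inl (Sum.inl e))) (X (Sum.inl (Sum.inr e))) (truncFun ρ f e))
      (fun e => waveSol'' z (X (Sum.inl (Sum.inl e))) (X (Sum.inl (Sum.inr e)))
        (truncFun ρ f e)) := by
  have hz0 : z ≠ 0 := fun h0 => by simp [h0] at hz
  have hH2 : ∀ e : Fin K ⊕ Fin M, IsH2 (edgeSet ℓ e)
      (waveSol z (X (Sum.inl (Sum.inl e))) (X (Sum.inl (Sum.inr e))) (truncFun ρ f e))
      (waveSol' z (X (Sum.inl (Sum.inl e))) (X (Sum.inl (Sum.inr e))) (truncFun ρ f e))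
      (waveSol'' z (X (Sum.inl (Sum.inl e))) (X (Sum.inl (Sum.inr e))) (truncFun ρ f e)) := by
    rintro (k | m)
    -- On a lead, the second row of the system says precisely that the amplitude of the growing wave
    -- vanishes from `ρ` on.
    · refine isH2_Ici_waveSol hz (integrable_truncFun ρ f _) (memLp_truncFun ρ f _) (ρ := ρ)
        (fun x hx => ?_) ?_
      · rw [truncFun, indicator_of_notMem]
        exact fun h => absurd h.2 (not_le.2 hx)
      · have h1 := waveCoeff_edgeLength hρ hℓ (Sum.inl k) (-z) (X (Sum.inl (Sum.inr (Sum.inl k)))) f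
        have h2 := hX (Sum.inl (Sum.inr (Sum.inl k)))
        simp only [sysRow, sysRhs, smul_apply, smul_eq_mul] at h2
        rw [neg_neg] at h1
        have h3 : edgeLength ℓ ρ (Sum.inl k : Fin K ⊕ Fin M) = ρ := rfl
        rw [h3] at h1
        rw [h1, h2, inv_neg]
        ring
    · exact isH2_Icc_waveSol hz0 (integrable_truncFun ρ f _) (memLp_truncFun ρ f _) (ℓ m)
  have hat0 : ∀ e : Fin K ⊕ Fin M,
      waveSol z (X (Sum.inl (Sum.inl e))) (X (Sum.inl (Sum.inr e))) (truncFun ρ f e) 0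
        = X (Sum.inl (Sum.inl e)) + X (Sum.inl (Sum.inr e)) := fun e => by
    simp [waveSol, waveCoeff_zero, wave_zero_right]
  have hat0' : ∀ e : Fin K ⊕ Fin M,
      waveSol' z (X (Sum.inl (Sum.inl e))) (X (Sum.inl (Sum.inr e))) (truncFun ρ f e) 0
        = Complex.I * z * (X (Sum.inl (Sum.inl e)) - X (Sum.inl (Sum.inr e))) := fun e => by
    simp [waveSol', waveCoeff_zero, wave_zero_right]
  have hc1 : ∀ m : Fin M, waveCoeff z (X (Sum.inl (Sum.inl (Sum.inr m))))
      (truncFun ρ f (Sum.inr m)) (ℓ m) = X (Sum.inl (Sum.inl (Sum.inr m)))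
        + Complex.I / 2 * z⁻¹ * edgeInt ℓ ρ (Sum.inr m) (-z) f := fun m =>
    waveCoeff_edgeLength hρ hℓ (Sum.inr m) z _ f
  have hc2 : ∀ m : Fin M, waveCoeff (-z) (X (Sum.inl (Sum.inr (Sum.inr m))))
      (truncFun ρ f (Sum.inr m)) (ℓ m) = X (Sum.inl (Sum.inr (Sum.inr m)))
        - Complex.I / 2 * z⁻¹ * edgeInt ℓ ρ (Sum.inr m) z f := fun m => by
    have h := waveCoeff_edgeLength hρ hℓ (Sum.inr m) (-z) (X (Sum.inl (Sum.inr (Sum.inr m)))) f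
    rw [neg_neg, inv_neg] at h
    refine Eq.trans h ?_
    ring
  let u : L2 K ℓ := WithLp.toLp 2 fun e => (hH2 e).memLp.toLp _
  have hu : ∀ e, u e =ᵐ[edgeMeasure ℓ e]
      waveSol z (X (Sum.inl (Sum.inl e))) (X (Sum.inl (Sum.inr e))) (truncFun ρ f e) := fun e =>
    MemLp.coeFn_toLp (hH2 e).memLp
  refine ⟨u, hH2, hu, fun e => ?_, ?_, ?_⟩
  · filter_upwards [hu e, Lp.coeFn_add (cutoff ℓ ρ f e) ((z ^ 2 • u) e),
      Lp.coeFn_smul (z ^ 2) (u e), coeFn_cutoff ρ f e] with x h1 h2 h3 h4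
    have e1 : (cutoff ℓ ρ f + z ^ 2 • u) e = cutoff ℓ ρ f e + (z ^ 2 • u) e := rfl
    have e2 : (z ^ 2 • u) e = z ^ 2 • u e := rfl
    rw [e1, h2, Pi.add_apply, h4, e2, h3, Pi.smul_apply, h1, waveSol'', truncatedEdge_eq,
      smul_eq_mul, truncFun]
    ring
  · refine ⟨fun v => X (Sum.inr v), fun k => ?_, fun m => ?_, fun m => ?_⟩
    · have h := hX (Sum.inl (Sum.inl (Sum.inl k)))
      simp only [sysRow, sysRhs, zero_apply, mul_zero, origin] at h
      refine (hat0 _).trans ?_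
      beta_reduce
      linear_combination h
    · have h := hX (Sum.inl (Sum.inl (Sum.inr m)))
      simp only [sysRow, sysRhs, zero_apply, mul_zero, origin] at h
      refine (hat0 _).trans ?_
      beta_reduce
      linear_combination h
    · have h := hX (Sum.inl (Sum.inr (Sum.inr m)))
      simp only [sysRow, sysRhs, smul_apply, sub_apply, smul_eq_mul] at h
      simp only [waveSol]
      rw [hc1, hc2]
      linear_combination h
  · intro v
    have h := hX (Sum.inr v)
    have hiso : isolated G v * X (Sum.inr v) = 0 ∨ ((∀ k, G.leadVertex k ≠ v) ∧
        (∀ m, G.source m ≠ v) ∧ ∀ m, G.target m ≠ v) := by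
      by_cases hv : (∃ k, G.leadVertex k = v) ∨ (∃ m, G.source m = v) ∨ ∃ m, G.target m = v
      · left
        rw [isolated, if_pos hv, zero_mul]
      · right
        push Not at hv
        exact hv
    -- Either the auxiliary term drops out of the row, or no edge ends at `v` and the Kirchhoff sum
    -- is empty.
    rcases hiso with hiso | ⟨i1, i2, i3⟩
    · simp only [sysRow, sysRhs] at h
      rw [hiso, add_zero] at h
      have h2 : (∑ m with G.target m = v, waveSol' z (X (Sum.inl (Sum.inl (Sum.inr m))))
            (X (Sum.inl (Sum.inr (Sum.inr m)))) (truncFun ρ f (Sum.inr m)) (ℓ m))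
          = Complex.I * z * ((∑ m with G.target m = v, (X (Sum.inl (Sum.inl (Sum.inr m))) * wave z (ℓ m)
            - X (Sum.inl (Sum.inr (Sum.inr m))) * wave (-z) (ℓ m)))
            + Complex.I / 2 * z⁻¹ * ∑ m with G.target m = v,
              (wave z (ℓ m) * edgeInt ℓ ρ (Sum.inr m) (-z) f
                + wave (-z) (ℓ m) * edgeInt ℓ ρ (Sum.inr m) z f)) := by
        rw [Finset.mul_sum, ← Finset.sum_add_distrib, Finset.mul_sum]
        refine Finset.sum_congr rfl fun m _ => ?_
        simp only [waveSol']
        rw [hc1, hc2]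
        ring
      rw [h2]
      simp only [hat0']
      have h3 : (∑ k with G.leadVertex k = v, -(Complex.I * z *
            (X (Sum.inl (Sum.inl (Sum.inl k))) - X (Sum.inl (Sum.inr (Sum.inl k))))))
          = Complex.I * z * ∑ k with G.leadVertex k = v,
            -(X (Sum.inl (Sum.inl (Sum.inl k))) - X (Sum.inl (Sum.inr (Sum.inl k)))) := by
        rw [Finset.mul_sum]
        exact Finset.sum_congr rfl fun _ _ => by ring
      have h4 : (∑ m with G.source m = v, -(Complex.I * z *
            (X (Sum.inl (Sum.inl (Sum.inr m))) - X (Sum.inl (Sum.inr (Sum.inr m))))))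
          = Complex.I * z * ∑ m with G.source m = v,
            -(X (Sum.inl (Sum.inl (Sum.inr m))) - X (Sum.inl (Sum.inr (Sum.inr m)))) := by
        rw [Finset.mul_sum]
        exact Finset.sum_congr rfl fun _ _ => by ring
      rw [h3, h4]
      have h5 : ((-(Complex.I / 2)) • ∑ m with G.target m = v,
          (wave z (ℓ m) • edgeInt ℓ ρ (Sum.inr m) (-z)
            + wave (-z) (ℓ m) • edgeInt ℓ ρ (Sum.inr m) z) : L2 K ℓ →L[ℂ] ℂ) f
          = -(Complex.I / 2) * ∑ m with G.target m = v,
              (wave z (ℓ m) * edgeInt ℓ ρ (Sum.inr m) (-z) f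
                + wave (-z) (ℓ m) * edgeInt ℓ ρ (Sum.inr m) z f) := by
        rw [smul_apply, sum_apply, smul_eq_mul]
        rfl
      rw [h5] at h
      linear_combination Complex.I * z * h
    · simp [Finset.filter_false_of_mem, i1, i2, i3]

end system

end QGraph
end

/-! ### The explicit continuation of the cut-off resolvent -/

noncomputable section

namespace QGraph

open Topology Filter
open scoped ComplexConjugate

section continuation

variable {J K M : ℕ} {G : LeadGraph J K M} {ℓ : Fin M → ℝ}

/-- The boundary value problem is uniquely solvable in the physical half plane. -/
theorem eq_zero_of_sysRow_eq_zero (hℓ : ∀ m, 0 < ℓ m) {z : ℂ} (hz : 0 < z.im)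
    {X : SysIdx J K M → ℂ} (hX : sysRow G ℓ z X = 0) : X = 0 := by
  have hz0 : z ≠ 0 := fun h0 => by simp [h0] at hz
  -- A null vector of the system is a solution with data `f = 0`; the cutoff radius `1` is
  -- arbitrary.
  obtain ⟨u, hu⟩ := exists_isRealization_of_sysRow (G := G) zero_le_one hℓ hz 0 X (fun i => by
    rw [hX, map_zero, mul_zero, Pi.zero_apply])
  rw [map_zero] at hu
  have hu0 : u = 0 := by
    have := HamiltonianRel.norm_le (hamiltonianRel_iff.2 ⟨_, _, _, hu⟩) hℓ hz
    rw [norm_zero, zero_div] at this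
    exact norm_le_zero_iff.1 this
  subst hu0
  -- `u = 0` holds only almost everywhere. The trace inequality, with all three norms equal to zero,
  -- transfers it to the values of the solution and its derivative at `x = 0`, that is, to the sum
  -- and difference of the amplitudes.
  have n1 : ∀ e, (eLpNorm (waveSol z (X (Sum.inl (Sum.inl e))) (X (Sum.inl (Sum.inr e)))
      (truncFun 1 0 e)) 2 (edgeMeasure ℓ e)).toReal = 0 := fun e => by
    rw [← eLpNorm_congr_ae (hu.coe_eq e), ← Lp.norm_def]
    exact norm_zero
  have n2 : ∀ e, (eLpNorm (waveSol' z (X (Sum.inl (Sum.inl e))) (X (Sum.inl (Sum.inr e)))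
      (truncFun 1 0 e)) 2 (edgeMeasure ℓ e)).toReal = 0 := fun e => by
    have h := hu.eLpNorm_deriv_sq_le hℓ e
    rw [norm_zero, zero_mul] at h
    exact pow_eq_zero_iff two_ne_zero |>.1 (le_antisymm h (sq_nonneg _))
  have n3 : ∀ e, (eLpNorm (waveSol'' z (X (Sum.inl (Sum.inl e))) (X (Sum.inl (Sum.inr e)))
      (truncFun 1 0 e)) 2 (edgeMeasure ℓ e)).toReal = 0 := fun e => by
    have h := eLpNorm_congr_ae (p := 2) (hu.coe_eq'' e)
    have h2 := eLpNorm_neg (waveSol'' z (X (Sum.inl (Sum.inl e))) (X (Sum.inl (Sum.inr e)))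
      (truncFun 1 (0 : L2 K ℓ) e)) 2 (edgeMeasure ℓ e)
    rw [← h2]
    refine (congrArg ENNReal.toReal h.symm).trans ?_
    rw [← Lp.norm_def, smul_zero, add_zero]
    exact norm_zero
  have t0 : ∀ e, X (Sum.inl (Sum.inl e)) + X (Sum.inl (Sum.inr e)) = 0 := fun e => by
    have h := norm_trace_le (hu.isH2 e).memLp (hu.isH2 e).memLp' (pieceLength_pos hℓ e)
      (Icc_pieceLength_subset e) (hu.isH2 e).eq_integral
    rw [n1, n2, mul_zero, mul_zero, add_zero] at h
    have := norm_le_zero_iff.1 h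
    simpa [waveSol, waveCoeff_zero, wave_zero_right] using this
  have t1 : ∀ e, X (Sum.inl (Sum.inl e)) - X (Sum.inl (Sum.inr e)) = 0 := fun e => by
    have h := norm_trace_le (hu.isH2 e).memLp' (hu.isH2 e).memLp'' (pieceLength_pos hℓ e)
      (Icc_pieceLength_subset e) (hu.isH2 e).eq_integral'
    rw [n2, n3, mul_zero, mul_zero, add_zero] at h
    have := norm_le_zero_iff.1 h
    simpa [waveSol', waveCoeff_zero, wave_zero_right, hz0] using this
  have hα : ∀ e, X (Sum.inl (Sum.inl e)) = 0 := fun e => by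
    linear_combination (t0 e + t1 e) / 2
  have hβ : ∀ e, X (Sum.inl (Sum.inr e)) = 0 := fun e => by
    linear_combination (t0 e - t1 e) / 2
  have horigin : ∀ e, X (Sum.inr (origin G e)) = 0 := fun e => by
    have h := congrFun hX (Sum.inl (Sum.inl e))
    simp only [sysRow, hα, hβ, Pi.zero_apply] at h
    simpa using h
  have hv : ∀ v, X (Sum.inr v) = 0 := by
    intro v
    by_cases hc : (∃ k, G.leadVertex k = v) ∨ (∃ m, G.source m = v) ∨ ∃ m, G.target m = v
    · rcases hc with ⟨k, rfl⟩ | ⟨m, rfl⟩ | ⟨m, rfl⟩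
      · exact horigin (Sum.inl k)
      · exact horigin (Sum.inr m)
      · have h := congrFun hX (Sum.inl (Sum.inr (Sum.inr m)))
        simp only [sysRow, hα, hβ, Pi.zero_apply] at h
        simpa using h
    · have h := congrFun hX (Sum.inr v)
      simp only [sysRow, hα, hβ, Pi.zero_apply, isolated, if_neg hc] at h
      simpa using h
  ext i
  rcases i with (e | e) | v
  · exact hα e
  · exact hβ e
  · exact hv v

/-- A square system with trivial kernel is invertible. Thus uniqueness, from the energy estimate,
also gives existence of the resolvent in the upper half plane. -/
theorem det_sysMatrix_ne_zero (hℓ : ∀ m, 0 < ℓ m) {z : ℂ} (hz : 0 < z.im) :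
    (sysMatrix G ℓ z).det ≠ 0 := by
  intro h
  obtain ⟨X, hX0, hX⟩ := Matrix.exists_mulVec_eq_zero_iff.2 h
  rw [sysMatrix_mulVec] at hX
  exact hX0 (eq_zero_of_sysRow_eq_zero hℓ hz hX)

/-- The inclusion of the functions on an edge. -/
def edgeIncl (ℓ : Fin M → ℝ) (e : Fin K ⊕ Fin M) : Lp ℂ 2 (edgeMeasure ℓ e) →L[ℂ] L2 K ℓ :=
  ((PiLp.continuousLinearEquiv 2 ℂ
      (fun e : Fin K ⊕ Fin M => Lp ℂ 2 (edgeMeasure ℓ e))).symm :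
        ((e : Fin K ⊕ Fin M) → Lp ℂ 2 (edgeMeasure ℓ e)) →L[ℂ] L2 K ℓ) ∘L
    ContinuousLinearMap.single ℂ (fun e : Fin K ⊕ Fin M => Lp ℂ 2 (edgeMeasure ℓ e)) e

theorem edgeIncl_apply (e : Fin K ⊕ Fin M) (g : Lp ℂ 2 (edgeMeasure ℓ e)) :
    edgeIncl ℓ e g = PiLp.single 2 e g := rfl

theorem norm_edgeIncl_le (e : Fin K ⊕ Fin M) : ‖edgeIncl ℓ e‖ ≤ 1 :=
  ContinuousLinearMap.opNorm_le_bound _ zero_le_one fun g => by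
    rw [edgeIncl_apply, PiLp.norm_single, one_mul]

/-- The restriction to an edge. -/
abbrev edgeProj (ℓ : Fin M → ℝ) (e : Fin K ⊕ Fin M) : L2 K ℓ →L[ℂ] Lp ℂ 2 (edgeMeasure ℓ e) :=
  PiLp.proj 2 (fun e : Fin K ⊕ Fin M => Lp ℂ 2 (edgeMeasure ℓ e)) e

theorem norm_edgeProj_le (e : Fin K ⊕ Fin M) : ‖edgeProj ℓ e‖ ≤ 1 :=
  ContinuousLinearMap.opNorm_le_bound _ zero_le_one fun f => by
    rw [one_mul]
    exact norm_apply_le f e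

theorem sum_edgeIncl_apply (g : ∀ e : Fin K ⊕ Fin M, Lp ℂ 2 (edgeMeasure ℓ e))
    (e : Fin K ⊕ Fin M) : (∑ e', edgeIncl ℓ e' (g e')) e = g e := by
  have h : ∀ e', (edgeIncl ℓ e' (g e')) e = (Pi.single e' (g e') : ∀ e, Lp ℂ 2 (edgeMeasure ℓ e)) e :=
    fun e' => rfl
  rw [WithLp.ofLp_sum, Finset.sum_apply]
  simp only [h]
  exact Fintype.sum_pi_single e g

/-- The solution of the boundary value problem, up to the factor `1 / (z det)`. -/
def amplitude (G : LeadGraph J K M) (ℓ : Fin M → ℝ) (ρ : ℝ) (z : ℂ) (i : SysIdx J K M) :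
    L2 K ℓ →L[ℂ] ℂ :=
  ∑ j, (sysMatrix G ℓ z).adjugate i j • sysRhs G ℓ ρ z j

/-- Multiples of the indicator function of a truncated edge. -/
def oneMap (ℓ : Fin M → ℝ) (ρ : ℝ) (e : Fin K ⊕ Fin M) : ℂ →L[ℂ] Lp ℂ 2 (edgeMeasure ℓ e) :=
  ContinuousLinearMap.toSpanSingleton ℂ (oneLp (edgeSet ℓ e) (edgeLength ℓ ρ e))

/-- The component on an edge of the numerator of the continued resolvent. -/
def edgeNumer (G : LeadGraph J K M) {ρ : ℝ} (hρ : 0 ≤ ρ) (hℓ : ∀ m, 0 < ℓ m)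
    (e : Fin K ⊕ Fin M) (z : ℂ) : L2 K ℓ →L[ℂ] Lp ℂ 2 (edgeMeasure ℓ e) :=
  waveMul _ (edgeLength ℓ ρ e) z ∘L oneMap ℓ ρ e ∘L amplitude G ℓ ρ z (Sum.inl (Sum.inl e))
    + waveMul _ (edgeLength ℓ ρ e) (-z) ∘L oneMap ℓ ρ e ∘L amplitude G ℓ ρ z (Sum.inl (Sum.inr e))
    -- The factor `det` compensates for the common denominator `z * det`, since this part of the
    -- solution needs only `1 / z`.
    + ((sysMatrix G ℓ z).det * (Complex.I / 2)) •
      (initialSol (edgeLength_nonneg hρ hℓ e) (Icc_edgeLength_subset ℓ ρ e) z ∘L edgeProj ℓ e)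

/-- The numerator of the continued resolvent. -/
def numer (G : LeadGraph J K M) {ρ : ℝ} (hρ : 0 ≤ ρ) (hℓ : ∀ m, 0 < ℓ m) (z : ℂ) :
    L2 K ℓ →L[ℂ] L2 K ℓ :=
  ∑ e, edgeIncl ℓ e ∘L edgeNumer G hρ hℓ e z

/-- The denominator of the continued resolvent. -/
def denom (G : LeadGraph J K M) (ℓ : Fin M → ℝ) (z : ℂ) : ℂ := z * (sysMatrix G ℓ z).det

/-- The continued resolvent. -/
def continued (G : LeadGraph J K M) {ρ : ℝ} (hρ : 0 ≤ ρ) (hℓ : ∀ m, 0 < ℓ m) (z : ℂ) :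
    L2 K ℓ →L[ℂ] L2 K ℓ := (denom G ℓ z)⁻¹ • numer G hρ hℓ z

theorem differentiable_edgeInt {ρ : ℝ} (hρ : 0 ≤ ρ) (hℓ : ∀ m, 0 < ℓ m) (e : Fin K ⊕ Fin M) :
    Differentiable ℂ fun z => edgeInt ℓ ρ e z :=
  (differentiable_waveInt (edgeLength_nonneg hρ hℓ e)).clm_comp (differentiable_const _)

theorem differentiable_sysRhs {ρ : ℝ} (hρ : 0 ≤ ρ) (hℓ : ∀ m, 0 < ℓ m) (i : SysIdx J K M) :
    Differentiable ℂ fun z => sysRhs G ℓ ρ z i := by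
  have h1 := fun e : Fin K ⊕ Fin M => differentiable_edgeInt hρ hℓ e
  have h2 : ∀ e : Fin K ⊕ Fin M, Differentiable ℂ fun z => edgeInt ℓ ρ e (-z) := fun e =>
    (h1 e).comp differentiable_neg
  have w1 : ∀ x : ℝ, Differentiable ℂ fun z => wave z x := fun x => by
    unfold wave
    fun_prop
  have w2 : ∀ x : ℝ, Differentiable ℂ fun z => wave (-z) x := fun x =>
    (w1 x).comp differentiable_neg
  rcases i with (e | k | m) | v
  · exact differentiable_const _
  · exact (h1 (Sum.inl k)).fun_const_smul (Complex.I / 2)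
  · exact (((w1 (ℓ m)).fun_smul (h2 (Sum.inr m))).fun_sub
      ((w2 (ℓ m)).fun_smul (h1 (Sum.inr m)))).fun_const_smul (-(Complex.I / 2))
  · simp only [sysRhs]
    exact (Differentiable.fun_sum fun m _ => ((w1 (ℓ m)).fun_smul (h2 (Sum.inr m))).fun_add
      ((w2 (ℓ m)).fun_smul (h1 (Sum.inr m)))).fun_const_smul (-(Complex.I / 2))

theorem differentiable_amplitude {ρ : ℝ} (hρ : 0 ≤ ρ) (hℓ : ∀ m, 0 < ℓ m) (i : SysIdx J K M) :
    Differentiable ℂ fun z => amplitude G ℓ ρ z i :=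
  Differentiable.fun_sum fun j _ => (differentiable_adjugate differentiable_sysMatrix i j).smul
    (differentiable_sysRhs hρ hℓ j)

theorem differentiable_numer (G : LeadGraph J K M) {ρ : ℝ} (hρ : 0 ≤ ρ) (hℓ : ∀ m, 0 < ℓ m) :
    Differentiable ℂ (numer G hρ hℓ : ℂ → (L2 K ℓ →L[ℂ] L2 K ℓ)) := by
  refine Differentiable.fun_sum fun e _ => (differentiable_const _).clm_comp ?_
  have hL := edgeLength_nonneg (K := K) hρ hℓ e
  have h1 := differentiable_waveMul (edgeMeasure ℓ e) hL
  have h2 : Differentiable ℂ fun z => waveMul (edgeMeasure ℓ e) (edgeLength ℓ ρ e) (-z) :=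
    h1.comp differentiable_neg
  refine ((h1.clm_comp ((differentiable_const _).clm_comp (differentiable_amplitude hρ hℓ _))).add
    (h2.clm_comp ((differentiable_const _).clm_comp (differentiable_amplitude hρ hℓ _)))).add ?_
  exact ((differentiable_det differentiable_sysMatrix).mul_const _).smul
    ((differentiable_initialSol hL _).clm_comp (differentiable_const _))

theorem differentiable_denom (G : LeadGraph J K M) (ℓ : Fin M → ℝ) :
    Differentiable ℂ (denom G ℓ) :=
  differentiable_id.mul (differentiable_det differentiable_sysMatrix)

theorem continuous_denom (G : LeadGraph J K M) :
    Continuous (Function.uncurry fun (z : ℂ) (ℓ : Fin M → ℝ) => denom G ℓ z) :=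
  continuous_fst.mul (continuous_sysMatrix G).matrix_det

theorem denom_ne_zero (hℓ : ∀ m, 0 < ℓ m) {z : ℂ} (hz : 0 < z.im) : denom G ℓ z ≠ 0 :=
  mul_ne_zero (fun h0 => by simp [h0] at hz) (det_sysMatrix_ne_zero hℓ hz)

theorem meromorphicOn_continued (G : LeadGraph J K M) {ρ : ℝ} (hρ : 0 ≤ ρ)
    (hℓ : ∀ m, 0 < ℓ m) :
    MeromorphicOn (continued G hρ hℓ : ℂ → (L2 K ℓ →L[ℂ] L2 K ℓ)) univ := fun z _ =>
  ((differentiable_denom G ℓ).analyticAt z).meromorphicAt.inv.smul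
    ((differentiable_numer G hρ hℓ).analyticAt z).meromorphicAt

/-- Linking the operator formula, built for holomorphy, to the concrete solution, built for the
differential equation: after division by `denom` the amplitudes are those of Cramer's rule and the
Volterra terms regain the coefficients `± i / (2z)`. -/
theorem coeFn_numer {ρ : ℝ} (hρ : 0 ≤ ρ) (hℓ : ∀ m, 0 < ℓ m) {z : ℂ}
    (hd : (sysMatrix G ℓ z).det ≠ 0) (hz : z ≠ 0) (f : L2 K ℓ) (e : Fin K ⊕ Fin M) :
    continued G hρ hℓ z f e =ᵐ[edgeMeasure ℓ e] (Icc 0 (edgeLength ℓ ρ e)).indicator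
      (waveSol z ((denom G ℓ z)⁻¹ * amplitude G ℓ ρ z (Sum.inl (Sum.inl e)) f)
        ((denom G ℓ z)⁻¹ * amplitude G ℓ ρ z (Sum.inl (Sum.inr e)) f) (truncFun ρ f e)) := by
  set L := edgeLength ℓ ρ e with hL
  set A := amplitude G ℓ ρ z (Sum.inl (Sum.inl e)) f with hA
  set B := amplitude G ℓ ρ z (Sum.inl (Sum.inr e)) f with hB
  have hL0 : 0 ≤ L := edgeLength_nonneg hρ hℓ e
  have hS := Icc_edgeLength_subset ℓ ρ e
  have e0 : continued G hρ hℓ z f e = (denom G ℓ z)⁻¹ • edgeNumer G hρ hℓ e z f := by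
    have h1 : continued G hρ hℓ z f
        = (denom G ℓ z)⁻¹ • ∑ e', edgeIncl ℓ e' (edgeNumer G hρ hℓ e' z f) := by
      rw [continued, smul_apply, numer, sum_apply]
      rfl
    rw [h1, WithLp.ofLp_smul, Pi.smul_apply,
      sum_edgeIncl_apply (fun e' => edgeNumer G hρ hℓ e' z f)]
  have e1 : edgeNumer G hρ hℓ e z f
      = A • waveMul _ L z (oneLp (edgeSet ℓ e) L) + B • waveMul _ L (-z) (oneLp (edgeSet ℓ e) L)
        + ((sysMatrix G ℓ z).det * (Complex.I / 2)) •
          (waveMul _ L z (volterra hL0 hS (waveMul _ L (-z) (f e)))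
            - waveMul _ L (-z) (volterra hL0 hS (waveMul _ L z (f e)))) := by
    rw [← map_smul, ← map_smul]
    rfl
  rw [e0, e1]
  set a := waveMul _ L z (oneLp (edgeSet ℓ e) L) with ha
  set b := waveMul _ L (-z) (oneLp (edgeSet ℓ e) L) with hb
  set p := waveMul _ L z (volterra hL0 hS (waveMul _ L (-z) (f e))) with hp
  set q := waveMul _ L (-z) (volterra hL0 hS (waveMul _ L z (f e))) with hq
  filter_upwards [waveMul_oneLp (S := edgeSet ℓ e) (L := L) z,
    waveMul_oneLp (S := edgeSet ℓ e) (L := L) (-z),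
    coeFn_waveMul_volterra hL0 hS z (-z) (f e), coeFn_waveMul_volterra hL0 hS (-z) z (f e),
    Lp.coeFn_smul (denom G ℓ z)⁻¹ (A • a + B • b
      + ((sysMatrix G ℓ z).det * (Complex.I / 2)) • (p - q)),
    Lp.coeFn_add (A • a + B • b) (((sysMatrix G ℓ z).det * (Complex.I / 2)) • (p - q)),
    Lp.coeFn_add (A • a) (B • b), Lp.coeFn_smul A a, Lp.coeFn_smul B b,
    Lp.coeFn_smul ((sysMatrix G ℓ z).det * (Complex.I / 2)) (p - q), Lp.coeFn_sub p q]
    with x h1 h2 h3 h4 h5 h6 h7 h8 h9 h10 h11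
  rw [h5, Pi.smul_apply, h6, Pi.add_apply, h7, Pi.add_apply, h8, h9, h10, Pi.smul_apply,
    Pi.smul_apply, Pi.smul_apply, h11, Pi.sub_apply, ha, hb, hp, hq, h1, h2, h3, h4]
  by_cases hx : x ∈ Icc 0 L
  · rw [cutWave, cutWave, indicator_of_mem hx, indicator_of_mem hx, indicator_of_mem hx,
      indicator_of_mem hx, indicator_of_mem hx, waveSol, waveCoeff, waveCoeff, truncFun, neg_neg]
    simp only [smul_eq_mul, ← hL]
    have hdd : (denom G ℓ z)⁻¹ * (sysMatrix G ℓ z).det = z⁻¹ := by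
      rw [denom]
      field_simp
    rw [inv_neg]
    linear_combination (Complex.I / 2 * (wave z x * ∫ t in (0 : ℝ)..x, wave (-z) t
        * (Icc 0 L).indicator (f e) t) - Complex.I / 2 * (wave (-z) x
        * ∫ t in (0 : ℝ)..x, wave z t * (Icc 0 L).indicator (f e) t)) * hdd
  · rw [cutWave, cutWave, indicator_of_notMem hx, indicator_of_notMem hx, indicator_of_notMem hx,
      indicator_of_notMem hx, indicator_of_notMem hx]
    simp

/-- Cramer's rule `A * adj A = det A`; the extra factor `z` in `denom` accounts for the `z⁻¹` in the
data. -/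
theorem sysRow_amplitude {ρ : ℝ} {z : ℂ} (hd : (sysMatrix G ℓ z).det ≠ 0) (hz : z ≠ 0)
    (f : L2 K ℓ) (i : SysIdx J K M) :
    sysRow G ℓ z (fun i => (denom G ℓ z)⁻¹ * amplitude G ℓ ρ z i f) i
      = z⁻¹ * sysRhs G ℓ ρ z i f := by
  have h1 : (fun i => (denom G ℓ z)⁻¹ * amplitude G ℓ ρ z i f)
      = (denom G ℓ z)⁻¹ • (sysMatrix G ℓ z).adjugate.mulVec fun j => sysRhs G ℓ ρ z j f := by
    ext i
    rw [Pi.smul_apply, smul_eq_mul, amplitude, sum_apply]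
    rfl
  rw [h1, ← sysMatrix_mulVec, Matrix.mulVec_smul, Matrix.mulVec_mulVec, Matrix.mul_adjugate,
    Matrix.smul_mulVec, Matrix.one_mulVec, Pi.smul_apply, Pi.smul_apply, smul_eq_mul, smul_eq_mul,
    denom]
  field_simp

/-- In the physical half plane the explicit formula gives the resolvent. -/
theorem exists_resolvent_and_continued_eq (G : LeadGraph J K M) {ρ : ℝ} (hρ : 0 ≤ ρ)
    (hℓ : ∀ m, 0 < ℓ m) {z : ℂ} (hz : 0 < z.im) :
    ∃ B : L2 K ℓ →L[ℂ] L2 K ℓ, IsResolvent G ℓ z B ∧ ‖B‖ ≤ 1 / (‖z‖ * z.im) ∧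
      (∀ u f, HamiltonianRel G ℓ u (f + z ^ 2 • u) → B f = u) ∧
      continued G hρ hℓ z = cutoff ℓ ρ ∘L B ∘L cutoff ℓ ρ := by
  have hz0 : z ≠ 0 := fun h0 => by simp [h0] at hz
  have hd := det_sysMatrix_ne_zero (G := G) hℓ hz
  have hsol := fun (ρ : ℝ) (hρ : 0 ≤ ρ) (f : L2 K ℓ) => exists_isRealization_of_sysRow hρ hℓ hz f _
    (sysRow_amplitude (G := G) (ρ := ρ) hd hz0 f)
  obtain ⟨B, hB, hBn, hBu⟩ := exists_isResolvent hℓ hz fun ρ hρ f => by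
    obtain ⟨u, hu⟩ := hsol ρ hρ.le f
    exact ⟨u, hamiltonianRel_iff.2 ⟨_, _, _, hu⟩⟩
  refine ⟨B, hB, hBn, hBu, ?_⟩
  ext1 f
  -- The solution for the given radius coincides with `B (cutoff f)` by uniqueness, so its
  -- restriction to the truncated graph is the continued formula.
  obtain ⟨u, hu⟩ := hsol ρ hρ f
  have h1 := hBu u (cutoff ℓ ρ f) (hamiltonianRel_iff.2 ⟨_, _, _, hu⟩)
  rw [ContinuousLinearMap.comp_apply, ContinuousLinearMap.comp_apply, h1]
  ext1 e
  apply Lp.ext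
  refine (coeFn_numer hρ hℓ hd hz0 f e).trans ?_
  refine EventuallyEq.trans ?_ (coeFn_cutoff ρ u e).symm
  rw [truncatedEdge_eq]
  filter_upwards [hu.coe_eq e] with x hx
  by_cases hxL : x ∈ Icc 0 (edgeLength ℓ ρ e)
  · rw [indicator_of_mem hxL, indicator_of_mem hxL, hx]
  · rw [indicator_of_notMem hxL, indicator_of_notMem hxL]

/-- This makes `continued` an admissible witness in the definition of `resonances`: each of its
poles is a resonance. No comparison with other continuations is required. -/
theorem isCutoffContinuation_continued (G : LeadGraph J K M) {ρ : ℝ} (hρ : 0 ≤ ρ)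
    (hℓ : ∀ m, 0 < ℓ m) :
    IsCutoffContinuation G ℓ ρ (continued G hρ hℓ : ℂ → (L2 K ℓ →L[ℂ] L2 K ℓ)) := by
  refine ⟨meromorphicOn_continued G hρ hℓ, fun z hz => ?_⟩
  obtain ⟨B, hB, -, -, h⟩ := exists_resolvent_and_continued_eq G hρ hℓ hz
  exact ⟨B, hB, h⟩

end continuation

end QGraph
end

/-! ### Bounds that are uniform in the edge lengths -/

noncomputable section

namespace QGraph

open Topology Filter
open scoped ComplexConjugate

section bounds

variable {J K M : ℕ} {ℓ : Fin M → ℝ}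

theorem edgeLength_le {ρ b : ℝ} (hb : ∀ m, ℓ m ≤ b) (e : Fin K ⊕ Fin M) :
    edgeLength ℓ ρ e ≤ max ρ b := by
  cases e with
  | inl k => exact le_max_left _ _
  | inr m => exact (hb m).trans (le_max_right _ _)

theorem norm_edgeInt_le {ρ b Z : ℝ} (hρ : 0 ≤ ρ) (hℓ : ∀ m, 0 < ℓ m) (hb : ∀ m, ℓ m ≤ b)
    (e : Fin K ⊕ Fin M) {z : ℂ} (hz : ‖z‖ ≤ Z) :
    ‖edgeInt ℓ ρ e z‖ ≤ √(max ρ b) * Real.exp (Z * max ρ b) := by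
  have h0 := edgeLength_nonneg hρ hℓ e
  have h1 := edgeLength_le (ρ := ρ) hb e
  refine (ContinuousLinearMap.opNorm_comp_le _ _).trans ?_
  refine (mul_le_mul (norm_waveInt_le h0 z) (norm_edgeProj_le e) (norm_nonneg _)
    (by positivity)).trans ?_
  rw [mul_one]
  exact mul_le_mul (Real.sqrt_le_sqrt h1) (Real.exp_le_exp.2
    (mul_le_mul hz h1 h0 ((norm_nonneg _).trans hz))) (Real.exp_pos _).le (Real.sqrt_nonneg _)

/-- Each entry consists of products of a wave and an integral, in at most `M` pairs at a vertex; the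
factor `1 / 2` absorbs the pair. `M + 1` also covers the other rows when `M = 0`. -/
theorem norm_sysRhs_le (G : LeadGraph J K M) {ρ b Z : ℝ} (hρ : 0 ≤ ρ) (hℓ : ∀ m, 0 < ℓ m)
    (hb : ∀ m, ℓ m ≤ b) (i : SysIdx J K M) {z : ℂ} (hz : ‖z‖ ≤ Z) :
    ‖sysRhs G ℓ ρ z i‖ ≤ (M + 1) * (Real.exp (Z * max ρ b) ^ 2 * √(max ρ b)) := by
  set E := Real.exp (Z * max ρ b) with hE
  have hZ : 0 ≤ Z := (norm_nonneg _).trans hz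
  have hmax : 0 ≤ max ρ b := hρ.trans (le_max_left _ _)
  have hE1 : 1 ≤ E := Real.one_le_exp (by positivity)
  have hi2 : ‖Complex.I / 2‖ ≤ 1 / 2 := by simp
  have hint : ∀ (e : Fin K ⊕ Fin M) (w : ℂ), ‖w‖ = ‖z‖ → ‖edgeInt ℓ ρ e w‖ ≤ √(max ρ b) * E :=
    fun e w hw => norm_edgeInt_le hρ hℓ hb e (hw.le.trans hz)
  have hw : ∀ (m : Fin M) (w : ℂ), ‖w‖ = ‖z‖ → ‖wave w (ℓ m)‖ ≤ E := fun m w hw => by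
    refine (norm_wave_le w (L := ℓ m) ⟨(hℓ m).le, le_rfl⟩).trans (Real.exp_le_exp.2 ?_)
    rw [hw]
    exact mul_le_mul hz ((hb m).trans (le_max_right _ _)) (hℓ m).le hZ
  have hterm : ∀ (m : Fin M) (w w' : ℂ), ‖w‖ = ‖z‖ → ‖w'‖ = ‖z‖ →
      ‖wave w (ℓ m) • (edgeInt ℓ ρ (Sum.inr m) w' : L2 K ℓ →L[ℂ] ℂ)‖ ≤ E ^ 2 * √(max ρ b) := by
    intro m w w' h h'
    rw [norm_smul]
    refine (mul_le_mul (hw m w h) (hint (Sum.inr m) w' h') (norm_nonneg _)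
      (by positivity)).trans_eq ?_
    ring
  have hpos : 0 ≤ E ^ 2 * √(max ρ b) := by positivity
  have hM : (0 : ℝ) ≤ M := Nat.cast_nonneg M
  rcases i with (e | k | m) | v
  · simp only [sysRhs, norm_zero]
    positivity
  · simp only [sysRhs]
    rw [norm_smul]
    have h1 := hint (Sum.inl k) z rfl
    have h2 : √(max ρ b) * E ≤ E ^ 2 * √(max ρ b) := by
      have : 0 ≤ √(max ρ b) := Real.sqrt_nonneg _
      have : 0 ≤ √(max ρ b) * E * (E - 1) := by
        have : 0 ≤ E - 1 := by linarith
        positivity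
      nlinarith
    have h3 := mul_le_mul hi2 h1 (norm_nonneg _) (by norm_num)
    nlinarith
  · simp only [sysRhs]
    rw [norm_smul, norm_neg]
    have h1 := (norm_sub_le _ _).trans (add_le_add (hterm m z (-z) rfl (norm_neg z))
      (hterm m (-z) z (norm_neg z) rfl))
    have h3 := mul_le_mul hi2 h1 (norm_nonneg _) (by norm_num)
    nlinarith
  · simp only [sysRhs]
    rw [norm_smul, norm_neg]
    have h1 : ‖∑ m with G.target m = v, (wave z (ℓ m) • edgeInt ℓ ρ (Sum.inr m) (-z)
        + wave (-z) (ℓ m) • (edgeInt ℓ ρ (Sum.inr m) z : L2 K ℓ →L[ℂ] ℂ))‖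
        ≤ M * (2 * (E ^ 2 * √(max ρ b))) := by
      refine (norm_sum_le_of_le (Finset.univ.filter fun m => G.target m = v) (fun m _ =>
        (norm_add_le _ _).trans (add_le_add (hterm m z (-z) rfl (norm_neg z))
        (hterm m (-z) z (norm_neg z) rfl)))).trans ?_
      rw [Finset.sum_const, nsmul_eq_mul, ← two_mul]
      refine mul_le_mul_of_nonneg_right ?_ (by positivity)
      have := Finset.card_filter_le (Finset.univ : Finset (Fin M)) fun m => G.target m = v
      rw [Finset.card_univ, Fintype.card_fin] at this
      exact_mod_cast this
    have h3 := mul_le_mul hi2 h1 (norm_nonneg _) (by norm_num)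
    nlinarith

/-- The numerator of the continued resolvent is bounded uniformly in the lengths. -/
theorem exists_bound_numer (G : LeadGraph J K M) {Λ : Set ℝ} (hΛ : IsCompact Λ) {ρ : ℝ}
    (hρ : 0 ≤ ρ) (Z : ℝ) : ∃ C, 0 ≤ C ∧ ∀ (ℓ : Fin M → ℝ) (hℓ : ∀ m, 0 < ℓ m), (∀ m, ℓ m ∈ Λ) →
      ∀ z : ℂ, ‖z‖ ≤ Z → ‖(numer G hρ hℓ z : L2 K ℓ →L[ℂ] L2 K ℓ)‖ ≤ C := by
  obtain ⟨b, hb⟩ := hΛ.bddAbove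
  -- Compactness handles the matrix quantities. The operators act on spaces that vary with the
  -- lengths, so their bounds must be explicit in the maximal length.
  have hcomp : IsCompact (Metric.closedBall (0 : ℂ) Z ×ˢ univ.pi fun _ : Fin M => Λ) :=
    (isCompact_closedBall _ _).prod (isCompact_univ_pi fun _ => hΛ)
  have hadj : ∀ i j : SysIdx J K M, ∃ C, ∀ p ∈ Metric.closedBall (0 : ℂ) Z ×ˢ univ.pi fun _ : Fin M => Λ,
      ‖(sysMatrix G p.2 p.1).adjugate i j‖ ≤ C := fun i j =>
    hcomp.exists_bound_of_continuousOn
      ((continuous_sysMatrix G).matrix_adjugate.matrix_elem i j).continuousOn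
  choose C₁ hC₁ using hadj
  obtain ⟨C₂, hC₂⟩ := hcomp.exists_bound_of_continuousOn
    (continuous_sysMatrix G).matrix_det.continuousOn
  set E := Real.exp (Z * max ρ b) with hE
  set Q : ℝ := (M + 1) * (E ^ 2 * √(max ρ b)) with hQ
  have hQ0 : 0 ≤ Q := by positivity
  set A : SysIdx J K M → ℝ := fun i => ∑ j, |C₁ i j| * Q with hA
  have hmax : 0 ≤ max ρ b := hρ.trans (le_max_left _ _)
  have hA0 : ∀ i, 0 ≤ A i := fun i => Finset.sum_nonneg fun j _ => by positivity
  refine ⟨∑ e : Fin K ⊕ Fin M, (E * (√(max ρ b) * A (Sum.inl (Sum.inl e)))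
    + E * (√(max ρ b) * A (Sum.inl (Sum.inr e))) + |C₂| * (1 / 2) * (2 * max ρ b * E ^ 2)),
    Finset.sum_nonneg fun e _ => ?_, fun ℓ hℓ hℓΛ z hz => ?_⟩
  · have := hA0 (Sum.inl (Sum.inl e))
    have := hA0 (Sum.inl (Sum.inr e))
    positivity
  have hZ : 0 ≤ Z := (norm_nonneg _).trans hz
  have hb' : ∀ m, ℓ m ≤ b := fun m => hb (hℓΛ m)
  have hmem : (z, ℓ) ∈ Metric.closedBall (0 : ℂ) Z ×ˢ univ.pi fun _ : Fin M => Λ :=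
    ⟨by simpa using hz, fun m _ => hℓΛ m⟩
  have hamp : ∀ i, ‖amplitude G ℓ ρ z i‖ ≤ A i := fun i => by
    refine norm_sum_le_of_le _ fun j _ => ?_
    rw [norm_smul]
    exact mul_le_mul ((hC₁ i j _ hmem).trans (le_abs_self _)) (norm_sysRhs_le G hρ hℓ hb' j hz)
      (norm_nonneg _) (abs_nonneg _)
  refine norm_sum_le_of_le _ fun e _ => ?_
  have hL0 := edgeLength_nonneg hρ hℓ e
  have hL1 := edgeLength_le (ρ := ρ) hb' e
  refine (ContinuousLinearMap.opNorm_comp_le _ _).trans ((mul_le_mul_of_nonneg_right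
    (norm_edgeIncl_le e) (norm_nonneg _)).trans ?_)
  rw [one_mul]
  have hexp : Real.exp (‖z‖ * edgeLength ℓ ρ e) ≤ E :=
    Real.exp_le_exp.2 (mul_le_mul hz hL1 hL0 hZ)
  have hone : ‖oneMap ℓ ρ e‖ ≤ √(max ρ b) := by
    rw [oneMap, ContinuousLinearMap.norm_toSpanSingleton]
    exact (norm_oneLp_le hL0).trans (Real.sqrt_le_sqrt hL1)
  have hwave : ∀ w : ℂ, ‖w‖ = ‖z‖ → ∀ i, ‖waveMul (edgeMeasure ℓ e) (edgeLength ℓ ρ e) w ∘L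
      oneMap ℓ ρ e ∘L amplitude G ℓ ρ z i‖ ≤ E * (√(max ρ b) * A i) := by
    intro w hw i
    have h1 := norm_waveMul_le (edgeMeasure ℓ e) (edgeLength ℓ ρ e) w
    rw [hw] at h1
    refine (ContinuousLinearMap.opNorm_comp_le _ _).trans (mul_le_mul (h1.trans hexp) ?_
      (norm_nonneg _) (Real.exp_pos _).le)
    exact (ContinuousLinearMap.opNorm_comp_le _ _).trans (mul_le_mul hone (hamp i)
      (norm_nonneg _) (Real.sqrt_nonneg _))
  refine (norm_add_le _ _).trans (add_le_add ((norm_add_le _ _).trans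
    (add_le_add (hwave z rfl _) (hwave (-z) (norm_neg z) _))) ?_)
  rw [norm_smul, norm_mul]
  have h2 : ‖initialSol hL0 (Icc_edgeLength_subset ℓ ρ e) z ∘L edgeProj ℓ e‖
      ≤ 2 * max ρ b * E ^ 2 := by
    refine (ContinuousLinearMap.opNorm_comp_le _ _).trans ?_
    refine (mul_le_mul (norm_initialSol_le hL0 _ z) (norm_edgeProj_le e) (norm_nonneg _)
      (by positivity)).trans ?_
    rw [mul_one]
    gcongr
  have h3 : ‖(sysMatrix G ℓ z).det‖ * ‖Complex.I / 2‖ ≤ |C₂| * (1 / 2) :=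
    mul_le_mul ((hC₂ _ hmem).trans (le_abs_self _)) (by simp) (norm_nonneg _) (abs_nonneg _)
  exact mul_le_mul h3 h2 (norm_nonneg _) (by positivity)

end bounds

/-! ### Locality of the Hamiltonian -/

section truncated

variable {J K M : ℕ} {G : LeadGraph J K M} {ℓ : Fin M → ℝ}

/-- Where a primitive on the half line vanishes, its integrand vanishes. -/
theorem ae_zero_of_primitive_Ioi {v w : ℝ → ℂ} {R : ℝ} (hR : 0 ≤ R)
    (hw : MemLp w 2 (volume.restrict (Ici 0))) (hv : ∀ᵐ x, R < x → v x = 0)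
    (h : ∀ x ∈ Ici (0 : ℝ), v x = v 0 + ∫ t in (0 : ℝ)..x, w t) : ∀ᵐ x, R < x → w x = 0 := by
  -- With this extension the primitive is continuous on the whole line, so vanishing almost
  -- everywhere beyond `R` improves to vanishing identically there; Lebesgue differentiation then
  -- gives the integrand.
  set W : ℝ → ℂ := (Ici 0).indicator w with hW
  have hWL : MemLp W 2 volume := (memLp_indicator_iff_restrict measurableSet_Ici).2 hw
  have hWloc : LocallyIntegrable W volume := MemLp.locallyIntegrable hWL (by norm_num)
  have hWint : ∀ a b, IntervalIntegrable W volume a b := fun a b =>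
    ((LocallyIntegrable.integrableOn_isCompact hWloc isCompact_uIcc).intervalIntegrable)
  set V : ℝ → ℂ := fun x => v 0 + ∫ t in (0 : ℝ)..x, W t with hV
  have hVc : Continuous V := continuous_const.add (intervalIntegral.continuous_primitive hWint 0)
  have hVv : ∀ x, 0 ≤ x → V x = v x := by
    intro x hx
    rw [h x hx, hV]
    simp only
    congr 1
    apply intervalIntegral.integral_congr
    intro t ht
    rw [uIcc_of_le hx] at ht
    exact indicator_of_mem ht.1 w
  have hV0 : V =ᵐ[volume.restrict (Ioi R)] 0 := by
    rw [EventuallyEq, ae_restrict_iff' measurableSet_Ioi]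
    filter_upwards [hv] with x hx hxR
    have hxR' : R < x := hxR
    rw [hVv x (by linarith), hx hxR, Pi.zero_apply]
  have hV1 : EqOn V 0 (Ioi R) :=
    Measure.eqOn_open_of_ae_eq hV0 isOpen_Ioi hVc.continuousOn continuousOn_const
  filter_upwards [LocallyIntegrable.ae_hasDerivAt_integral hWloc] with x hx hxR
  have hd := (hx 0).const_add (v 0)
  have hz : HasDerivAt V 0 x := by
    refine (hasDerivAt_const x (0 : ℂ)).congr_of_eventuallyEq ?_
    filter_upwards [Ioi_mem_nhds hxR] with y hy using hV1 hy
  have h1 : W x = 0 := hd.unique hz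
  have hx0 : x ∈ Ici (0 : ℝ) := hR.trans hxR.le
  rwa [hW, indicator_of_mem hx0] at h1

theorem cutoff_eq_self {R : ℝ} {u : L2 K ℓ} (hu : u ∈ truncatedSpace ℓ R) : cutoff ℓ R u = u := by
  ext1 e
  apply Lp.ext
  filter_upwards [coeFn_cutoff R u e, hu e] with x h1 h2
  rw [h1]
  by_cases hx : x ∈ truncatedEdge ℓ R e
  · rw [indicator_of_mem hx]
  · rw [indicator_of_notMem hx, h2 hx]

/-- The Hamiltonian is local: it maps truncated functions to truncated functions. -/
theorem mem_truncatedSpace_of_hamiltonianRel {R : ℝ} (hR : 0 ≤ R) {u f : L2 K ℓ}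
    (h : HamiltonianRel G ℓ u f) (hu : u ∈ truncatedSpace ℓ R) : f ∈ truncatedSpace ℓ R := by
  obtain ⟨U, U', U'', hr⟩ := hamiltonianRel_iff.1 h
  rintro (k | m)
  · have h2 := hr.isH2 (Sum.inl k)
    have hU : ∀ᵐ x, R < x → U (Sum.inl k) x = 0 := by
      have h3 := (ae_restrict_iff' measurableSet_Ici).1 (hr.coe_eq (Sum.inl k))
      have h4 := (ae_restrict_iff' measurableSet_Ici).1 (hu (Sum.inl k))
      filter_upwards [h3, h4] with x h3 h4 hx
      have hx0 : x ∈ Ici (0 : ℝ) := hR.trans hx.le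
      rw [← h3 hx0]
      exact h4 hx0 fun hc => absurd hc.2 (not_le.2 hx)
    have hU' := ae_zero_of_primitive_Ioi hR h2.memLp' hU h2.eq_integral
    have hU'' := ae_zero_of_primitive_Ioi hR h2.memLp'' hU' h2.eq_integral'
    filter_upwards [hr.coe_eq'' (Sum.inl k), ae_restrict_of_ae hU'',
      ae_restrict_mem measurableSet_Ici] with x h3 h4 h5 h6
    have hx : R < x := by
      by_contra! hc
      exact h6 ⟨h5, hc⟩
    rw [h3, h4 hx, neg_zero]
  · filter_upwards [ae_restrict_mem (measurableSet_edgeSet ℓ (Sum.inr m))] with x h1 h2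
    exact absurd h1 h2

/-- Both `u` and `P u` live in the truncated graph. Hence the cutoff to the right of the resolvent
leaves the error of the quasimode unchanged. -/
theorem cutoff_quasimode {R : ℝ} (hR : 0 ≤ R) {u f : L2 K ℓ} (h : HamiltonianRel G ℓ u f)
    (hu : u ∈ truncatedSpace ℓ R) (a : ℂ) : cutoff ℓ R (f - a • u) = f - a • u := by
  rw [map_sub, map_smul, cutoff_eq_self hu,
    cutoff_eq_self (mem_truncatedSpace_of_hamiltonianRel hR h hu)]

end truncated

end QGraph
end

/-! ### From a disc without resonances to a contradiction -/

noncomputable section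
namespace QGraph
open Topology Filter

variable {J K M : ℕ} {G : LeadGraph J K M} {ℓ : Fin M → ℝ}

/-- A meromorphic quotient without poles in a set extends analytically over the zeros of
its denominator. -/
theorem exists_differentiableOn_eq_quotient {E : Type*} [NormedAddCommGroup E] [NormedSpace ℂ E]
    [CompleteSpace E] {H : ℂ → E} {D : ℂ → ℂ} (hH : Differentiable ℂ H) (hD : Differentiable ℂ D)
    {U : Set ℂ} (hmer : MeromorphicOn (fun z => (D z)⁻¹ • H z) U)
    (hord : ∀ z ∈ U, 0 ≤ meromorphicOrderAt (fun z => (D z)⁻¹ • H z) z) :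
    ∃ A : ℂ → E, DifferentiableOn ℂ A U ∧ ∀ z ∈ U, D z ≠ 0 → A z = (D z)⁻¹ • H z := by
  -- At a zero of `D` the quotient takes the default value `0`, so it may be discontinuous even at a
  -- removable singularity. The meromorphic normal form repairs these values and changes nothing
  -- where `D z ≠ 0`.
  set F : ℂ → E := fun z => (D z)⁻¹ • H z with hF
  have han : ∀ z ∈ U, AnalyticAt ℂ (toMeromorphicNFOn F U) z := fun z hz => by
    refine (meromorphicNFOn_toMeromorphicNFOn F U hz).meromorphicOrderAt_nonneg_iff_analyticAt.1 ?_
    rw [meromorphicOrderAt_toMeromorphicNFOn hmer hz]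
    exact hord z hz
  refine ⟨toMeromorphicNFOn F U, fun z hz => (han z hz).differentiableAt.differentiableWithinAt,
    fun z hz hDz => ?_⟩
  have h1 : Tendsto F (𝓝[≠] z) (𝓝 (F z)) :=
    ((((hD z).continuousAt.inv₀ hDz).smul (hH z).continuousAt : ContinuousAt F z)).tendsto.mono_left
      nhdsWithin_le_nhds
  have h2 : Tendsto (toMeromorphicNFOn F U) (𝓝[≠] z) (𝓝 (toMeromorphicNFOn F U z)) :=
    (han z hz).continuousAt.tendsto.mono_left nhdsWithin_le_nhds
  exact tendsto_nhds_unique (h2.congr' (hmer.toMeromorphicNFOn_eq_self_on_nhdsNE hz)) h1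

/-- The cut-off resolvent extends analytically to every set without resonances. -/
theorem exists_differentiableOn_eq_continued {R : ℝ} (hR : 0 < R) (hℓ : ∀ m, 0 < ℓ m)
    {U : Set ℂ} (hres : ∀ z ∈ U, z ∉ resonances G ℓ) :
    ∃ A : ℂ → (L2 K ℓ →L[ℂ] L2 K ℓ), DifferentiableOn ℂ A U ∧
      ∀ z ∈ U, denom G ℓ z ≠ 0 → A z = continued G hR.le hℓ z :=
  exists_differentiableOn_eq_quotient (differentiable_numer G hR.le hℓ) (differentiable_denom G ℓ)
    ((meromorphicOn_continued G hR.le hℓ).mono_set (subset_univ U))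
    fun z hz => not_lt.1 fun h =>
      hres z hz ⟨R, hR, _, isCutoffContinuation_continued G hR.le hℓ, h⟩

/-- The resolvent in the upper half-plane reproduces a compactly supported function. -/
theorem continued_apply_quasimode {R : ℝ} (hR : 0 < R) (hℓ : ∀ m, 0 < ℓ m)
    (u : (hamiltonian G ℓ).domain) (hu : (u : L2 K ℓ) ∈ truncatedSpace ℓ R) {z : ℂ}
    (hz : 0 < z.im) :
    continued G hR.le hℓ z (hamiltonian G ℓ u - z ^ 2 • (u : L2 K ℓ)) = u := by
  obtain ⟨B, -, -, hB, hF⟩ := exists_resolvent_and_continued_eq G hR.le hℓ hz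
  have hrel := hamiltonianRel_coe u
  rw [hF, ContinuousLinearMap.comp_apply, ContinuousLinearMap.comp_apply,
    cutoff_quasimode hR.le hrel hu, hB u _ (by simpa using hrel), cutoff_eq_self hu]

theorem norm_continued_le {R : ℝ} (hR : 0 < R) (hℓ : ∀ m, 0 < ℓ m) {z : ℂ} (hz : 0 < z.im) :
    ‖continued G hR.le hℓ z‖ ≤ 1 / (‖z‖ * z.im) := by
  obtain ⟨B, -, hB, -, hF⟩ := exists_resolvent_and_continued_eq G hR.le hℓ hz
  rw [hF]
  refine (ContinuousLinearMap.opNorm_comp_le _ _).trans ?_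
  have h1 : ‖cutoff (K := K) ℓ R‖ ≤ 1 := norm_cutoff_le R
  have h2 : ‖B ∘L cutoff ℓ R‖ ≤ ‖B‖ * 1 :=
    (ContinuousLinearMap.opNorm_comp_le _ _).trans
      (mul_le_mul_of_nonneg_left h1 (norm_nonneg _))
  calc _ ≤ 1 * (‖B‖ * 1) := mul_le_mul h1 h2 (norm_nonneg _) zero_le_one
    _ ≤ _ := by linarith

/-- An analytic continuation of the cut-off resolvent to a disc centred on the real axis
reproduces a quasimode at the centre. -/
theorem apply_quasimode_of_eq_continued {R : ℝ} (hR : 0 < R) (hℓ : ∀ m, 0 < ℓ m)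
    (u : (hamiltonian G ℓ).domain) (hu : (u : L2 K ℓ) ∈ truncatedSpace ℓ R) {x r : ℝ} (hr : 0 < r)
    {A : ℂ → (L2 K ℓ →L[ℂ] L2 K ℓ)} (hA : DifferentiableOn ℂ A (Metric.ball (x : ℂ) r))
    (hAF : ∀ z ∈ Metric.ball (x : ℂ) r, denom G ℓ z ≠ 0 → A z = continued G hR.le hℓ z) :
    A x (hamiltonian G ℓ u - (x : ℂ) ^ 2 • (u : L2 K ℓ)) = u := by
  have hd : DifferentiableOn ℂ
      (fun z => A z (hamiltonian G ℓ u - z ^ 2 • (u : L2 K ℓ)) - (u : L2 K ℓ))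
      (Metric.ball (x : ℂ) r) := by
    refine (hA.clm_apply ?_).sub_const _
    exact (Differentiable.differentiableOn (by fun_prop))
  have hz1 : (x : ℂ) + (r / 2 : ℝ) * Complex.I ∈ Metric.ball (x : ℂ) r := by
    rw [mem_ball_iff_norm, add_sub_cancel_left, norm_mul, Complex.norm_I, Complex.norm_real,
      Real.norm_of_nonneg (by positivity)]
    linarith
  -- Near `x + i r / 2`, in the upper half of the disc, `A` is the true cut-off resolvent; the
  -- identity theorem carries the relation to the real centre.
  have hev : (fun z => A z (hamiltonian G ℓ u - z ^ 2 • (u : L2 K ℓ)) - (u : L2 K ℓ))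
      =ᶠ[𝓝 ((x : ℂ) + (r / 2 : ℝ) * Complex.I)] 0 := by
    have him : IsOpen {z : ℂ | 0 < z.im} := isOpen_lt continuous_const Complex.continuous_im
    filter_upwards [Metric.isOpen_ball.mem_nhds hz1,
      him.mem_nhds (show 0 < ((x : ℂ) + (r / 2 : ℝ) * Complex.I).im by simpa using hr)]
      with z hz hz0
    rw [hAF z hz (denom_ne_zero hℓ hz0), continued_apply_quasimode hR hℓ u hu hz0, sub_self]
    rfl
  have h := (hd.analyticOnNhd Metric.isOpen_ball).eqOn_zero_of_preconnected_of_eventuallyEq_zero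
    (convex_ball _ _).isPreconnected hz1 hev (Metric.mem_ball_self hr)
  exact sub_eq_zero.1 h

/-- A polynomial bound for the continued resolvent near the real axis, in discs without
resonances, uniform in the edge lengths. -/
theorem exists_polynomial_bound (G : LeadGraph J K M) {Λ : Set ℝ} (hΛ : IsCompact Λ)
    (hΛpos : Λ ⊆ Ioi 0) {I : Set ℝ} (hI : IsCompact I) {R : ℝ} (hR : 0 < R) :
    ∃ (N : ℕ) (C r₀ : ℝ), 0 ≤ C ∧ 0 < r₀ ∧ ∀ (ℓ : Fin M → ℝ) (hℓ : ∀ m, 0 < ℓ m),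
      (∀ m, ℓ m ∈ Λ) → ∀ x ∈ I, ∀ r, 0 < r → r ≤ r₀ →
      ∀ A : ℂ → (L2 K ℓ →L[ℂ] L2 K ℓ), DifferentiableOn ℂ A (Metric.ball (x : ℂ) r) →
      (∀ z ∈ Metric.ball (x : ℂ) r, denom G ℓ z ≠ 0 → A z = continued G hR.le hℓ z) →
      ∀ z ∈ Metric.closedBall (x : ℂ) (r / 2), ‖A z‖ ≤ C * (r ^ N)⁻¹ := by
  obtain ⟨b, hb⟩ := hI.isBounded.exists_norm_le
  obtain ⟨N, c, r₀, hc, hr₀, hr₁, hcircle⟩ := exists_uniform_circle (continuous_denom G)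
    (fun ℓ => differentiable_denom G ℓ)
    (S := (Complex.ofReal '' I) ×ˢ (univ.pi fun _ : Fin M => Λ))
    ((hI.image Complex.continuous_ofReal).prod (isCompact_univ_pi fun _ => hΛ))
    -- Invertibility in the upper half plane, at the point `i`, excludes that `denom` vanishes
    -- identically for some lengths.
    (fun p hp => ⟨Complex.I, denom_ne_zero (fun m => hΛpos (hp.2 m (mem_univ m))) (by simp)⟩)
  -- `b` bounds the centres and the radii are at most `1`, so `b + 1` bounds all `z` on the circles.
  obtain ⟨C, hC, hCb⟩ := exists_bound_numer G hΛ hR.le (b + 1)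
  refine ⟨N, C / c, r₀, by positivity, hr₀, fun ℓ hℓ hℓΛ x hx r hr hrr A hA hAF => ?_⟩
  obtain ⟨s, ⟨hs1, hs2⟩, hs⟩ := hcircle ((x : ℂ), ℓ) ⟨⟨x, hx, rfl⟩, fun m _ => hℓΛ m⟩ r hr hrr
  have hs0 : 0 < s := by linarith
  have hbd : ∀ z ∈ frontier (Metric.ball (x : ℂ) s), ‖A z‖ ≤ C / c * (r ^ N)⁻¹ := by
    intro z hz
    rw [frontier_ball _ hs0.ne'] at hz
    have h1 := hs z hz
    have hzx : ‖z - x‖ = s := by rwa [mem_sphere_iff_norm] at hz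
    have hpos : 0 < c * r ^ N := by positivity
    have hD : denom G ℓ z ≠ 0 := norm_pos_iff.1 (hpos.trans_le h1)
    have hzn : ‖z‖ ≤ b + 1 := by
      have h2 := norm_add_le (z - x) (x : ℂ)
      have h3 := hb x hx
      rw [sub_add_cancel, Complex.norm_real] at h2
      linarith
    rw [hAF z (by rw [mem_ball_iff_norm]; linarith) hD, continued, norm_smul, norm_inv]
    calc ‖denom G ℓ z‖⁻¹ * ‖numer G hR.le hℓ z‖ ≤ (c * r ^ N)⁻¹ * C :=
          mul_le_mul (inv_anti₀ hpos h1) (hCb ℓ hℓ hℓΛ z hzn) (norm_nonneg _) (by positivity)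
      _ = _ := by rw [mul_inv]; ring
  intro z hz
  -- `denom` may vanish inside the circle, but `A` is analytic there. The circle encloses the closed
  -- disc of radius `r / 2` since `r / 2 < s`.
  refine Complex.norm_le_of_forall_mem_frontier_norm_le Metric.isBounded_ball
    (DifferentiableOn.diffContOnCl (hA.mono ?_)) hbd ?_
  · rw [closure_ball _ hs0.ne']
    exact Metric.closedBall_subset_ball hs2
  · rw [closure_ball _ hs0.ne']
    exact Metric.closedBall_subset_closedBall hs1.le hz

/-- In a disc without resonances whose radius is a fixed power of `ε`, the continued resolvent at
the centre is smaller than `ε⁻¹`. -/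
theorem exists_quasimode_threshold (G : LeadGraph J K M) {Λ : Set ℝ} (hΛ : IsCompact Λ)
    (hΛpos : Λ ⊆ Ioi 0) {I : Set ℝ} (hI : IsCompact I) (hIpos : I ⊆ Ioi 0) {R : ℝ} (hR : 0 < R)
    {γ : ℝ} (hγ0 : 0 < γ) (hγ : γ < 1) :
    ∃ ε₀ : ℝ, 0 < ε₀ ∧ ∀ ℓ : Fin M → ℝ, (∀ m, ℓ m ∈ Λ) →
      ∀ (u : (hamiltonian G ℓ).domain) (x ε : ℝ), (u : L2 K ℓ) ∈ truncatedSpace ℓ R → x ∈ I →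
        ‖(u : L2 K ℓ)‖ = 1 → ‖hamiltonian G ℓ u - (x : ℂ) ^ 2 • (u : L2 K ℓ)‖ = ε →
        0 < ε → ε < ε₀ → (resonances G ℓ ∩ Metric.ball (x : ℂ) (ε ^ γ)).Nonempty := by
  obtain ⟨a, ha, haI⟩ : ∃ a > 0, ∀ x ∈ I, a ≤ x := by
    rcases I.eq_empty_or_nonempty with rfl | hne
    · exact ⟨1, one_pos, by simp⟩
    · obtain ⟨a, haI, ha⟩ := hI.exists_isLeast hne
      exact ⟨a, hIpos haI, ha⟩
  obtain ⟨N, C₁, r₁, hC₁, hr₁, hpoly⟩ := exists_polynomial_bound G hΛ hΛpos hI hR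
  -- `2 / a` comes from the resolvent estimate: `r < a` gives `‖z‖ ≥ a / 2` on the closed disc of
  -- radius `r / 2` about `x ≥ a`.
  set C := max C₁ (2 / a) with hCdef
  have hC : 0 ≤ C := hC₁.trans (le_max_left _ _)
  -- With this `η` one has `γ (1 + 2η) = 1 - (1 - γ) / 2`, so for `r = ε ^ γ` the maximum principle
  -- bounds `‖A x‖ ε` by a constant times `ε ^ ((1 - γ) / 2)`.
  have hη : 0 < (1 - γ) / (4 * γ) := by
    have : 0 < 1 - γ := by linarith
    positivity
  obtain ⟨r₂, hr₂, hmax⟩ := semiclassical_maximum_principle N C hC hη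
  have hlim : ∀ p : ℝ, 0 < p → Tendsto (fun ε : ℝ => ε ^ p) (𝓝[>] 0) (𝓝 0) := fun p hp => by
    have := (Real.continuousAt_rpow_const 0 p (Or.inr hp.le)).tendsto
    rw [Real.zero_rpow hp.ne'] at this
    exact this.mono_left nhdsWithin_le_nhds
  have hsmall : ∀ᶠ ε : ℝ in 𝓝[>] 0, ε ^ γ < min r₁ (min r₂ a) ∧
      Real.exp 2 * C * ε ^ ((1 - γ) / 2) < 1 := by
    refine ((hlim γ hγ0).eventually_lt_const (by positivity)).and ?_
    have h := (hlim ((1 - γ) / 2) (by linarith)).const_mul (Real.exp 2 * C)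
    rw [mul_zero] at h
    exact h.eventually_lt_const one_pos
  obtain ⟨ε₀, hε₀, hsub⟩ := mem_nhdsGT_iff_exists_Ioo_subset.1 hsmall
  refine ⟨ε₀, hε₀, fun ℓ hℓΛ u x ε hu hx hu1 hε hεpos hεlt => ?_⟩
  obtain ⟨hr, hlt⟩ := hsub ⟨hεpos, hεlt⟩
  have hℓ : ∀ m, 0 < ℓ m := fun m => hΛpos (hℓΛ m)
  set r := ε ^ γ with hrdef
  have hr0 : 0 < r := Real.rpow_pos_of_pos hεpos γ
  obtain ⟨hrr₁, hrr₂, hra⟩ : r < r₁ ∧ r < r₂ ∧ r < a := by simpa only [lt_min_iff] using hr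
  by_contra hcon
  have hres : ∀ z ∈ Metric.ball (x : ℂ) r, z ∉ resonances G ℓ :=
    fun z hz h => hcon ⟨z, h, hz⟩
  obtain ⟨A, hA, hAF⟩ := exists_differentiableOn_eq_continued hR hℓ hres
  have hbound : ‖A x‖ ≤ Real.exp 2 * C / r ^ (1 + 2 * ((1 - γ) / (4 * γ))) := by
    refine hmax _ A x r hr0 hrr₂ hA (fun z hz => ?_) (fun z hz hz0 => ?_)
    · exact (hpoly ℓ hℓ hℓΛ x hx r hr0 hrr₁.le A hA hAF z hz).trans
        (mul_le_mul_of_nonneg_right (le_max_left _ _) (by positivity))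
    · have hzx : ‖z - x‖ ≤ r / 2 := by rwa [mem_closedBall_iff_norm] at hz
      rw [hAF z (by rw [mem_ball_iff_norm]; linarith) (denom_ne_zero hℓ hz0)]
      have hzn : a / 2 ≤ ‖z‖ := by
        have h2 := norm_sub_norm_le (x : ℂ) z
        rw [norm_sub_rev, Complex.norm_real] at h2
        have h3 := Real.le_norm_self x
        have h4 := haI x hx
        linarith
      calc _ ≤ 1 / (‖z‖ * z.im) := norm_continued_le hR hℓ hz0
        _ ≤ 1 / (a / 2 * z.im) := by gcongr
        _ = 2 / a / z.im := by field_simp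
        _ ≤ _ := by gcongr; exact le_max_right _ _
  have hid := apply_quasimode_of_eq_continued hR hℓ u hu hr0 hA hAF
  -- The normalised quasimode makes the continued resolvent at least as large as `1 / ε`.
  have hone : 1 ≤ ‖A x‖ * ε := by
    have h := (A x).le_opNorm (hamiltonian G ℓ u - (x : ℂ) ^ 2 • (u : L2 K ℓ))
    rwa [hid, hu1, hε] at h
  have hpow : r ^ (1 + 2 * ((1 - γ) / (4 * γ))) = ε / ε ^ ((1 - γ) / 2) := by
    have h1 : γ * (1 + 2 * ((1 - γ) / (4 * γ))) = 1 - (1 - γ) / 2 := by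
      field_simp
      ring
    rw [hrdef, ← Real.rpow_mul hεpos.le, h1, Real.rpow_sub hεpos, Real.rpow_one]
  have hq : 0 < ε ^ ((1 - γ) / 2) := Real.rpow_pos_of_pos hεpos _
  rw [hpow] at hbound
  have : ‖A x‖ * ε ≤ Real.exp 2 * C * ε ^ ((1 - γ) / 2) := by
    calc ‖A x‖ * ε ≤ Real.exp 2 * C / (ε / ε ^ ((1 - γ) / 2)) * ε :=
          mul_le_mul_of_nonneg_right hbound hεpos.le
      _ = _ := by field_simp
  linarith

theorem finite_leadGraph (J K M : ℕ) : Finite (LeadGraph J K M) :=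
  Finite.of_injective
    (fun G : LeadGraph J K M => (G.leadVertex, G.source, G.target)) fun G G' h => by
      cases G
      cases G'
      simp_all

end QGraph
end

theorem theorem2 (J K M : ℕ) (hK : 0 < K)
    (Λ : Set ℝ) (hΛ : IsCompact Λ) (hΛpos : Λ ⊆ Set.Ioi 0)
    (I : Set ℝ) (hI : IsCompact I) (hIpos : I ⊆ Set.Ioi 0)
    (R : ℝ) (hR : 0 < R) (γ : ℝ) (hγ : γ < 1) :
    ∃ ε₀ : ℝ, 0 < ε₀ ∧
      ∀ (G : LeadGraph J K M) (ℓ : Fin M → ℝ), (∀ m, ℓ m ∈ Λ) →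
        ∀ (u : (QGraph.hamiltonian G ℓ).domain) (lam₀ : ℝ) (ε : ℝ),
          (u : QGraph.L2 K ℓ) ∈ QGraph.truncatedSpace ℓ R → lam₀ ∈ I →
          ‖(u : QGraph.L2 K ℓ)‖ = 1 →
          ‖QGraph.hamiltonian G ℓ u - ((lam₀ : ℂ) ^ 2) • (u : QGraph.L2 K ℓ)‖ = ε →
          0 < ε → ε < ε₀ →
          (QGraph.resonances G ℓ ∩ Metric.ball (lam₀ : ℂ) (ε ^ γ)).Nonempty := by
  -- The choice of `η` needs a positive exponent. For `ε < 1` a larger exponent gives a smaller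
  -- disc, so `γ` may be replaced by `max γ (1 / 2)`; this is why the threshold is also capped by
  -- `1`.
  have hγ' : max γ (1 / 2) < 1 := max_lt hγ (by norm_num)
  have hγ0 : 0 < max γ (1 / 2) := lt_max_of_lt_right (by norm_num)
  choose δ hδ hmain using fun G : LeadGraph J K M =>
    QGraph.exists_quasimode_threshold G hΛ hΛpos hI hIpos hR hγ0 hγ'
  -- Uniformity over graphs is a minimum over finitely many thresholds.
  have := QGraph.finite_leadGraph J K M
  obtain ⟨δ₀, hδ₀, hδle⟩ : ∃ δ₀ > 0, ∀ G, δ₀ ≤ δ G := by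
    rcases isEmpty_or_nonempty (LeadGraph J K M) with h | h
    · exact ⟨1, one_pos, fun G => h.elim G⟩
    · obtain ⟨G₀, hG₀⟩ := Finite.exists_min δ
      exact ⟨δ G₀, hδ G₀, hG₀⟩
  refine ⟨min δ₀ 1, lt_min hδ₀ one_pos, fun G ℓ hℓ u x ε hu hx hu1 hε hε0 hεlt => ?_⟩
  obtain ⟨h1, h2⟩ := lt_min_iff.1 hεlt
  refine (hmain G ℓ hℓ u x ε hu hx hu1 hε hε0 (h1.trans_le (hδle G))).mono
    (inter_subset_inter_right _ (Metric.ball_subset_ball ?_))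
  exact Real.rpow_le_rpow_of_exponent_ge hε0 h2.le (le_max_left _ _)
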